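/- Let $N_d\ge 1$, $N_r\ge 1$, $N_s\ge N_d$ be integers; let $\bar H_{sr}\in\mathbb C^{N_r\times N_s}$ and $\bar H_{rd}\in\mathbb C^{N_d\times N_r}$ be the estimated channels, $\Sigma_{sr}\in\mathbb C^{N_r\times N_r}$, $\Sigma_{rd}\in\mathbb C^{N_d\times N_d}$ Hermitian positive semidefinite (receive-side error covariances), $T$ an $N_d\times N_d$ permutation matrix, and $\sigma_s,\sigma_{n_{sr}},\sigma_{n_{rd}},P_s,P_r>0$. Write $\bar H_{rd}^{T}=T\bar H_{rd}$, $\hat\Sigma_{rd}=T\Sigma_{rd}T^H$. The transmit-side error covariances are $\Psi_{sr}=I$, $\Psi_{rd}=I$. For $F_s\in\mathbb C^{N_s\times N_d}$, $F_r\in\mathbb C^{N_r\times N_r}$ put $$\alpha_1=\operatorname{tr}(F_sF_s^H\Psi_{sr}^T),\quad R=\sigma_s^2\bar H_{sr}F_sF_s^H\bar H_{sr}^H+\sigma_s^2\alpha_1\Sigma_{sr}+\sigma_{n_{sr}}^2I,\quad \alpha_2=\operatorname{tr}(F_rRF_r^H\Psi_{rd}^T),$$ $$B=\bar H_{rd}^TF_r(\sigma_s^2\alpha_1\Sigma_{sr}+\sigma_{n_{sr}}^2I)F_r^H(\bar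 H_{rd}^T)^H+\alpha_2\hat\Sigma_{rd}+\sigma_{n_{rd}}^2I,\quad \bar H=\bar H_{rd}^TF_r\bar H_{sr}.$$ Consider the problem (P) of minimizing $$J(F_s,F_r)=\left|\left(\sigma_s^{-2}I+F_s^H\bar H^HB^{-1}\bar HF_s\right)^{-1}\right|\quad\text{subject to}\quad \operatorname{tr}(\sigma_s^2F_sF_s^H)\le P_s,\quad \operatorname{tr}(F_rRF_r^H)\le P_r .$$ Fix any eigenvalue decompositions $\Sigma_{sr}=U_{\Sigma_{sr}}\Lambda_{\Sigma_{sr}}U_{\Sigma_{sr}}^H$, $\hat\Sigma_{rd}=U_{\Sigma_{rd}}\Lambda_{\Sigma_{rd}}U_{\Sigma_{rd}}^H$ and set $\tilde\Lambda_{\Sigma_{sr}}=\sigma_s^2\frac{P_s}{\sigma_s^2}\Lambda_{\Sigma_{sr}}+\sigma_{n_{sr}}^2I$, $\tilde\Lambda_{\Sigma_{rd}}=P_r\Lambda_{\Sigma_{rd}}+\sigma_{n_{rd}}^2I$. Consider singular value decompositions, with singular values in nonincreasing order, $$\tilde\Lambda_{\Sigma_{sr}}^{-1/2}U_{\Sigma_{sr}}^H\bar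 H_{sr}=\tilde U_{sr}\tilde\Lambda_{sr}\tilde V_{sr}^H,\qquad \tilde\Lambda_{\Sigma_{rd}}^{-1/2}U_{\Sigma_{rd}}^H\bar H_{rd}^T=\tilde U_{rd}\tilde\Lambda_{rd}\tilde V_{rd}^H,$$ and let $\tilde\lambda_{1,i},\tilde\lambda_{2,i}$ ($1\le i\le N_d$) be the singular values, continued by $0$ where the matrix has no $i$-th diagonal entry. For real vectors $(\lambda_{s,i})_{i\le N_d}$, $(\lambda_{r,i})_{i\le N_d}$ and unitary $\Phi_s\in\mathbb C^{N_d\times N_d}$ put $$(*)\qquad F_s=\tilde V_{sr}\Lambda_s\Phi_s,\qquad F_r=\tilde V_{rd}\Lambda_r\tilde U_{sr}^H\tilde\Lambda_{\Sigma_{sr}}^{-1/2}U_{\Sigma_{sr}}^H,$$ where $\Lambda_s$ ($N_s\times N_d$) and $\Lambda_r$ ($N_r\times N_r$) are diagonal with diagonal entries $\lambda_{s,i}$ and $\lambda_{r,i}$ (padded with zeros or truncated to fit; if $N_r<N_d$, call $\lambda_r$ admissible when $\lambda_{r,i}=0$ for $i>N_r$; otherwise every $\lambda_r$ is admissible). Let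 (S) be the scalar problem $$\min_{\lambda_s,\lambda_r}\ \prod_{i=1}^{N_d}\left(\sigma_s^{-2}+\frac{\tilde\lambda_{1,i}^2\tilde\lambda_{2,i}^2\lambda_{s,i}^2\lambda_{r,i}^2}{\tilde\lambda_{2,i}^2\lambda_{r,i}^2+1}\right)^{-1}\ \text{s.t.}\ \sum_{i=1}^{N_d}\sigma_s^2\lambda_{s,i}^2\le P_s,\ \ \sum_{i=1}^{N_d}\lambda_{r,i}^2(\sigma_s^2\lambda_{s,i}^2\tilde\lambda_{1,i}^2+1)\le P_r,$$ and (L) the problem, over $x,y\in[0,\infty)^{N_d}$, $$\max_{x,y}\ \sum_{i=1}^{N_d}\ln\frac{y_i\tilde\lambda_{2,i}^2x_i\tilde\lambda_{1,i}^2+y_i\tilde\lambda_{2,i}^2+x_i\tilde\lambda_{1,i}^2+1}{y_i\tilde\lambda_{2,i}^2+x_i\tilde\lambda_{1,i}^2+1}\quad\text{s.t.}\quad \sum_i x_i\le P_s,\ \ \sum_i y_i\le P_r .$$ Then: 1. (P) has a global minimizer with $\alpha_1=P_s/\sigma_s^2$ and $\alpha_2=P_r$. If $\bar H_{sr}\ne0$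 and $\bar H_{rd}\ne0$, then every global minimizer $(F_s,F_r)$ of (P) satisfies both power constraints with equality, with $\alpha_1=P_s/\sigma_s^2$, $\alpha_2=P_r$, and has the form $(*)$ for some such singular value decompositions, some unitary $\Phi_s$, and some $\lambda_s,\lambda_r\ge0$ that minimize (S). 2. For every choice of such singular value decompositions: (a) there are $\lambda_s,\lambda_r\ge 0$ that minimize (S), with equality in both constraints of (S), such that for every unitary $\Phi_s$ the pair $(*)$ is a global minimizer of (P) with $\alpha_1=P_s/\sigma_s^2$, $\alpha_2=P_r$; (b) for a pair $(*)$ with $\lambda_r$ admissible, the source power equals $\sum_i\sigma_s^2\lambda_{s,i}^2$; if this is $P_s$, the relay power equals $\sum_i\lambda_{r,i}^2(\sigma_s^2\lambda_{s,i}^2\tilde\lambda_{1,i}^2+1)$; if that in turn is $P_r$, then $J(F_s,F_r)$ equals the objective of (S); (c) if $(\lambda_s,\lambda_r)$ minimizes (S), then $(*)$ minimizes (P) for every unitary $\Phi_s$; conversely, if $\bar H_{sr}\ne0$, $\bar H_{rd}\neq0$, $\lambda_r$ is admissible and $(*)$ minimizes (P), then $(\lambda_s,\lambda_r)$ minimizes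 (S); (d) with $x_i=\sigma_s^2\lambda_{s,i}^2$ and $y_i=\lambda_{r,i}^2(\sigma_s^2\lambda_{s,i}^2\tilde\lambda_{1,i}^2+1)$, the objective of (S) equals $\sigma_s^{2N_d}$ times $\exp$ of minus the objective of (L); $(\lambda_s,\lambda_r)$ minimizes (S) if and only if $(x,y)$ maximizes (L); and every $x,y\in[0,\infty)^{N_d}$ arises in this way from some $\lambda_s,\lambda_r\ge0$. -/

import Mathlib

open Matrix
open scoped ComplexOrder

noncomputable section

/-- Data of the relay link for one branch: estimated channels, covariances of the channel
estimation errors on the receive side (`Sigma`) and transmit side (`Psi`), cancellation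
ordering, standard deviations of the symbols and of the noises, and power budgets. -/
structure RelayModel (Ns Nr Nd : ℕ) where
  Hsr : Matrix (Fin Nr) (Fin Ns) ℂ
  Hrd : Matrix (Fin Nd) (Fin Nr) ℂ
  Sigmasr : Matrix (Fin Nr) (Fin Nr) ℂ
  Sigmard : Matrix (Fin Nd) (Fin Nd) ℂ
  Psisr : Matrix (Fin Ns) (Fin Ns) ℂ
  Psird : Matrix (Fin Nr) (Fin Nr) ℂ
  order : Equiv.Perm (Fin Nd)
  σs : ℝ
  σnsr : ℝ
  σnrd : ℝ
  Ps : ℝ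
  Pr : ℝ

namespace RelayModel

variable {Ns Nr Nd : ℕ} (M : RelayModel Ns Nr Nd)

/-- The ordering transformation (permutation) matrix. -/
def T : Matrix (Fin Nd) (Fin Nd) ℂ := M.order.permMatrix ℂ

/-- The reordered estimated relay-to-destination channel. -/
def HrdT : Matrix (Fin Nd) (Fin Nr) ℂ := M.T * M.Hrd

/-- The reordered receive-side error covariance of the second hop. -/
def SigmardT : Matrix (Fin Nd) (Fin Nd) ℂ := M.T * M.Sigmard * M.Tᴴ

/-- `α₁ = tr(F_s F_sᴴ Ψ_srᵀ)`. -/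
def alpha1 (Fs : Matrix (Fin Ns) (Fin Nd) ℂ) : ℝ :=
  (trace (Fs * Fsᴴ * M.Psisrᵀ)).re

/-- `σ_s² α₁ Σ_sr + σ_nsr² I`. -/
def noiseCov (Fs : Matrix (Fin Ns) (Fin Nd) ℂ) : Matrix (Fin Nr) (Fin Nr) ℂ :=
  (M.σs ^ 2 * M.alpha1 Fs) • M.Sigmasr + (M.σnsr ^ 2) • (1 : Matrix (Fin Nr) (Fin Nr) ℂ)

/-- Covariance of the signal received at the relay,
`σ_s² H_sr F_s F_sᴴ H_srᴴ + σ_s² α₁ Σ_sr + σ_nsr² I`. -/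
def relayCov (Fs : Matrix (Fin Ns) (Fin Nd) ℂ) : Matrix (Fin Nr) (Fin Nr) ℂ :=
  (M.σs ^ 2) • (M.Hsr * Fs * Fsᴴ * M.Hsrᴴ) + M.noiseCov Fs

/-- `α₂ = tr(F_r (σ_s² H_sr F_s F_sᴴ H_srᴴ + σ_s² α₁ Σ_sr + σ_nsr² I) F_rᴴ Ψ_rdᵀ)`. -/
def alpha2 (Fs : Matrix (Fin Ns) (Fin Nd) ℂ) (Fr : Matrix (Fin Nr) (Fin Nr) ℂ) : ℝ :=
  (trace (Fr * M.relayCov Fs * Frᴴ * M.Psirdᵀ)).re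

/-- Power spent by the source. -/
def sourcePower (Fs : Matrix (Fin Ns) (Fin Nd) ℂ) : ℝ :=
  (trace ((M.σs ^ 2) • (Fs * Fsᴴ))).re

/-- (Expected) power spent by the relay. -/
def relayPower (Fs : Matrix (Fin Ns) (Fin Nd) ℂ) (Fr : Matrix (Fin Nr) (Fin Nr) ℂ) : ℝ :=
  (trace (Fr * M.relayCov Fs * Frᴴ)).re

/-- The effective noise covariance `B` at the destination. -/
def B (Fs : Matrix (Fin Ns) (Fin Nd) ℂ) (Fr : Matrix (Fin Nr) (Fin Nr) ℂ) :
    Matrix (Fin Nd) (Fin Nd) ℂ :=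
  M.HrdT * Fr * M.noiseCov Fs * Frᴴ * M.HrdTᴴ + (M.alpha2 Fs Fr) • M.SigmardT
    + (M.σnrd ^ 2) • (1 : Matrix (Fin Nd) (Fin Nd) ℂ)

/-- The effective estimated channel `H_rd F_r H_sr`. -/
def Hbar (Fr : Matrix (Fin Nr) (Fin Nr) ℂ) : Matrix (Fin Nd) (Fin Ns) ℂ :=
  M.HrdT * Fr * M.Hsr

/-- The determinant objective `|(σ_s⁻² I + F_sᴴ Hᴴ B⁻¹ H F_s)⁻¹|`, a positive real number. -/
def J (Fs : Matrix (Fin Ns) (Fin Nd) ℂ) (Fr : Matrix (Fin Nr) (Fin Nr) ℂ) : ℝ :=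
  (det (((M.σs ^ 2)⁻¹ • (1 : Matrix (Fin Nd) (Fin Nd) ℂ)
    + Fsᴴ * (M.Hbar Fr)ᴴ * (M.B Fs Fr)⁻¹ * M.Hbar Fr * Fs)⁻¹)).re

/-- The power constraints at the source and at the relay. -/
def Feasible (Fs : Matrix (Fin Ns) (Fin Nd) ℂ) (Fr : Matrix (Fin Nr) (Fin Nr) ℂ) : Prop :=
  M.sourcePower Fs ≤ M.Ps ∧ M.relayPower Fs Fr ≤ M.Pr

/-- A global minimizer of the determinant problem. -/
def IsOptimal (Fs : Matrix (Fin Ns) (Fin Nd) ℂ) (Fr : Matrix (Fin Nr) (Fin Nr) ℂ) : Prop :=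
  M.Feasible Fs Fr ∧ ∀ Fs' Fr', M.Feasible Fs' Fr' → M.J Fs Fr ≤ M.J Fs' Fr'

end RelayModel

/-- `S = U diag(d) Uᴴ` is an eigenvalue decomposition. -/
structure IsEVD {n : ℕ} (S U : Matrix (Fin n) (Fin n) ℂ) (d : Fin n → ℝ) : Prop where
  unitary : U ∈ unitaryGroup (Fin n) ℂ
  eq : S = U * diagonal (fun i => (d i : ℂ)) * Uᴴ

/-- The `m × n` rectangular diagonal matrix with diagonal entries `d 0, d 1, …`. -/
def rectDiag (m n : ℕ) (d : ℕ → ℝ) : Matrix (Fin m) (Fin n) ℂ :=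
  Matrix.of fun i j => if (i : ℕ) = (j : ℕ) then (d i : ℂ) else 0

/-- Extension of a finite vector by zeros. -/
def zeroExt {k : ℕ} (v : Fin k → ℝ) : ℕ → ℝ := fun i => if h : i < k then v ⟨i, h⟩ else 0

/-- `H = U diag(d) Vᴴ` is a (full) singular value decomposition with the singular values in
nonincreasing order; the sequence `d` is continued by zeros beyond `min m n`. -/
structure IsSVD {m n : ℕ} (H : Matrix (Fin m) (Fin n) ℂ) (U : Matrix (Fin m) (Fin m) ℂ)
    (d : ℕ → ℝ) (V : Matrix (Fin n) (Fin n) ℂ) : Prop where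
  unitary_left : U ∈ unitaryGroup (Fin m) ℂ
  unitary_right : V ∈ unitaryGroup (Fin n) ℂ
  antitone : Antitone d
  nonneg : ∀ i, 0 ≤ d i
  eq_zero : ∀ i, min m n ≤ i → d i = 0
  eq : H = U * rectDiag m n d * Vᴴ

/-- `diag(d)^{-1/2}` for a vector `d` of positive numbers. -/
def invSqrtDiag {n : ℕ} (d : Fin n → ℝ) : Matrix (Fin n) (Fin n) ℂ :=
  diagonal fun i => (((Real.sqrt (d i))⁻¹ : ℝ) : ℂ)

namespace RelayModel

variable {Ns Nr Nd : ℕ} (M : RelayModel Ns Nr Nd)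

/-- Eigenvalues of `σ_s² α₁ Σ_sr + σ_nsr² I` at `α₁ = P_s/σ_s²`,
where `d` are the eigenvalues of `Σ_sr`. -/
def eigSr (d : Fin Nr → ℝ) : Fin Nr → ℝ :=
  fun i => M.σs ^ 2 * (M.Ps / M.σs ^ 2) * d i + M.σnsr ^ 2

/-- Eigenvalues of `α₂ Σ̂_rd + σ_nrd² I` at `α₂ = P_r`,
where `d` are the eigenvalues of `Σ̂_rd`. -/
def eigRd (d : Fin Nd → ℝ) : Fin Nd → ℝ :=
  fun i => M.Pr * d i + M.σnrd ^ 2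

/-- The whitened first-hop channel, for an eigenvalue decomposition `(U, d)` of `Σ_sr`. -/
def whitenedSr (U : Matrix (Fin Nr) (Fin Nr) ℂ) (d : Fin Nr → ℝ) :
    Matrix (Fin Nr) (Fin Ns) ℂ :=
  invSqrtDiag (M.eigSr d) * Uᴴ * M.Hsr

/-- The whitened second-hop channel, for an eigenvalue decomposition `(U, d)` of `Σ̂_rd`. -/
def whitenedRd (U : Matrix (Fin Nd) (Fin Nd) ℂ) (d : Fin Nd → ℝ) :
    Matrix (Fin Nd) (Fin Nr) ℂ :=
  invSqrtDiag (M.eigRd d) * Uᴴ * M.HrdT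

/-- The source precoder `Ṽ_sr Λ_s Φ_s`. -/
def sourcePrecoder (V : Matrix (Fin Ns) (Fin Ns) ℂ) (ls : Fin Nd → ℝ)
    (Φ : Matrix (Fin Nd) (Fin Nd) ℂ) : Matrix (Fin Ns) (Fin Nd) ℂ :=
  V * rectDiag Ns Nd (zeroExt ls) * Φ

/-- The relay precoder `Ṽ_rd Λ_r Ũ_srᴴ Λ̃_Σsr^{-1/2} U_Σsrᴴ`, with the eigenvalue
decomposition `(U, d)` of `Σ_sr`. -/
def relayPrecoder (Vrd : Matrix (Fin Nr) (Fin Nr) ℂ) (lr : Fin Nd → ℝ)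
    (Usr : Matrix (Fin Nr) (Fin Nr) ℂ) (U : Matrix (Fin Nr) (Fin Nr) ℂ) (d : Fin Nr → ℝ) :
    Matrix (Fin Nr) (Fin Nr) ℂ :=
  Vrd * rectDiag Nr Nr (zeroExt lr) * Usrᴴ * invSqrtDiag (M.eigSr d) * Uᴴ

/-- Objective of the scalar power-allocation problem in the precoder gains;
`l1`, `l2` are the singular values of the whitened channels. -/
def scalarObj (l1 l2 : ℕ → ℝ) (ls lr : Fin Nd → ℝ) : ℝ :=
  ∏ i : Fin Nd, ((M.σs ^ 2)⁻¹ +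
    l1 i ^ 2 * l2 i ^ 2 * ls i ^ 2 * lr i ^ 2 / (l2 i ^ 2 * lr i ^ 2 + 1))⁻¹

/-- Source power in terms of the gains. -/
def scalarSourcePower (ls : Fin Nd → ℝ) : ℝ := ∑ i : Fin Nd, M.σs ^ 2 * ls i ^ 2

/-- Relay power in terms of the gains. -/
def scalarRelayPower (l1 : ℕ → ℝ) (ls lr : Fin Nd → ℝ) : ℝ :=
  ∑ i : Fin Nd, lr i ^ 2 * (M.σs ^ 2 * ls i ^ 2 * l1 i ^ 2 + 1)

/-- Constraints of the scalar power-allocation problem. -/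
def ScalarFeasible (l1 : ℕ → ℝ) (ls lr : Fin Nd → ℝ) : Prop :=
  M.scalarSourcePower ls ≤ M.Ps ∧ M.scalarRelayPower l1 ls lr ≤ M.Pr

/-- A global minimizer of the scalar power-allocation problem. -/
def IsScalarOptimal (l1 l2 : ℕ → ℝ) (ls lr : Fin Nd → ℝ) : Prop :=
  M.ScalarFeasible l1 ls lr ∧ ∀ ls' lr', M.ScalarFeasible l1 ls' lr' →
    M.scalarObj l1 l2 ls lr ≤ M.scalarObj l1 l2 ls' lr'

/-- `x_i = σ_s² λ_{s,i}²`. -/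
def xOf (ls : Fin Nd → ℝ) : Fin Nd → ℝ := fun i => M.σs ^ 2 * ls i ^ 2

/-- `y_i = λ_{r,i}² (σ_s² λ_{s,i}² λ_{1,i}² + 1)`. -/
def yOf (l1 : ℕ → ℝ) (ls lr : Fin Nd → ℝ) : Fin Nd → ℝ :=
  fun i => lr i ^ 2 * (M.σs ^ 2 * ls i ^ 2 * l1 i ^ 2 + 1)

/-- Objective of the logarithmic power-allocation problem. -/
def powerObj (l1 l2 : ℕ → ℝ) (x y : Fin Nd → ℝ) : ℝ :=
  ∑ i : Fin Nd, Real.log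
    ((y i * l2 i ^ 2 * x i * l1 i ^ 2 + y i * l2 i ^ 2 + x i * l1 i ^ 2 + 1) /
      (y i * l2 i ^ 2 + x i * l1 i ^ 2 + 1))

/-- Constraints of the logarithmic power-allocation problem. -/
def PowerFeasible (x y : Fin Nd → ℝ) : Prop :=
  (∀ i, 0 ≤ x i) ∧ (∀ i, 0 ≤ y i) ∧ ∑ i, x i ≤ M.Ps ∧ ∑ i, y i ≤ M.Pr

/-- A global maximizer of the logarithmic power-allocation problem. -/
def IsPowerOptimal (l1 l2 : ℕ → ℝ) (x y : Fin Nd → ℝ) : Prop :=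
  M.PowerFeasible x y ∧ ∀ x' y', M.PowerFeasible x' y' →
    powerObj l1 l2 x' y' ≤ powerObj l1 l2 x y

end RelayModel

end

/-! Whitening by the noise covariances at full power turns the design problem into a maximisation
over two Frobenius balls. Let `L * Lᴴ` and `L' * L'ᴴ` be these covariances, `P` and `Q` the whitened
channels, `F = σ_s F_s`, `C = 1 + (P F)(P F)ᴴ`, `Z = F_r L C^{1/2}` and `D = (Q Z)ᴴ(Q Z)`. For a
pair spending both budgets, Sylvester's identity gives `J = σ_s^{2 N_d} / gain` with `gain = det C ·
det (1 + D) / det (C + D)`, and the constraints become `energy F ≤ P_s`, `energy Z ≤ P_r`. A pair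
spending less sees less error-induced noise than the whitening assumes, so its `J` is at most this
expression (`IsWhitened.J_le`). Conversely, scaling a feasible pair with nonzero precoders up to
full power does not increase `J`, because the thermal noises do not scale with the signal
(`exists_tight_improvement`); a pair that conveys nothing has the largest possible `J`. Hence
minimising `J` amounts to maximising `gain`, and a maximiser exists by compactness.

At a maximiser with `gain > 1`, the Lagrange condition for `Z` shows that `D` commutes with `C`
(`hopCov_hopGram_commute`). In a joint eigenbasis the two stationarity conditions say that active
columns are eigenvectors of `Qᴴ * Q` and of `P * Pᴴ`, so the link splits into parallel scalar links
along matched singular directions (`JointBasis.exists_linkFrames`). Exchange arguments on the scalar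
links (`no_inversion`, `gain_le`, `update_le`) show that the directions used are dominant and that
both hops sort them in the same order. They therefore extend to full singular value decompositions
with nonincreasing singular values (`exists_svd_form`). Undoing the normalisation yields the stated
form of the precoders (`exists_structured`).

Singular values do not depend on the decomposition, and the scalar problem depends on nothing else.
So its minimum equals that of the matrix problem for every choice of decompositions
(`exists_gains_attaining`). In the other direction, scalar-feasible gains always give feasible
precoders with `J` at most the scalar objective (`feasible_structured`); these two bounds yield all
optimality transfers. The logarithmic problem is a change of variables. -/

noncomputable section

/-! ### Completing orthonormal columns to unitary matrices -/

section UnitaryCompletion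

/-- The `j`-th column of a matrix as a vector of Euclidean space. -/
def colVec {m : ℕ} {ι : Type*} (A : Matrix (Fin m) ι ℂ) (j : ι) : EuclideanSpace ℂ (Fin m) :=
  WithLp.toLp 2 fun i => A i j

theorem inner_colVec {m : ℕ} {ι κ : Type*} (A : Matrix (Fin m) ι ℂ) (B : Matrix (Fin m) κ ℂ)
    (i : ι) (j : κ) : inner ℂ (colVec A i) (colVec B j) = (Aᴴ * B) i j := by
  simp only [colVec, EuclideanSpace.inner_toLp_toLp, Matrix.mul_apply, dotProduct,
    conjTranspose_apply, Pi.star_apply]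
  exact Finset.sum_congr rfl fun _ _ => mul_comm _ _

theorem orthonormal_colVec {m : ℕ} {ι : Type*} [DecidableEq ι] {A : Matrix (Fin m) ι ℂ}
    (h : Aᴴ * A = 1) : Orthonormal ℂ (colVec A) := by
  rw [orthonormal_iff_ite]
  intro i j
  rw [inner_colVec, h, one_apply]

/-- The matrix whose columns are the vectors of an orthonormal basis. -/
def basisMatrix {m : ℕ} {ι : Type*} (b : ι → EuclideanSpace ℂ (Fin m)) : Matrix (Fin m) ι ℂ :=
  Matrix.of fun i j => b j i

theorem colVec_basisMatrix {m : ℕ} {ι : Type*} (b : ι → EuclideanSpace ℂ (Fin m)) (j : ι) :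
    colVec (basisMatrix b) j = b j := rfl

theorem basisMatrix_conjTranspose_mul_self {m : ℕ} {ι : Type*} [DecidableEq ι]
    {b : ι → EuclideanSpace ℂ (Fin m)} (hb : Orthonormal ℂ b) :
    (basisMatrix b)ᴴ * basisMatrix b = 1 := by
  ext i j
  rw [← inner_colVec, colVec_basisMatrix, colVec_basisMatrix, orthonormal_iff_ite.mp hb, one_apply]

theorem basisMatrix_mem_unitaryGroup {m : ℕ} {b : Fin m → EuclideanSpace ℂ (Fin m)}
    (hb : Orthonormal ℂ b) : basisMatrix b ∈ unitaryGroup (Fin m) ℂ :=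
  mem_unitaryGroup_iff'.mpr (basisMatrix_conjTranspose_mul_self hb)

theorem card_le_of_conjTranspose_mul_self {m : ℕ} {ι : Type*} [Fintype ι] [DecidableEq ι]
    {A : Matrix (Fin m) ι ℂ} (h : Aᴴ * A = 1) : Fintype.card ι ≤ m := by
  have := (orthonormal_colVec h).linearIndependent.fintype_card_le_finrank
  simpa using this

/-- Orthonormal columns prescribed on a set of positions extend to a unitary matrix. -/
theorem exists_unitary_extending_on {m : ℕ} (s : Set (Fin m)) (A : Matrix (Fin m) (Fin m) ℂ)
    (h : ∀ i ∈ s, ∀ j ∈ s, (Aᴴ * A) i j = (1 : Matrix (Fin m) (Fin m) ℂ) i j) :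
    ∃ U ∈ unitaryGroup (Fin m) ℂ, ∀ j ∈ s, ∀ i, U i j = A i j := by
  have ho : Orthonormal ℂ (s.domRestrict (colVec A)) := by
    classical
    rw [orthonormal_iff_ite]
    intro i j
    simp only [Set.domRestrict_apply, inner_colVec, h _ i.2 _ j.2, one_apply, Subtype.ext_iff]
  obtain ⟨b, hb⟩ := ho.exists_orthonormalBasis_extension_of_card_eq (by simp)
  refine ⟨basisMatrix b, basisMatrix_mem_unitaryGroup b.orthonormal, fun j hj i => ?_⟩
  simp [basisMatrix, hb j hj, colVec]

/-- A matrix with orthonormal columns extends to a unitary matrix. -/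
theorem exists_unitary_extending {m r : ℕ} (hr : r ≤ m) (A : Matrix (Fin m) (Fin r) ℂ)
    (h : Aᴴ * A = 1) :
    ∃ U ∈ unitaryGroup (Fin m) ℂ, ∀ i j, U i (Fin.castLE hr j) = A i j := by
  obtain ⟨U, hU, hUA⟩ := exists_unitary_extending_on {j : Fin m | (j : ℕ) < r}
    (Matrix.of fun i j => if hj : (j : ℕ) < r then A i ⟨j, hj⟩ else 0) (by
      intro i hi j hj
      simp only [Set.mem_ofPred_eq] at hi hj
      have := congrFun (congrFun h ⟨i, hi⟩) ⟨j, hj⟩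
      simp only [Matrix.mul_apply, conjTranspose_apply, one_apply, Fin.mk.injEq] at this
      simpa [Matrix.mul_apply, hi, hj, one_apply, Fin.ext_iff] using this)
  refine ⟨U, hU, fun i j => ?_⟩
  rw [hUA _ (by simp)]
  simp

end UnitaryCompletion

/-! ### Sorted and joint diagonalisation of Hermitian matrices -/

section Spectral

/-- Orthonormal eigenvectors of a Hermitian matrix, for eigenvalues which dominate the quadratic
form on their orthogonal complement, extend to a sorted unitary diagonalisation. -/
theorem exists_sorted_diagonalization_extending {n r : ℕ} {S : Matrix (Fin n) (Fin n) ℂ}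
    (hS : S.IsHermitian) (A : Matrix (Fin n) (Fin r) ℂ) (a : Fin r → ℝ) (hA : Aᴴ * A = 1)
    (heig : S * A = A * diagonal fun i => (a i : ℂ)) (ha : Antitone a) (hr : r ≤ n)
    (htop : ∀ v : Fin n → ℂ, Aᴴ *ᵥ v = 0 → ∀ i, (star v ⬝ᵥ S *ᵥ v).re ≤ a i * (star v ⬝ᵥ v).re) :
    ∃ V ∈ unitaryGroup (Fin n) ℂ, ∃ α : Fin n → ℝ, Antitone α ∧
      S * V = V * diagonal (fun i => (α i : ℂ)) ∧
      (∀ i j, V i (Fin.castLE hr j) = A i j) ∧ ∀ j, α (Fin.castLE hr j) = a j := by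
  obtain ⟨k, rfl⟩ := Nat.exists_eq_add_of_le hr
  set T := toEuclideanLin S with hT
  have hTs : T.IsSymmetric := isSymmetric_toEuclideanLin_iff.mpr hS
  have hTA : ∀ j, T (colVec A j) = (a j : ℂ) • colVec A j := by
    intro j
    ext i
    have := congrFun (congrFun heig i) j
    rw [mul_diagonal] at this
    simp only [hT, colVec, toLpLin_apply, PiLp.smul_apply, smul_eq_mul]
    rw [mul_comm, ← this]; rfl
  -- The complement of the prescribed eigenvectors is invariant because `S` is Hermitian; an
  -- eigenbasis of the restriction supplies the remaining columns.
  set K : Submodule ℂ (EuclideanSpace ℂ (Fin (r + k))) := (Submodule.span ℂ (Set.range (colVec A)))ᗮ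
    with hK
  have hmemK : ∀ v, v ∈ K ↔ ∀ j, inner ℂ (colVec A j) v = 0 := by
    intro v
    rw [hK, Submodule.mem_orthogonal]
    constructor
    · intro h j
      exact h _ (Submodule.subset_span ⟨j, rfl⟩)
    · intro h u hu
      induction hu using Submodule.span_induction with
      | mem x hx => obtain ⟨j, rfl⟩ := hx; exact h j
      | zero => simp
      | add x y _ _ hx hy => rw [inner_add_left, hx, hy, add_zero]
      | smul c x _ hx => rw [inner_smul_left, hx, mul_zero]
  have hinv : ∀ v ∈ K, T v ∈ K := by
    intro v hv
    rw [hmemK] at hv ⊢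
    intro j
    rw [← hTs, hTA, inner_smul_left, hv, mul_zero]
  have hfin : Module.finrank ℂ K = k := by
    have h1 := Submodule.finrank_add_finrank_orthogonal (Submodule.span ℂ (Set.range (colVec A)))
    rw [finrank_span_eq_card (orthonormal_colVec hA).linearIndependent] at h1
    simp only [Fintype.card_fin, finrank_euclideanSpace] at h1
    rw [hK]; omega
  have hTK := hTs.restrict_invariant hinv
  set b := hTK.eigenvectorBasis hfin
  set β := hTK.eigenvalues hfin
  have hTb : ∀ j, T (b j : EuclideanSpace ℂ (Fin (r + k))) = (β j : ℂ) • (b j : EuclideanSpace ℂ _) := by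
    intro j
    have := congrArg Subtype.val (hTK.apply_eigenvectorBasis hfin j)
    exact this
  let v : Fin (r + k) → EuclideanSpace ℂ (Fin (r + k)) :=
    Fin.append (colVec A) fun j => (b j : EuclideanSpace ℂ _)
  let α : Fin (r + k) → ℝ := Fin.append a β
  have hv1 : ∀ j, v (Fin.castAdd k j) = colVec A j := fun j => Fin.append_left _ _ j
  have hv2 : ∀ j, v (Fin.natAdd r j) = b j := fun j => Fin.append_right _ _ j
  have hα1 : ∀ j, α (Fin.castAdd k j) = a j := fun j => Fin.append_left _ _ j
  have hα2 : ∀ j, α (Fin.natAdd r j) = β j := fun j => Fin.append_right _ _ j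
  have hbK : ∀ i j, inner ℂ (colVec A i) (b j : EuclideanSpace ℂ _) = 0 :=
    fun i j => (hmemK _).mp (b j).2 i
  have hbb : ∀ i j, inner ℂ (b i : EuclideanSpace ℂ (Fin (r + k))) (b j : EuclideanSpace ℂ _)
      = if i = j then 1 else 0 := by
    intro i j
    exact orthonormal_iff_ite.mp b.orthonormal i j
  have hAA := orthonormal_iff_ite.mp (orthonormal_colVec hA)
  have hvo : Orthonormal ℂ v := by
    rw [orthonormal_iff_ite]
    intro i j
    refine Fin.addCases (fun i => ?_) (fun i => ?_) i <;>
      refine Fin.addCases (fun j => ?_) (fun j => ?_) j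
    · simp only [hv1, hAA, Fin.castAdd_inj]
    · have : Fin.castAdd k i ≠ Fin.natAdd r j := by
        intro h; have := congrArg Fin.val h; simp at this; omega
      simp [hv1, hv2, hbK, this]
    · have : Fin.natAdd r i ≠ Fin.castAdd k j := by
        intro h; have := congrArg Fin.val h; simp at this; omega
      rw [hv1, hv2, ← inner_conj_symm, hbK]
      simp [this]
    · simp only [hv2, hbb, Fin.natAdd_inj]
  have hTv : ∀ j, T (v j) = (α j : ℂ) • v j := by
    intro j
    refine Fin.addCases (fun j => ?_) (fun j => ?_) j
    · rw [hv1, hα1, hTA]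
    · rw [hv2, hα2, hTb]
  refine ⟨basisMatrix v, basisMatrix_mem_unitaryGroup hvo, α, ?_, ?_, ?_, hα1⟩
  · intro i j hij
    induction i using Fin.addCases with
    | left i =>
      induction j using Fin.addCases with
      | left j => rw [hα1, hα1]; exact ha hij
      | right j =>
        rw [hα1, hα2]
        -- The junction of the two eigenvalue lists: evaluating the domination hypothesis at the
        -- unit eigenvector `b j` of the complement gives `β j ≤ a i`.
        have h1 := htop (b j : EuclideanSpace ℂ (Fin (r + k))).ofLp (by
          ext l
          have := hbK l j
          rw [EuclideanSpace.inner_eq_star_dotProduct] at this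
          simp only [Matrix.mulVec, dotProduct, conjTranspose_apply, Pi.zero_apply]
          rw [← this]
          simp [dotProduct, colVec, mul_comm]) i
        have h2 := hbb j j
        rw [if_pos rfl, EuclideanSpace.inner_eq_star_dotProduct, dotProduct_comm] at h2
        have h3 : S *ᵥ (b j : EuclideanSpace ℂ (Fin (r + k))).ofLp
            = (β j : ℂ) • (b j : EuclideanSpace ℂ (Fin (r + k))).ofLp := by
          have := congrArg WithLp.ofLp (hTb j)
          simpa [hT, toLpLin_apply] using this
        rw [h3, dotProduct_smul, h2] at h1
        simpa using h1
    | right i =>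
      induction j using Fin.addCases with
      | left j => exact absurd hij (by simp [Fin.le_def]; omega)
      | right j =>
        rw [hα2, hα2]
        exact hTK.eigenvalues_antitone hfin (by simpa using hij)
  · ext i j
    rw [mul_diagonal]
    have := congrArg (fun w : EuclideanSpace ℂ (Fin (r + k)) => w i) (hTv j)
    simp only [hT, toLpLin_apply, PiLp.smul_apply, smul_eq_mul] at this
    rw [mul_comm]
    exact this
  · intro i j
    show v (Fin.castAdd k j) i = A i j
    rw [hv1]; rfl

/-- Commuting Hermitian matrices have a common unitary diagonalisation. -/
theorem exists_joint_diagonalization {n : ℕ} {S T : Matrix (Fin n) (Fin n) ℂ}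
    (hS : S.IsHermitian) (hT : T.IsHermitian) (hST : S * T = T * S) :
    ∃ W ∈ unitaryGroup (Fin n) ℂ, ∃ a b : Fin n → ℝ,
      S * W = W * diagonal (fun i => (a i : ℂ)) ∧ T * W = W * diagonal (fun i => (b i : ℂ)) := by
  classical
  set f := toEuclideanLin S with hf
  set g := toEuclideanLin T with hg
  have hfs : f.IsSymmetric := isSymmetric_toEuclideanLin_iff.mpr hS
  have hgs : g.IsSymmetric := isSymmetric_toEuclideanLin_iff.mpr hT
  have hfg : ∀ v, f (g v) = g (f v) := by
    intro v
    simp only [hf, hg, toLpLin_apply, mulVec_mulVec, hST]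
  have hinv : ∀ μ : ℂ, ∀ v ∈ Module.End.eigenspace f μ, g v ∈ Module.End.eigenspace f μ := by
    intro μ v hv
    rw [Module.End.mem_eigenspace_iff] at hv ⊢
    rw [hfg, hv, map_smul]
  -- Each eigenspace of `S` is preserved by `T`, so it carries an eigenbasis of the restricted `T`;
  -- collecting these over all eigenspaces diagonalises both.
  let e : ∀ μ : Module.End.Eigenvalues f, OrthonormalBasis _ ℂ (Module.End.eigenspace f (μ : ℂ)) :=
    fun μ => (hgs.restrict_invariant (hinv μ)).eigenvectorBasis rfl
  have hfam : OrthogonalFamily ℂ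
      (fun μ : Module.End.Eigenvalues f => Module.End.eigenspace f (μ : ℂ))
      fun μ => (Module.End.eigenspace f (μ : ℂ)).subtypeₗᵢ := hfs.orthogonalFamily_eigenspaces'
  let B := hfs.direct_sum_isInternal.collectedOrthonormalBasis hfam e
  have hBe : ∀ i, B i = e i.1 i.2 := by
    intro i
    simp [B, DirectSum.IsInternal.collectedOrthonormalBasis]
  have hcard : Fintype.card (Σ μ : Module.End.Eigenvalues f,
      Fin (Module.finrank ℂ (Module.End.eigenspace f (μ : ℂ)))) = n := by
    have := Module.finrank_eq_card_basis B.toBasis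
    simpa using this.symm
  let σ := (Fintype.equivFinOfCardEq hcard).symm
  have hval : ∀ μ : Module.End.Eigenvalues f, ∃ x : ℝ, (μ : ℂ) = x := by
    intro μ
    have := hfs.conj_eigenvalue_eq_self μ.2
    exact ⟨(μ : ℂ).re, (Complex.conj_eq_iff_re.mp this).symm⟩
  choose x hx using hval
  refine ⟨basisMatrix fun i => B (σ i), basisMatrix_mem_unitaryGroup
    (B.orthonormal.comp _ σ.injective), fun i => x (σ i).1,
    fun i => (hgs.restrict_invariant (hinv (σ i).1)).eigenvalues rfl (σ i).2, ?_, ?_⟩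
  · ext i j
    have h1 : f (B (σ j)) = (x (σ j).1 : ℂ) • B (σ j) := by
      rw [hBe, ← hx]
      exact Module.End.mem_eigenspace_iff.mp (e (σ j).1 (σ j).2).2
    have := congrArg (fun w : EuclideanSpace ℂ (Fin n) => w i) h1
    simp only [hf, toLpLin_apply, PiLp.smul_apply, smul_eq_mul] at this
    rw [mul_diagonal, mul_comm]
    exact this
  · ext i j
    have h1 : g (B (σ j)) = (((hgs.restrict_invariant (hinv (σ j).1)).eigenvalues rfl (σ j).2 : ℝ)
        : ℂ) • B (σ j) := by
      rw [hBe]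
      have := congrArg Subtype.val
        ((hgs.restrict_invariant (hinv (σ j).1)).apply_eigenvectorBasis rfl (σ j).2)
      simpa using this
    have := congrArg (fun w : EuclideanSpace ℂ (Fin n) => w i) h1
    simp only [hg, toLpLin_apply, PiLp.smul_apply, smul_eq_mul] at this
    rw [mul_diagonal, mul_comm]
    exact this

end Spectral

/-! ### Rectangular diagonal matrices and singular value decompositions -/

section SVD

theorem rectDiag_conjTranspose (m n : ℕ) (d : ℕ → ℝ) : (rectDiag m n d)ᴴ = rectDiag n m d := by
  ext i j
  simp only [rectDiag, conjTranspose_apply, of_apply]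
  by_cases h : (i : ℕ) = j
  · simp [h]
  · simp [h, Ne.symm h]

/-- A middle dimension smaller than both outer ones cuts the product off at index `k`; the
hypothesis says that nothing nonzero is lost there. -/
theorem rectDiag_mul_rectDiag {m k n : ℕ} (a b : ℕ → ℝ)
    (h : ∀ i, i < m → i < n → k ≤ i → a i * b i = 0) :
    rectDiag m k a * rectDiag k n b = rectDiag m n fun i => a i * b i := by
  ext i j
  simp only [rectDiag, Matrix.mul_apply, of_apply]
  by_cases hij : (i : ℕ) = j
  · rw [if_pos hij]
    by_cases hk : (i : ℕ) < k
    · rw [Finset.sum_eq_single ⟨i, hk⟩]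
      · simp [hij]
      · intro l _ hl
        rw [if_neg, zero_mul]
        intro h'; exact hl (Fin.ext h'.symm)
      · simp
    · have h0 := h i i.2 (hij ▸ j.2) (not_lt.mp hk)
      rw [h0, Complex.ofReal_zero]
      refine Finset.sum_eq_zero fun l _ => ?_
      rw [if_neg, zero_mul]
      have := l.2
      omega
  · rw [if_neg hij]
    refine Finset.sum_eq_zero fun l _ => ?_
    by_cases h1 : (i : ℕ) = l
    · rw [if_neg (show ¬ (l : ℕ) = j by omega), mul_zero]
    · rw [if_neg h1, zero_mul]

theorem rectDiag_square (n : ℕ) (d : ℕ → ℝ) :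
    rectDiag n n d = diagonal fun i : Fin n => (d i : ℂ) := by
  ext i j
  simp only [rectDiag, of_apply, diagonal_apply, Fin.ext_iff]

theorem mul_rectDiag_apply {m n k : ℕ} (A : Matrix (Fin k) (Fin m) ℂ) (d : ℕ → ℝ) (i : Fin k)
    (j : Fin n) :
    (A * rectDiag m n d) i j = if h : (j : ℕ) < m then A i ⟨j, h⟩ * d j else 0 := by
  simp only [rectDiag, Matrix.mul_apply, of_apply]
  split_ifs with h
  · rw [Finset.sum_eq_single ⟨j, h⟩]
    · simp
    · intro l _ hl
      rw [if_neg, mul_zero]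
      intro h'; exact hl (Fin.ext h')
    · simp
  · refine Finset.sum_eq_zero fun l _ => ?_
    rw [if_neg, mul_zero]
    have := l.2
    omega

theorem unitary_conjTranspose_mul {n : ℕ} {U : Matrix (Fin n) (Fin n) ℂ}
    (h : U ∈ unitaryGroup (Fin n) ℂ) : Uᴴ * U = 1 := mem_unitaryGroup_iff'.mp h

theorem unitary_mul_conjTranspose {n : ℕ} {U : Matrix (Fin n) (Fin n) ℂ}
    (h : U ∈ unitaryGroup (Fin n) ℂ) : U * Uᴴ = 1 := mem_unitaryGroup_iff.mp h

/-- Orthonormal right singular vectors, for singular values which dominate on the orthogonal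
complement, extend to a full singular value decomposition. -/
theorem exists_svd_extending {m n r : ℕ} (H : Matrix (Fin m) (Fin n) ℂ)
    (A : Matrix (Fin n) (Fin r) ℂ) (a : Fin r → ℝ) (hA : Aᴴ * A = 1)
    (heig : Hᴴ * H * A = A * diagonal fun i => (a i : ℂ)) (ha : Antitone a) (hr : r ≤ n)
    (htop : ∀ v : Fin n → ℂ, Aᴴ *ᵥ v = 0 → ∀ i,
      (star v ⬝ᵥ (Hᴴ * H) *ᵥ v).re ≤ a i * (star v ⬝ᵥ v).re) :
    ∃ U l V, IsSVD H U l V ∧ (∀ i j, V i (Fin.castLE hr j) = A i j) ∧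
      ∀ j : Fin r, l j = Real.sqrt (a j) := by
  obtain ⟨V, hV, α, hα, hVα, hVA, hαa⟩ := exists_sorted_diagonalization_extending
    (isHermitian_conjTranspose_mul_self H) A a hA heig ha hr htop
  have hVV := unitary_conjTranspose_mul hV
  have hG : (H * V)ᴴ * (H * V) = diagonal fun i => (α i : ℂ) := by
    rw [conjTranspose_mul, Matrix.mul_assoc, ← Matrix.mul_assoc Hᴴ, hVα, ← Matrix.mul_assoc, hVV,
      Matrix.one_mul]
  have hα0 : ∀ i, 0 ≤ α i := by
    intro i
    have h := (posSemidef_conjTranspose_mul_self (H * V)).diag_nonneg (i := i)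
    rw [hG, diagonal_apply_eq] at h
    exact_mod_cast h
  let l : ℕ → ℝ := fun i => if h : i < n then Real.sqrt (α ⟨i, h⟩) else 0
  have hl : ∀ i : Fin n, l i = Real.sqrt (α i) := fun i => by simp [l]
  have hl0 : ∀ i, 0 ≤ l i := by
    intro i
    simp only [l]
    split_ifs
    · exact Real.sqrt_nonneg _
    · exact le_rfl
  have hanti : Antitone l := by
    intro i j hij
    by_cases hj : j < n
    · simp only [l, hj, lt_of_le_of_lt hij hj, dite_true]
      exact Real.sqrt_le_sqrt (hα hij)
    · simp only [l, hj, dite_false]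
      exact hl0 i
  have hcol : ∀ i j : Fin n, ∑ x, star ((H * V) x i) * (H * V) x j
      = if i = j then ((l i : ℂ)) ^ 2 else 0 := by
    intro i j
    have := congrFun (congrFun hG i) j
    simp only [Matrix.mul_apply (M := (H * V)ᴴ), conjTranspose_apply, diagonal_apply] at this
    rw [this]
    split_ifs with h
    · rw [hl, ← Complex.ofReal_pow, Real.sq_sqrt (hα0 i)]
    · rfl
  -- A positive `l i` with `m ≤ i` would make columns `0, …, i` of `H * V`, once normalised, into
  -- more than `m` orthonormal vectors of an `m`-dimensional space.
  have hlm : ∀ i, m ≤ i → l i = 0 := by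
    intro i hi
    by_contra hne
    have hpos : 0 < l i := lt_of_le_of_ne (hl0 i) (Ne.symm hne)
    have hin : i < n := by
      by_contra h
      exact hne (by simp [l, h])
    have hle : ∀ j : Fin (i + 1), 0 < l j := fun j => hpos.trans_le (hanti (by omega))
    have := card_le_of_conjTranspose_mul_self (A := (Matrix.of fun x (j : Fin (i + 1)) =>
      (H * V) x ⟨j, by omega⟩ * ((l j : ℂ))⁻¹)) (by
        ext p q
        have h := hcol ⟨p, by omega⟩ ⟨q, by omega⟩
        have hp : (l p : ℂ) ≠ 0 := by exact_mod_cast (hle p).ne'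
        simp only [Matrix.mul_apply (M := (Matrix.of _)ᴴ), conjTranspose_apply, of_apply, one_apply,
          star_mul', Fin.mk.injEq] at h ⊢
        calc _ = ((l p : ℂ))⁻¹ * (∑ x, star ((H * V) x ⟨p, by omega⟩) * (H * V) x ⟨q, by omega⟩)
              * ((l q : ℂ))⁻¹ := by
              rw [Finset.mul_sum, Finset.sum_mul]
              refine Finset.sum_congr rfl fun x _ => ?_
              simp
              ring
          _ = _ := by
              rw [h]
              by_cases hpq : p = q
              · subst hpq
                simp only [if_true]
                field_simp
              · have : ¬ (p : ℕ) = q := fun h => hpq (Fin.ext h)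
                simp [hpq, this])
    simp at this
    omega
  -- Left singular vectors are the normalised nonzero columns of `H * V`; the other positions are
  -- filled arbitrarily, since they are multiplied by zero.
  obtain ⟨U, hU, hUA⟩ := exists_unitary_extending_on {j : Fin m | 0 < l j}
    (Matrix.of fun x j => if h : (j : ℕ) < n then (H * V) x ⟨j, h⟩ * ((l j : ℂ))⁻¹ else 0) (by
      intro p hp q hq
      simp only [Set.mem_ofPred_eq] at hp hq
      have hpn : (p : ℕ) < n := by
        by_contra h
        simp [l, h] at hp
      have hqn : (q : ℕ) < n := by
        by_contra h
        simp [l, h] at hq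
      have h := hcol ⟨p, hpn⟩ ⟨q, hqn⟩
      have hp' : (l p : ℂ) ≠ 0 := by exact_mod_cast hp.ne'
      simp only [Matrix.mul_apply (M := (Matrix.of _)ᴴ), conjTranspose_apply, of_apply, one_apply,
        star_mul', Fin.mk.injEq, hpn, hqn, dite_true] at h ⊢
      calc _ = ((l p : ℂ))⁻¹ * (∑ x, star ((H * V) x ⟨p, hpn⟩) * (H * V) x ⟨q, hqn⟩)
            * ((l q : ℂ))⁻¹ := by
            rw [Finset.mul_sum, Finset.sum_mul]
            refine Finset.sum_congr rfl fun x _ => ?_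
            simp
            ring
        _ = _ := by
            rw [h]
            by_cases hpq : p = q
            · subst hpq
              simp only [if_true]
              field_simp
            · have : ¬ (p : ℕ) = q := fun h => hpq (Fin.ext h)
              simp [hpq, this])
  refine ⟨U, l, V, ⟨hU, hV, hanti, hl0, ?_, ?_⟩, hVA, ?_⟩
  · intro i hi
    rcases min_le_iff.mp hi with h | h
    · exact hlm i h
    · simp [l, not_lt.mpr h]
  · have hHV : H * V = U * rectDiag m n l := by
      ext i j
      rw [mul_rectDiag_apply]
      by_cases hlj : 0 < l j
      · have hjm : (j : ℕ) < m := by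
          by_contra h
          exact hlj.ne' (hlm j (not_lt.mp h))
        have hne : (l j : ℂ) ≠ 0 := by exact_mod_cast hlj.ne'
        rw [dif_pos hjm, hUA _ (by simpa using hlj)]
        simp [hne]
      · have hl00 : l j = 0 := le_antisymm (not_lt.mp hlj) (hl0 j)
        have h := hcol j j
        rw [if_pos rfl, hl00] at h
        have h' : ∑ x, Complex.normSq ((H * V) x j) = 0 := by
          have : ((∑ x, Complex.normSq ((H * V) x j) : ℝ) : ℂ) = 0 := by
            rw [Complex.ofReal_sum]
            simpa [Complex.normSq_eq_conj_mul_self] using h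
          exact_mod_cast this
        have := (Finset.sum_eq_zero_iff_of_nonneg (fun x _ => Complex.normSq_nonneg _)).mp h' i
          (Finset.mem_univ _)
        rw [Complex.normSq_eq_zero.mp this, hl00]
        simp
    rw [← hHV, Matrix.mul_assoc, unitary_mul_conjTranspose hV, Matrix.mul_one]
  · intro j
    rw [← hαa, ← hl]
    rfl

theorem isSVD_conjTranspose_mul_self {m n : ℕ} {H : Matrix (Fin m) (Fin n) ℂ} {U l V}
    (h : IsSVD H U l V) : Hᴴ * H = V * diagonal (fun i : Fin n => ((l i ^ 2 : ℝ) : ℂ)) * Vᴴ := by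
  have h1 : rectDiag n m l * rectDiag m n l = diagonal fun i : Fin n => ((l i ^ 2 : ℝ) : ℂ) := by
    rw [rectDiag_mul_rectDiag, rectDiag_square]
    · simp only [sq]
    · intro i _ _ hi
      rw [h.eq_zero i (min_le_of_left_le hi), mul_zero]
  conv_lhs => rw [h.eq]
  simp only [conjTranspose_mul, conjTranspose_conjTranspose, rectDiag_conjTranspose]
  rw [← h1]
  calc _ = V * rectDiag n m l * (Uᴴ * U) * rectDiag m n l * Vᴴ := by simp only [Matrix.mul_assoc]
    _ = _ := by
      rw [unitary_conjTranspose_mul h.unitary_left]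
      simp only [Matrix.mul_assoc, Matrix.one_mul]

theorem antitone_eq_of_map_eq {n : ℕ} {f g : Fin n → ℝ} (hf : Antitone f) (hg : Antitone g)
    (h : (Finset.univ.val.map f) = Finset.univ.val.map g) : f = g := by
  have hp : (List.ofFn f).Perm (List.ofFn g) := by
    rw [← Multiset.coe_eq_coe]
    simpa [Fin.univ_val_map] using h
  exact List.ofFn_injective (hp.eq_of_pairwise' (r := (· ≥ ·))
    (List.pairwise_ofFn.mpr fun i j hij => hf hij.le)
    (List.pairwise_ofFn.mpr fun i j hij => hg hij.le))

/-- The squared singular values are the roots of the characteristic polynomial of `Hᴴ * H`, and a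
sorted list is determined by its multiset. This is what carries a scalar optimum from one
decomposition to every other. -/
theorem isSVD_singularValues_unique {m n : ℕ} {H : Matrix (Fin m) (Fin n) ℂ} {U l V U' l' V'}
    (h : IsSVD H U l V) (h' : IsSVD H U' l' V') : l = l' := by
  have key : ∀ {U l V}, IsSVD H U l V → (Hᴴ * H).charpoly.roots
      = (Finset.univ.val.map fun i : Fin n => ((l i ^ 2 : ℝ) : ℂ)) := by
    intro U l V h
    rw [isSVD_conjTranspose_mul_self h, charpoly_mul_comm, ← Matrix.mul_assoc,
      unitary_conjTranspose_mul h.unitary_right, Matrix.one_mul, charpoly_diagonal]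
    have := Polynomial.roots_multiset_prod_X_sub_C
      (Finset.univ.val.map fun i : Fin n => ((l i ^ 2 : ℝ) : ℂ))
    rw [Multiset.map_map] at this
    exact this
  have h1 := (key h).symm.trans (key h')
  have h2 : (Finset.univ.val.map fun i : Fin n => l i ^ 2)
      = Finset.univ.val.map fun i : Fin n => l' i ^ 2 := by
    have := congrArg (Multiset.map Complex.re) h1
    simpa only [Multiset.map_map, Function.comp_def, Complex.ofReal_re] using this
  have h3 := antitone_eq_of_map_eq
    (fun i j hij => pow_le_pow_left₀ (h.nonneg j) (h.antitone hij) 2)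
    (fun i j hij => pow_le_pow_left₀ (h'.nonneg j) (h'.antitone hij) 2) h2
  ext i
  by_cases hi : i < n
  · exact (pow_left_inj₀ (h.nonneg i) (h'.nonneg i) two_ne_zero).mp (congrFun h3 ⟨i, hi⟩)
  · rw [h.eq_zero i (min_le_of_right_le (not_lt.mp hi)),
      h'.eq_zero i (min_le_of_right_le (not_lt.mp hi))]

end SVD

/-! ### Monotonicity of determinants and inverses of positive definite matrices -/

section Determinants

variable {m n : ℕ}

theorem Matrix.PosDef.det_re_pos {A : Matrix (Fin n) (Fin n) ℂ} (hA : A.PosDef) :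
    0 < A.det.re := (Complex.pos_iff.mp hA.det_pos).1

theorem Matrix.PosDef.det_eq_re {A : Matrix (Fin n) (Fin n) ℂ} (hA : A.PosDef) :
    A.det = (A.det.re : ℂ) :=
  Complex.ext rfl (by simpa using (Complex.pos_iff.mp hA.det_pos).2.symm)

theorem Matrix.PosDef.isUnit_det' {A : Matrix (Fin n) (Fin n) ℂ} (hA : A.PosDef) :
    IsUnit A.det := hA.det_pos.ne'.isUnit

theorem isHermitian_diagonalization {C : Matrix (Fin n) (Fin n) ℂ} (hC : C.IsHermitian) :
    ∃ U ∈ unitaryGroup (Fin n) ℂ, C = U * diagonal (fun i => (hC.eigenvalues i : ℂ)) * Uᴴ := by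
  refine ⟨hC.eigenvectorUnitary, hC.eigenvectorUnitary.2, ?_⟩
  conv_lhs => rw [hC.spectral_theorem]
  rfl

theorem posDef_conj_diagonal {U : Matrix (Fin n) (Fin n) ℂ} (hU : U ∈ unitaryGroup (Fin n) ℂ)
    {d : Fin n → ℝ} (hd : ∀ i, 0 < d i) : (U * diagonal (fun i => (d i : ℂ)) * Uᴴ).PosDef := by
  have h : (diagonal (fun i => (d i : ℂ))).PosDef :=
    PosDef.diagonal (fun i => by exact_mod_cast hd i)
  refine h.mul_mul_conjTranspose_same ?_
  intro v w hvw
  have := congrArg (fun z => z ᵥ* Uᴴ) hvw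
  simpa [vecMul_vecMul, unitary_mul_conjTranspose hU] using this

theorem exists_posDef_sqrt {C : Matrix (Fin n) (Fin n) ℂ} (hC : C.PosDef) :
    ∃ R : Matrix (Fin n) (Fin n) ℂ, R.PosDef ∧ R * R = C := by
  obtain ⟨U, hU, hCU⟩ := isHermitian_diagonalization hC.1
  refine ⟨U * diagonal (fun i => ((Real.sqrt (hC.1.eigenvalues i) : ℝ) : ℂ)) * Uᴴ,
    posDef_conj_diagonal hU fun i => Real.sqrt_pos.mpr (hC.eigenvalues_pos i), ?_⟩
  conv_rhs => rw [hCU]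
  have h : ∀ D : Matrix (Fin n) (Fin n) ℂ, U * D * Uᴴ * (U * D * Uᴴ) = U * (D * D) * Uᴴ := by
    intro D
    calc _ = U * D * (Uᴴ * U) * D * Uᴴ := by simp only [Matrix.mul_assoc]
      _ = _ := by rw [unitary_conjTranspose_mul hU]; simp only [Matrix.mul_assoc, Matrix.one_mul]
  rw [h, diagonal_mul_diagonal]
  congr 3
  funext i
  rw [← Complex.ofReal_mul, Real.mul_self_sqrt (hC.eigenvalues_pos i).le]

/-- For a column `w` of `W` with eigenvalue `s²`, `(R + s)(R w - s w) = 0`, and `R + s` is positive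
definite. No functional calculus is needed, and this applies to any positive definite square root.
-/
theorem sqrt_mul_of_mul {C R W : Matrix (Fin n) (Fin n) ℂ} {c : Fin n → ℝ} (hR : R.PosDef)
    (hRC : R * R = C) (hc : ∀ i, 0 ≤ c i) (hCW : C * W = W * diagonal fun i => (c i : ℂ)) :
    R * W = W * diagonal fun i => ((Real.sqrt (c i) : ℝ) : ℂ) := by
  have key : ∀ j, R *ᵥ (fun i => W i j) = ((Real.sqrt (c j) : ℝ) : ℂ) • fun i => W i j := by
    intro j
    set s := Real.sqrt (c j) with hs
    have hC : R *ᵥ (R *ᵥ fun i => W i j) = ((s : ℂ) * s) • fun i => W i j := by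
      rw [mulVec_mulVec, hRC, ← Complex.ofReal_mul, hs, Real.mul_self_sqrt (hc j)]
      ext i
      have := congrFun (congrFun hCW i) j
      rw [mul_diagonal] at this
      simp only [Pi.smul_apply, smul_eq_mul]
      rw [mul_comm, ← this]; rfl
    have hpd : (R + (s : ℂ) • (1 : Matrix (Fin n) (Fin n) ℂ)).PosDef :=
      hR.add_posSemidef (PosSemidef.one.smul (by exact_mod_cast Real.sqrt_nonneg _))
    by_contra hne
    have h0 : (R *ᵥ (fun i => W i j) - (s : ℂ) • fun i => W i j) ≠ 0 := sub_ne_zero.mpr hne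
    have := hpd.dotProduct_mulVec_pos h0
    rw [add_mulVec, mulVec_sub, hC, smul_mulVec, one_mulVec, mulVec_smul, smul_sub, smul_smul] at this
    simp at this
  ext i j
  rw [mul_diagonal]
  have := congrFun (key j) i
  simp only [Pi.smul_apply, smul_eq_mul] at this
  rw [mul_comm, ← this]; rfl

theorem one_add_sum_le_prod_one_add {ι : Type*} (s : Finset ι) (f : ι → ℝ) (hf : ∀ i ∈ s, 0 ≤ f i) :
    1 + ∑ i ∈ s, f i ≤ ∏ i ∈ s, (1 + f i) := by
  classical
  induction s using Finset.induction_on with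
  | empty => simp
  | insert a s ha ih =>
    rw [Finset.sum_insert ha, Finset.prod_insert ha]
    have h1 := ih fun i hi => hf i (Finset.mem_insert_of_mem hi)
    have h2 := hf a (Finset.mem_insert_self _ _)
    have h3 : 0 ≤ ∑ i ∈ s, f i := Finset.sum_nonneg fun i hi => hf i (Finset.mem_insert_of_mem hi)
    nlinarith [mul_nonneg h2 h3]

theorem one_add_trace_le_det_one_add {K : Matrix (Fin n) (Fin n) ℂ} (hK : K.PosSemidef) :
    1 + K.trace.re ≤ (1 + K).det.re := by
  obtain ⟨U, hU, hKU⟩ := isHermitian_diagonalization hK.1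
  have h1 : (1 + K).det = ((∏ i, (1 + hK.1.eigenvalues i) : ℝ) : ℂ) := by
    have : (1 + K) = U * (diagonal fun i => ((1 + hK.1.eigenvalues i : ℝ) : ℂ)) * Uᴴ := by
      have hd : (diagonal fun i => ((1 + hK.1.eigenvalues i : ℝ) : ℂ))
          = 1 + diagonal (fun i => (hK.1.eigenvalues i : ℂ)) := by
        rw [← diagonal_one, diagonal_add]; simp
      rw [hd, Matrix.mul_add, Matrix.add_mul, Matrix.mul_one, unitary_mul_conjTranspose hU, ← hKU]
    rw [this, det_mul_right_comm, unitary_mul_conjTranspose hU, Matrix.one_mul, det_diagonal]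
    push_cast; rfl
  have h2 := hK.1.trace_eq_sum_eigenvalues
  rw [h1, h2, ← RCLike.ofReal_sum]
  simp only [Complex.coe_algebraMap, Complex.ofReal_re]
  exact one_add_sum_le_prod_one_add _ _ fun i _ => hK.eigenvalues_nonneg i

theorem det_re_mul_posDef {A B : Matrix (Fin n) (Fin n) ℂ} (hA : A.PosDef) :
    (A * B).det.re = A.det.re * B.det.re := by
  rw [det_mul, hA.det_eq_re, Complex.re_ofReal_mul, Complex.ofReal_re]

/-- Factor `A + E = R (1 + K) R` with `R² = A` and `K = R⁻¹ E R⁻¹`, and use `det (1 + K) ≥ 1 + tr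
K`. The trace term gives weak and strict monotonicity of the determinant at once. -/
theorem det_re_mul_one_add_le {A E : Matrix (Fin n) (Fin n) ℂ} (hA : A.PosDef) (hE : E.PosSemidef) :
    ∃ K : Matrix (Fin n) (Fin n) ℂ, K.PosSemidef ∧ (E ≠ 0 → K ≠ 0) ∧
      A.det.re * (1 + K.trace.re) ≤ (A + E).det.re := by
  obtain ⟨R, hR, hRA⟩ := exists_posDef_sqrt hA
  have hRu := hR.isUnit_det'
  have hRi : R⁻¹ᴴ = R⁻¹ := hR.inv.1
  refine ⟨R⁻¹ * E * R⁻¹, ?_, ?_, ?_⟩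
  · have := hE.conjTranspose_mul_mul_same R⁻¹
    rwa [hRi] at this
  · intro hE0 h
    apply hE0
    calc E = R * (R⁻¹ * E * R⁻¹) * R := by
          rw [← Matrix.mul_assoc, ← Matrix.mul_assoc, mul_nonsing_inv _ hRu, Matrix.one_mul,
            Matrix.mul_assoc, nonsing_inv_mul _ hRu, Matrix.mul_one]
      _ = 0 := by rw [h]; simp
  · have h1 : A + E = R * (1 + R⁻¹ * E * R⁻¹) * R := by
      rw [Matrix.mul_add, Matrix.add_mul, Matrix.mul_one, hRA, ← Matrix.mul_assoc,
        ← Matrix.mul_assoc, mul_nonsing_inv _ hRu, Matrix.one_mul, Matrix.mul_assoc,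
        nonsing_inv_mul _ hRu, Matrix.mul_one]
    have h2 : (A + E).det = (A * (1 + R⁻¹ * E * R⁻¹)).det := by
      rw [h1, det_mul_right_comm, hRA, det_mul]
    rw [h2, det_re_mul_posDef hA]
    have hK : (R⁻¹ * E * R⁻¹).PosSemidef := by
      have := hE.conjTranspose_mul_mul_same R⁻¹
      rwa [hRi] at this
    exact mul_le_mul_of_nonneg_left (one_add_trace_le_det_one_add hK) hA.det_re_pos.le

theorem Matrix.PosSemidef.trace_re_nonneg {K : Matrix (Fin n) (Fin n) ℂ}
    (hK : K.PosSemidef) : 0 ≤ K.trace.re := (Complex.nonneg_iff.mp hK.trace_nonneg).1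

theorem Matrix.PosSemidef.trace_re_pos {K : Matrix (Fin n) (Fin n) ℂ}
    (hK : K.PosSemidef) (h0 : K ≠ 0) : 0 < K.trace.re := by
  refine lt_of_le_of_ne hK.trace_re_nonneg fun h => h0 (hK.trace_eq_zero_iff.mp ?_)
  exact Complex.ext h.symm (by simpa using (Complex.nonneg_iff.mp hK.trace_nonneg).2.symm)

theorem det_re_le_add {A E : Matrix (Fin n) (Fin n) ℂ} (hA : A.PosDef) (hE : E.PosSemidef) :
    A.det.re ≤ (A + E).det.re := by
  obtain ⟨K, hK, -, h⟩ := det_re_mul_one_add_le hA hE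
  nlinarith [hA.det_re_pos, hK.trace_re_nonneg, mul_nonneg hA.det_re_pos.le hK.trace_re_nonneg]

theorem det_re_lt_add {A E : Matrix (Fin n) (Fin n) ℂ} (hA : A.PosDef) (hE : E.PosSemidef)
    (h0 : E ≠ 0) : A.det.re < (A + E).det.re := by
  obtain ⟨K, hK, hK0, h⟩ := det_re_mul_one_add_le hA hE
  nlinarith [hA.det_re_pos, mul_pos hA.det_re_pos (hK.trace_re_pos (hK0 h0))]

/-- The right side is a congruence of `E + E A⁻¹ E`, so positivity, semidefinite or definite, passes
from `E` to the gap between the inverses. -/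
theorem inv_sub_inv_add {A E : Matrix (Fin n) (Fin n) ℂ} (hA : A.PosDef) (hE : E.PosSemidef) :
    A⁻¹ - (A + E)⁻¹ = (A + E)⁻¹ * (E + E * A⁻¹ * E) * (A + E)⁻¹ := by
  have hA1 := hA.isUnit_det'
  have hB1 := (hA.add_posSemidef hE).isUnit_det'
  have h : E + E * A⁻¹ * E = (A + E) * A⁻¹ * (A + E) - (A + E) := by
    rw [Matrix.add_mul, mul_nonsing_inv _ hA1, Matrix.add_mul, Matrix.one_mul, Matrix.mul_add,
      Matrix.mul_assoc E A⁻¹ A, nonsing_inv_mul _ hA1, Matrix.mul_one]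
    abel
  rw [h, Matrix.mul_sub, Matrix.sub_mul, nonsing_inv_mul _ hB1, Matrix.one_mul,
    ← Matrix.mul_assoc, ← Matrix.mul_assoc, nonsing_inv_mul _ hB1, Matrix.one_mul,
    Matrix.mul_assoc, mul_nonsing_inv _ hB1, Matrix.mul_one]

theorem posSemidef_inv_sub_inv {A E : Matrix (Fin n) (Fin n) ℂ} (hA : A.PosDef)
    (hE : E.PosSemidef) : (A⁻¹ - (A + E)⁻¹).PosSemidef := by
  have hAE := (hA.add_posSemidef hE).inv
  have h1 : (E + E * A⁻¹ * E).PosSemidef := by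
    refine hE.add ?_
    have := hA.inv.posSemidef.conjTranspose_mul_mul_same E
    rwa [hE.1.eq] at this
  have h2 := h1.conjTranspose_mul_mul_same (A + E)⁻¹
  rw [hAE.1.eq] at h2
  rwa [inv_sub_inv_add hA hE]

theorem posDef_inv_sub_inv {A E : Matrix (Fin n) (Fin n) ℂ} (hA : A.PosDef)
    (hE : E.PosDef) : (A⁻¹ - (A + E)⁻¹).PosDef := by
  have hAE := (hA.add_posSemidef hE.posSemidef).inv
  have h1 : (E + E * A⁻¹ * E).PosDef := by
    refine hE.add_posSemidef ?_
    have := hA.inv.posSemidef.conjTranspose_mul_mul_same E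
    rwa [hE.1.eq] at this
  have h2 := h1.conjTranspose_mul_mul_same (B := (A + E)⁻¹) (by
    exact mulVec_injective_of_isUnit hAE.isUnit)
  rw [hAE.1.eq] at h2
  rwa [inv_sub_inv_add hA hE.posSemidef]

theorem conj_ne_zero_of_posDef {K : Matrix (Fin n) (Fin n) ℂ} (hK : K.PosDef)
    {G : Matrix (Fin n) (Fin m) ℂ} (hG : G ≠ 0) : Gᴴ * K * G ≠ 0 := by
  obtain ⟨R, hR, hRK⟩ := exists_posDef_sqrt hK
  intro h
  have h1 : (R * G)ᴴ * (R * G) = 0 := by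
    rw [conjTranspose_mul, hR.1.eq, ← h, ← hRK]
    simp only [Matrix.mul_assoc]
  have h2 := conjTranspose_mul_self_eq_zero.mp h1
  apply hG
  calc G = R⁻¹ * (R * G) := by rw [← Matrix.mul_assoc, nonsing_inv_mul _ hR.isUnit_det', Matrix.one_mul]
    _ = 0 := by rw [h2, Matrix.mul_zero]

end Determinants

/-! ### The determinant of the error covariance -/

section MseDet

variable {n k : ℕ}

/-- Determinant of the error covariance `(c I + Gᴴ B⁻¹ G)⁻¹` for the noise covariance `B` and the
channel `G`. -/
def mseDet (c : ℝ) (B : Matrix (Fin n) (Fin n) ℂ) (G : Matrix (Fin n) (Fin k) ℂ) : ℝ :=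
  (det ((c • (1 : Matrix (Fin k) (Fin k) ℂ) + Gᴴ * B⁻¹ * G)⁻¹)).re

theorem posDef_smul_one {c : ℝ} (hc : 0 < c) : (c • (1 : Matrix (Fin k) (Fin k) ℂ)).PosDef :=
  PosDef.one.smul hc

theorem posDef_mse {c : ℝ} (hc : 0 < c) {B : Matrix (Fin n) (Fin n) ℂ} (hB : B.PosDef)
    (G : Matrix (Fin n) (Fin k) ℂ) :
    (c • (1 : Matrix (Fin k) (Fin k) ℂ) + Gᴴ * B⁻¹ * G).PosDef :=
  (posDef_smul_one hc).add_posSemidef (hB.inv.posSemidef.conjTranspose_mul_mul_same G)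

theorem mseDet_eq_inv {c : ℝ} (hc : 0 < c) {B : Matrix (Fin n) (Fin n) ℂ} (hB : B.PosDef)
    (G : Matrix (Fin n) (Fin k) ℂ) :
    mseDet c B G = (det (c • (1 : Matrix (Fin k) (Fin k) ℂ) + Gᴴ * B⁻¹ * G)).re⁻¹ := by
  rw [mseDet, det_nonsing_inv, Ring.inverse_eq_inv', (posDef_mse hc hB G).det_eq_re,
    ← Complex.ofReal_inv, Complex.ofReal_re, Complex.ofReal_re]

theorem mseDet_mono {c : ℝ} (hc : 0 < c) {B E : Matrix (Fin n) (Fin n) ℂ} (hB : B.PosDef)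
    (hE : E.PosSemidef) (G : Matrix (Fin n) (Fin k) ℂ) : mseDet c B G ≤ mseDet c (B + E) G := by
  rw [mseDet_eq_inv hc hB, mseDet_eq_inv hc (hB.add_posSemidef hE)]
  have hS := posDef_mse hc (hB.add_posSemidef hE) G
  refine inv_anti₀ hS.det_re_pos ?_
  have h := det_re_le_add hS ((posSemidef_inv_sub_inv hB hE).conjTranspose_mul_mul_same G)
  rwa [Matrix.mul_sub, Matrix.sub_mul, add_add_sub_cancel] at h

/-- Positive definite extra noise makes the gap between the inverse noise covariances positive
definite, so compressing that gap by a nonzero `G` cannot vanish, and the determinant moves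
strictly. -/
theorem mseDet_strictMono {c : ℝ} (hc : 0 < c) {B E : Matrix (Fin n) (Fin n) ℂ} (hB : B.PosDef)
    (hE : E.PosDef) {G : Matrix (Fin n) (Fin k) ℂ} (hG : G ≠ 0) :
    mseDet c B G < mseDet c (B + E) G := by
  rw [mseDet_eq_inv hc hB, mseDet_eq_inv hc (hB.add_posSemidef hE.posSemidef)]
  have hS := posDef_mse hc (hB.add_posSemidef hE.posSemidef) G
  refine inv_strictAnti₀ hS.det_re_pos ?_
  have h := det_re_lt_add hS
    ((posSemidef_inv_sub_inv hB hE.posSemidef).conjTranspose_mul_mul_same G)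
    (conj_ne_zero_of_posDef (posDef_inv_sub_inv hB hE) hG)
  rwa [Matrix.mul_sub, Matrix.sub_mul, add_add_sub_cancel] at h

theorem mseDet_zero {c : ℝ} (hc : 0 < c) {B : Matrix (Fin n) (Fin n) ℂ} (hB : B.PosDef) :
    mseDet c B (0 : Matrix (Fin n) (Fin k) ℂ) = c⁻¹ ^ k := by
  rw [mseDet_eq_inv hc hB, Matrix.mul_zero, add_zero]
  have : det (c • (1 : Matrix (Fin k) (Fin k) ℂ)) = ((c ^ k : ℝ) : ℂ) := by
    rw [show c • (1 : Matrix (Fin k) (Fin k) ℂ) = (c : ℂ) • 1 by ext; simp, det_smul]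
    simp
  rw [this, Complex.ofReal_re, inv_pow]

theorem mseDet_le {c : ℝ} (hc : 0 < c) {B : Matrix (Fin n) (Fin n) ℂ} (hB : B.PosDef)
    (G : Matrix (Fin n) (Fin k) ℂ) : mseDet c B G ≤ c⁻¹ ^ k := by
  rw [← mseDet_zero hc hB, mseDet_eq_inv hc hB, mseDet_eq_inv hc hB]
  refine inv_anti₀ (posDef_mse hc hB 0).det_re_pos ?_
  rw [Matrix.mul_zero, add_zero]
  exact det_re_le_add (posDef_smul_one hc) (hB.inv.posSemidef.conjTranspose_mul_mul_same G)

theorem mseDet_lt {c : ℝ} (hc : 0 < c) {B : Matrix (Fin n) (Fin n) ℂ} (hB : B.PosDef)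
    {G : Matrix (Fin n) (Fin k) ℂ} (hG : G ≠ 0) : mseDet c B G < c⁻¹ ^ k := by
  rw [← mseDet_zero hc hB, mseDet_eq_inv hc hB, mseDet_eq_inv hc hB]
  refine inv_strictAnti₀ (posDef_mse hc hB 0).det_re_pos ?_
  rw [Matrix.mul_zero, add_zero]
  exact det_re_lt_add (posDef_smul_one hc) (hB.inv.posSemidef.conjTranspose_mul_mul_same G)
    (conj_ne_zero_of_posDef hB.inv hG)

/-- Sylvester's identity moves the determinant from the symbol space to the receive space, where
noise and received covariances can be whitened together. -/
theorem mseDet_eq_ratio {c : ℝ} (hc : 0 < c) {B : Matrix (Fin n) (Fin n) ℂ} (hB : B.PosDef)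
    (G : Matrix (Fin n) (Fin k) ℂ) :
    mseDet c B G = c⁻¹ ^ k * (B.det.re / (B + c⁻¹ • (G * Gᴴ)).det.re) := by
  have hB2 : (B + c⁻¹ • (G * Gᴴ)).PosDef := hB.add_posSemidef
    ((posSemidef_self_mul_conjTranspose G).smul (inv_pos.mpr hc).le)
  have h1 : det (c • (1 : Matrix (Fin k) (Fin k) ℂ) + Gᴴ * B⁻¹ * G)
      = ((c ^ k * ((B + c⁻¹ • (G * Gᴴ)).det.re / B.det.re) : ℝ) : ℂ) := by
    have hs : c • (1 : Matrix (Fin k) (Fin k) ℂ) + Gᴴ * B⁻¹ * G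
        = (c : ℂ) • (1 + Gᴴ * ((c⁻¹ : ℂ) • (B⁻¹ * G))) := by
      have hc' : (c : ℂ) ≠ 0 := by exact_mod_cast hc.ne'
      rw [smul_add, Matrix.mul_smul, smul_smul, mul_inv_cancel₀ hc', one_smul, Matrix.mul_assoc]
      congr 1
    have hs2 : B + c⁻¹ • (G * Gᴴ) = B * (1 + ((c⁻¹ : ℂ) • (B⁻¹ * G)) * Gᴴ) := by
      rw [Matrix.mul_add, Matrix.mul_one, Matrix.smul_mul, Matrix.mul_smul, Matrix.mul_assoc,
        ← Matrix.mul_assoc, mul_nonsing_inv _ hB.isUnit_det', Matrix.one_mul]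
      congr 1
      ext; simp
    have h3 : (B + c⁻¹ • (G * Gᴴ)).det = B.det * (1 + Gᴴ * ((c⁻¹ : ℂ) • (B⁻¹ * G))).det := by
      rw [hs2, det_mul, det_one_add_mul_comm]
    rw [hs, det_smul, Fintype.card_fin]
    push_cast
    rw [← hB2.det_eq_re, ← hB.det_eq_re, h3, mul_div_cancel_left₀ _ hB.det_pos.ne']
  rw [mseDet_eq_inv hc hB, h1, Complex.ofReal_re, mul_inv, inv_div, inv_pow]

end MseDet

/-! ### First-order conditions over a Frobenius ball -/

section FirstOrder

variable {m n k : ℕ}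

/-- Apply the polynomial expansion of `det (1 + X M)` to `M = E + X G`; the trace of `G` then enters
only at second order. -/
theorem det_one_add_expansion (E G : Matrix (Fin n) (Fin n) ℂ) :
    ∃ q : Polynomial ℂ, ∀ t : ℂ,
      (1 + (t • E + t ^ 2 • G)).det = 1 + t * E.trace + t ^ 2 * q.eval t := by
  let M : Matrix (Fin n) (Fin n) (Polynomial ℂ) :=
    E.map Polynomial.C + (Polynomial.X : Polynomial ℂ) • G.map Polynomial.C
  have h := det_one_add_smul (Polynomial.X : Polynomial ℂ) M
  obtain ⟨s, hs⟩ : ∃ s : Polynomial ℂ, (1 + (Polynomial.X : Polynomial ℂ) • M).det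
      = 1 + M.trace * Polynomial.X + s * Polynomial.X ^ 2 := ⟨_, h⟩
  refine ⟨Polynomial.C G.trace + s, fun t => ?_⟩
  have h1 := congrArg (Polynomial.evalRingHom t) hs
  rw [RingHom.map_det] at h1
  have h2 : (Polynomial.evalRingHom t).mapMatrix (1 + (Polynomial.X : Polynomial ℂ) • M)
      = 1 + (t • E + t ^ 2 • G) := by
    ext i j
    simp only [M, RingHom.mapMatrix_apply, map_apply, Matrix.add_apply, Matrix.smul_apply, smul_eq_mul,
      Polynomial.coe_evalRingHom, Polynomial.eval_add, Polynomial.eval_mul, Polynomial.eval_X,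
      Polynomial.eval_C, one_apply]
    split_ifs <;> simp <;> ring
  have h3 : M.trace = Polynomial.C E.trace + Polynomial.X * Polynomial.C G.trace := by
    simp [M, trace, Finset.sum_add_distrib, Finset.mul_sum]
  rw [h2, h3] at h1
  rw [h1]
  simp
  ring

/-- If the quotient `det(A₁ + ·) / det(A₂ + ·)` does not increase along a curve with initial
velocity `E`, then `tr((A₁⁻¹ - A₂⁻¹) E) ≤ 0`. -/
theorem trace_inv_sub_inv_mul_nonpos {A₁ A₂ E G : Matrix (Fin n) (Fin n) ℂ} (h₁ : A₁.PosDef)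
    (h₂ : A₂.PosDef) {δ : ℝ} (hδ : 0 < δ)
    (h : ∀ t : ℝ, 0 < t → t < δ →
      (A₁ + ((t : ℂ) • E + (t : ℂ) ^ 2 • G)).det.re * A₂.det.re
        ≤ A₁.det.re * (A₂ + ((t : ℂ) • E + (t : ℂ) ^ 2 • G)).det.re) :
    ((A₁⁻¹ - A₂⁻¹) * E).trace.re ≤ 0 := by
  have key : ∀ {A : Matrix (Fin n) (Fin n) ℂ}, A.PosDef → ∃ q : Polynomial ℂ, ∀ t : ℝ,
      (A + ((t : ℂ) • E + (t : ℂ) ^ 2 • G)).det.re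
        = A.det.re * (1 + t * (A⁻¹ * E).trace.re + t ^ 2 * (q.eval (t : ℂ)).re) := by
    intro A hA
    obtain ⟨q, hq⟩ := det_one_add_expansion (A⁻¹ * E) (A⁻¹ * G)
    refine ⟨q, fun t => ?_⟩
    have : A + ((t : ℂ) • E + (t : ℂ) ^ 2 • G)
        = A * (1 + ((t : ℂ) • (A⁻¹ * E) + (t : ℂ) ^ 2 • (A⁻¹ * G))) := by
      simp only [Matrix.mul_add, Matrix.mul_one, Matrix.mul_smul, ← Matrix.mul_assoc,
        mul_nonsing_inv _ hA.isUnit_det', Matrix.one_mul]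
    rw [this, det_re_mul_posDef hA, hq, ← Complex.ofReal_pow]
    simp only [Complex.add_re, Complex.re_ofReal_mul, Complex.one_re]
  obtain ⟨q₁, hq₁⟩ := key h₁
  obtain ⟨q₂, hq₂⟩ := key h₂
  have hp₁ := h₁.det_re_pos
  have hp₂ := h₂.det_re_pos
  -- Divided by `t · det A₁ · det A₂`, the cross-multiplied inequality leaves this continuous
  -- function, nonpositive for small `t > 0`; its value at `0` is the trace in question.
  have hlim : Filter.Tendsto (fun t : ℝ => (A₁⁻¹ * E).trace.re - (A₂⁻¹ * E).trace.re
      + t * ((q₁.eval (t : ℂ)).re - (q₂.eval (t : ℂ)).re)) (nhdsWithin 0 (Set.Ioi 0))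
      (nhds ((A₁⁻¹ * E).trace.re - (A₂⁻¹ * E).trace.re
      + 0 * ((q₁.eval ((0 : ℝ) : ℂ)).re - (q₂.eval ((0 : ℝ) : ℂ)).re))) := by
    refine (Continuous.tendsto ?_ 0).mono_left nhdsWithin_le_nhds
    have hc : ∀ q : Polynomial ℂ, Continuous fun t : ℝ => (q.eval (t : ℂ)).re := fun q =>
      Complex.continuous_re.comp (q.continuous.comp Complex.continuous_ofReal)
    exact continuous_const.add (continuous_id.mul ((hc q₁).sub (hc q₂)))
  have hle := le_of_tendsto hlim (b := 0) (by
    filter_upwards [Ioo_mem_nhdsGT hδ] with t ht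
    have h' := h t ht.1 ht.2
    rw [hq₁, hq₂] at h'
    have h3 : A₁.det.re * A₂.det.re * (t * ((A₁⁻¹ * E).trace.re - (A₂⁻¹ * E).trace.re
      + t * ((q₁.eval (t : ℂ)).re - (q₂.eval (t : ℂ)).re))) ≤ 0 := by linarith
    have h4 : 0 < A₁.det.re * A₂.det.re * t := mul_pos (mul_pos hp₁ hp₂) ht.1
    rw [← mul_assoc] at h3
    exact nonpos_of_mul_nonpos_right h3 h4)
  rw [zero_mul, add_zero] at hle
  rwa [Matrix.sub_mul, trace_sub, Complex.sub_re]

/-- The squared Frobenius norm. -/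
def energy (A : Matrix (Fin m) (Fin k) ℂ) : ℝ := (A * Aᴴ).trace.re

theorem energy_eq (A : Matrix (Fin m) (Fin k) ℂ) : energy A = (Aᴴ * A).trace.re := by
  rw [energy, trace_mul_comm]

theorem energy_nonneg (A : Matrix (Fin m) (Fin k) ℂ) : 0 ≤ energy A :=
  (posSemidef_self_mul_conjTranspose A).trace_re_nonneg

theorem energy_pos {A : Matrix (Fin m) (Fin k) ℂ} (h : A ≠ 0) : 0 < energy A :=
  (posSemidef_self_mul_conjTranspose A).trace_re_pos
    fun h0 => h (self_mul_conjTranspose_eq_zero.mp h0)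

theorem energy_smul (t : ℝ) (A : Matrix (Fin m) (Fin k) ℂ) :
    energy ((t : ℂ) • A) = t ^ 2 * energy A := by
  simp only [energy, conjTranspose_smul, Matrix.smul_mul, Matrix.mul_smul, trace_smul]
  simp [sq, mul_assoc]

theorem trace_conjTranspose_mul_re_comm (A B : Matrix (Fin m) (Fin k) ℂ) :
    (Aᴴ * B).trace.re = (Bᴴ * A).trace.re := by
  have : (Bᴴ * A) = (Aᴴ * B)ᴴ := by simp
  rw [this, trace_conjTranspose]; simp

theorem energy_add_smul (A B : Matrix (Fin m) (Fin k) ℂ) (t : ℝ) :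
    energy (A + (t : ℂ) • B) = energy A + 2 * t * (Bᴴ * A).trace.re + t ^ 2 * energy B := by
  have h := trace_conjTranspose_mul_re_comm A B
  simp only [energy_eq, conjTranspose_add, conjTranspose_smul, Matrix.add_mul, Matrix.mul_add,
    Matrix.smul_mul, Matrix.mul_smul, trace_add, trace_smul, Complex.add_re, smul_eq_mul,
    Complex.star_def, Complex.conj_ofReal, Complex.re_ofReal_mul]
  rw [h]
  ring

/-- Lagrange multiplier for maximisation over a Frobenius ball. -/
theorem exists_multiplier {Z N : Matrix (Fin m) (Fin k) ℂ} (hZ : Z ≠ 0)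
    (h : ∀ G : Matrix (Fin m) (Fin k) ℂ, (Gᴴ * Z).trace.re < 0 → (Gᴴ * N).trace.re ≤ 0) :
    ∃ ν : ℝ, 0 ≤ ν ∧ N = (ν : ℂ) • Z := by
  have hp := energy_pos hZ
  set a := (Zᴴ * N).trace.re / energy Z with ha
  have haZ : a * energy Z = (Zᴴ * N).trace.re := div_mul_cancel₀ _ hp.ne'
  set G₀ := N - (a : ℂ) • Z with hG₀
  have h1 : (G₀ᴴ * Z).trace.re = 0 := by
    rw [hG₀, conjTranspose_sub, Matrix.sub_mul, conjTranspose_smul, Matrix.smul_mul, trace_sub,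
      trace_smul, Complex.sub_re, trace_conjTranspose_mul_re_comm N Z, ← haZ, energy_eq]
    simp
  have h2 : (G₀ᴴ * N).trace.re = energy G₀ := by
    have : N = G₀ + (a : ℂ) • Z := by rw [hG₀]; abel
    conv_lhs => rw [this]
    rw [Matrix.mul_add, Matrix.mul_smul, trace_add, trace_smul, Complex.add_re, smul_eq_mul,
      Complex.re_ofReal_mul, h1, mul_zero, add_zero, energy_eq]
  -- `G₀` is the part of `N` orthogonal to `Z`. It is tangent to the sphere, so it is tilted inwards
  -- by `-ε Z` to satisfy the strict hypothesis; letting `ε` tend to zero forces `G₀ = 0`.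
  have h3 : ∀ ε : ℝ, 0 < ε → energy G₀ ≤ ε * (Zᴴ * N).trace.re := by
    intro ε hε
    have := h (G₀ - (ε : ℂ) • Z) (by
      rw [conjTranspose_sub, Matrix.sub_mul, conjTranspose_smul, Matrix.smul_mul, trace_sub,
        trace_smul, Complex.sub_re, h1]
      have := mul_pos hε hp
      rw [energy_eq] at this
      simpa using this)
    rw [conjTranspose_sub, Matrix.sub_mul, conjTranspose_smul, Matrix.smul_mul, trace_sub,
      trace_smul, Complex.sub_re, h2] at this
    simp at this
    linarith
  have h4 : energy G₀ ≤ 0 := by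
    by_contra hne
    push Not at hne
    by_cases hb : 0 < (Zᴴ * N).trace.re
    · have := h3 (energy G₀ / (2 * (Zᴴ * N).trace.re)) (by positivity)
      have e : energy G₀ / (2 * (Zᴴ * N).trace.re) * (Zᴴ * N).trace.re = energy G₀ / 2 := by
        field_simp
      linarith
    · have := h3 1 one_pos
      linarith
  have h5 : G₀ = 0 := by
    by_contra hne
    exact absurd (energy_pos hne) (not_lt.mpr h4)
  refine ⟨a, ?_, sub_eq_zero.mp h5⟩
  have := h3 1 one_pos
  exact div_nonneg (by linarith [energy_nonneg G₀]) hp.le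

end FirstOrder

/-! ### The normalised two-hop gain and its stationarity conditions -/

section Gain

variable {Ns Nr Nd k : ℕ}

/-- Received covariance `I + (PF)(PF)ᴴ` of the normalised first hop. -/
def hopCov (P : Matrix (Fin Nr) (Fin Ns) ℂ) (F : Matrix (Fin Ns) (Fin k) ℂ) :
    Matrix (Fin Nr) (Fin Nr) ℂ := 1 + (P * F) * (P * F)ᴴ

/-- Gram matrix `(QZ)ᴴ(QZ)` of the normalised second hop. -/
def hopGram (Q : Matrix (Fin Nd) (Fin Nr) ℂ) (Z : Matrix (Fin Nr) (Fin Nr) ℂ) :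
    Matrix (Fin Nr) (Fin Nr) ℂ := (Q * Z)ᴴ * (Q * Z)

/-- The determinant gain of the normalised two-hop link. -/
def gain (P : Matrix (Fin Nr) (Fin Ns) ℂ) (Q : Matrix (Fin Nd) (Fin Nr) ℂ)
    (F : Matrix (Fin Ns) (Fin k) ℂ) (Z : Matrix (Fin Nr) (Fin Nr) ℂ) : ℝ :=
  (hopCov P F).det.re * (1 + hopGram Q Z).det.re / (hopCov P F + hopGram Q Z).det.re

variable (P : Matrix (Fin Nr) (Fin Ns) ℂ) (Q : Matrix (Fin Nd) (Fin Nr) ℂ)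
    (F : Matrix (Fin Ns) (Fin k) ℂ) (Z : Matrix (Fin Nr) (Fin Nr) ℂ)

theorem hopCov_posDef : (hopCov P F).PosDef :=
  PosDef.one.add_posSemidef (posSemidef_self_mul_conjTranspose _)

theorem hopGram_posSemidef : (hopGram Q Z).PosSemidef := posSemidef_conjTranspose_mul_self _

theorem one_add_hopGram_posDef : (1 + hopGram Q Z).PosDef :=
  PosDef.one.add_posSemidef (hopGram_posSemidef Q Z)

theorem hopCov_add_hopGram_posDef : (hopCov P F + hopGram Q Z).PosDef :=
  (hopCov_posDef P F).add_posSemidef (hopGram_posSemidef Q Z)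

variable {P Q F Z} {p q : ℝ}

/-- The linear term of the energy along `G` is negative and outweighs the quadratic one for small
`t`, so perturbations in such directions respect the power budget. -/
theorem energy_add_smul_le {m l : ℕ} {A G : Matrix (Fin m) (Fin l) ℂ}
    (hG : (Gᴴ * A).trace.re < 0) : ∃ δ > 0, ∀ t : ℝ, 0 < t → t < δ →
      energy (A + (t : ℂ) • G) ≤ energy A := by
  have hpos : 0 < energy G + 1 := by linarith [energy_nonneg G]
  refine ⟨-(Gᴴ * A).trace.re / (energy G + 1), div_pos (neg_pos.mpr hG) hpos, fun t h0 ht => ?_⟩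
  rw [energy_add_smul]
  rw [lt_div_iff₀ hpos] at ht
  nlinarith [mul_pos h0 h0, energy_nonneg G]

/-- With `F` fixed, only `det (1 + D) / det (C + D)` varies. Its logarithmic derivative along `G` is
`2 Re tr (Gᴴ Qᴴ Q Z Γ)`, where `Γ` is the difference of inverses in the statement; the multiplier
lemma then applies. -/
theorem stationary_relay (hZ : Z ≠ 0) (hZq : energy Z ≤ q)
    (hmax : ∀ Z' : Matrix (Fin Nr) (Fin Nr) ℂ, energy Z' ≤ q → gain P Q F Z' ≤ gain P Q F Z) :
    ∃ ν : ℝ, 0 ≤ ν ∧ Qᴴ * Q * Z * ((1 + hopGram Q Z)⁻¹ - (hopCov P F + hopGram Q Z)⁻¹)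
      = (ν : ℂ) • Z := by
  refine exists_multiplier hZ fun G hG => ?_
  set Γ := (1 + hopGram Q Z)⁻¹ - (hopCov P F + hopGram Q Z)⁻¹ with hΓ
  have hΓH : Γᴴ = Γ := by
    rw [hΓ, conjTranspose_sub, (one_add_hopGram_posDef Q Z).inv.1.eq,
      (hopCov_add_hopGram_posDef P Q F Z).inv.1.eq]
  obtain ⟨δ, hδ, hle⟩ := energy_add_smul_le hG
  have h := trace_inv_sub_inv_mul_nonpos (E := (Q * Z)ᴴ * (Q * G) + (Q * G)ᴴ * (Q * Z))
    (G := (Q * G)ᴴ * (Q * G)) (one_add_hopGram_posDef Q Z) (hopCov_add_hopGram_posDef P Q F Z) hδ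
    (by
      intro t h0 ht
      have h1 := hmax (Z + (t : ℂ) • G) ((hle t h0 ht).trans hZq)
      have hexp : hopGram Q (Z + (t : ℂ) • G) = hopGram Q Z
          + ((t : ℂ) • ((Q * Z)ᴴ * (Q * G) + (Q * G)ᴴ * (Q * Z))
            + (t : ℂ) ^ 2 • ((Q * G)ᴴ * (Q * G))) := by
        simp only [hopGram, Matrix.mul_add, Matrix.mul_smul, conjTranspose_add, conjTranspose_smul,
          Matrix.add_mul, Matrix.smul_mul, smul_add, Complex.star_def, Complex.conj_ofReal, sq,
          smul_smul]
        abel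
      rw [gain, gain, div_le_div_iff₀ (hopCov_add_hopGram_posDef P Q F _).det_re_pos
        (hopCov_add_hopGram_posDef P Q F _).det_re_pos, hexp,
        ← add_assoc 1, ← add_assoc (hopCov P F)] at h1
      have hc := (hopCov_posDef P F).det_re_pos
      rw [mul_assoc, mul_assoc] at h1
      exact le_of_mul_le_mul_left h1 hc)
  have e1 : (Γ * ((Q * Z)ᴴ * (Q * G))).trace.re = (Gᴴ * (Qᴴ * Q * Z * Γ)).trace.re := by
    have : Γ * ((Q * Z)ᴴ * (Q * G)) = (Qᴴ * Q * Z * Γ)ᴴ * G := by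
      simp only [conjTranspose_mul, conjTranspose_conjTranspose, hΓH, Matrix.mul_assoc]
    rw [this, trace_conjTranspose_mul_re_comm]
  have e2 : (Γ * ((Q * G)ᴴ * (Q * Z))).trace.re = (Gᴴ * (Qᴴ * Q * Z * Γ)).trace.re := by
    rw [trace_mul_comm]
    simp only [conjTranspose_mul, Matrix.mul_assoc]
  rw [Matrix.mul_add, trace_add, Complex.add_re, e1, e2] at h
  linarith

/-- The same argument with `Z` fixed, for the varying quotient `det C / det (C + D)`. -/
theorem stationary_source (hF : F ≠ 0) (hFp : energy F ≤ p)
    (hmax : ∀ F' : Matrix (Fin Ns) (Fin k) ℂ, energy F' ≤ p → gain P Q F' Z ≤ gain P Q F Z) :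
    ∃ κ : ℝ, 0 ≤ κ ∧ Pᴴ * ((hopCov P F)⁻¹ - (hopCov P F + hopGram Q Z)⁻¹) * (P * F)
      = (κ : ℂ) • F := by
  refine exists_multiplier hF fun G hG => ?_
  set Γ := (hopCov P F)⁻¹ - (hopCov P F + hopGram Q Z)⁻¹ with hΓ
  have hΓH : Γᴴ = Γ := by
    rw [hΓ, conjTranspose_sub, (hopCov_posDef P F).inv.1.eq,
      (hopCov_add_hopGram_posDef P Q F Z).inv.1.eq]
  obtain ⟨δ, hδ, hle⟩ := energy_add_smul_le hG
  have h := trace_inv_sub_inv_mul_nonpos (E := (P * F) * (P * G)ᴴ + (P * G) * (P * F)ᴴ)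
    (G := (P * G) * (P * G)ᴴ) (hopCov_posDef P F) (hopCov_add_hopGram_posDef P Q F Z) hδ
    (by
      intro t h0 ht
      have h1 := hmax (F + (t : ℂ) • G) ((hle t h0 ht).trans hFp)
      have hexp : hopCov P (F + (t : ℂ) • G) = hopCov P F
          + ((t : ℂ) • ((P * F) * (P * G)ᴴ + (P * G) * (P * F)ᴴ)
            + (t : ℂ) ^ 2 • ((P * G) * (P * G)ᴴ)) := by
        simp only [hopCov, Matrix.mul_add, Matrix.mul_smul, conjTranspose_add, conjTranspose_smul,
          Matrix.add_mul, Matrix.smul_mul, smul_add, Complex.star_def, Complex.conj_ofReal, sq,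
          smul_smul]
        abel
      rw [gain, gain, div_le_div_iff₀ (hopCov_add_hopGram_posDef P Q _ _).det_re_pos
        (hopCov_add_hopGram_posDef P Q F _).det_re_pos, hexp, add_right_comm] at h1
      have hc := (one_add_hopGram_posDef Q Z).det_re_pos
      rw [mul_right_comm, mul_right_comm _ (1 + hopGram Q Z).det.re] at h1
      exact le_of_mul_le_mul_right h1 hc)
  have e1 : (Γ * ((P * F) * (P * G)ᴴ)).trace.re = (Gᴴ * (Pᴴ * Γ * (P * F))).trace.re := by
    rw [← Matrix.mul_assoc, trace_mul_comm]
    simp only [conjTranspose_mul, Matrix.mul_assoc]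
  have e2 : (Γ * ((P * G) * (P * F)ᴴ)).trace.re = (Gᴴ * (Pᴴ * Γ * (P * F))).trace.re := by
    rw [trace_conjTranspose_mul_re_comm, ← Matrix.mul_assoc, trace_mul_comm]
    simp only [conjTranspose_mul, conjTranspose_conjTranspose, hΓH, Matrix.mul_assoc]
  rw [Matrix.mul_add, trace_add, Complex.add_re, e1, e2] at h
  linarith

end Gain

/-! ### Exchange arguments for parallel scalar links -/

section ScalarOrder

variable {ι : Type*} [Fintype ι]

/-- The gain of parallel two-hop links with hop signal-to-noise ratios `m i` and `d i`. -/
def pairGain (m d : ι → ℝ) : ℝ := ∏ i, (1 + m i) * (1 + d i) / (1 + m i + d i)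

theorem pairGain_comm (m d : ι → ℝ) : pairGain m d = pairGain d m := by
  refine Finset.prod_congr rfl fun i _ => ?_
  rw [mul_comm (1 + m i), add_right_comm]

/-- All factors other than `i` and `j` cancel, so an exchange between two links is compared through
these two alone. -/
theorem prod_two_le {f g : ι → ℝ} (hg : ∀ k, 0 < g k) {i j : ι} (hij : i ≠ j)
    (h : ∀ k, k ≠ i → k ≠ j → f k = g k) (hle : ∏ k, f k ≤ ∏ k, g k) :
    f i * f j ≤ g i * g j := by
  have h1 : ∏ k, f k / g k = f i / g i * (f j / g j) := by
    refine Finset.prod_eq_mul i j hij (fun k _ hk => ?_) (by simp) (by simp)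
    rw [h k hk.1 hk.2, div_self (hg k).ne']
  rw [Finset.prod_div_distrib, div_mul_div_comm] at h1
  have h2 : (∏ k, f k) / ∏ k, g k ≤ 1 :=
    (div_le_one (Finset.prod_pos fun k _ => hg k)).mpr hle
  rw [h1, div_le_one (mul_pos (hg i) (hg j))] at h2
  exact h2

theorem sum_sub_sum_two {f g : ι → ℝ} {i j : ι} (hij : i ≠ j)
    (h : ∀ k, k ≠ i → k ≠ j → f k = g k) :
    ∑ k, f k - ∑ k, g k = (f i - g i) + (f j - g j) := by
  rw [← Finset.sum_sub_distrib]
  exact Finset.sum_eq_add i j hij (fun k _ hk => by rw [h k hk.1 hk.2, sub_self]) (by simp)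
    (by simp)

/-- `v` bounds the gain of all links with squared channel gains in `S` and `T` (closed under
permutations) and power budgets `p` and `q`. -/
structure GainBound (S T : Set (ι → ℝ)) (p q v : ℝ) : Prop where
  pos_left : ∀ a ∈ S, ∀ i, 0 < a i
  pos_right : ∀ b ∈ T, ∀ i, 0 < b i
  perm_left : ∀ a ∈ S, ∀ σ : Equiv.Perm ι, a ∘ σ ∈ S
  perm_right : ∀ b ∈ T, ∀ σ : Equiv.Perm ι, b ∘ σ ∈ T
  le : ∀ a ∈ S, ∀ b ∈ T, ∀ x y : ι → ℝ, (∀ i, 0 ≤ x i) → (∀ i, 0 ≤ y i) →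
    ∑ i, x i ≤ p → ∑ i, y i ≤ q → pairGain (fun i => x i * a i) (fun i => y i * b i) ≤ v

/-- A configuration attaining the bound. -/
structure Attains (S T : Set (ι → ℝ)) (p q v : ℝ) (a b x y : ι → ℝ) : Prop where
  mem_left : a ∈ S
  mem_right : b ∈ T
  pos_left : ∀ i, 0 < x i
  pos_right : ∀ i, 0 < y i
  sum_left : ∑ i, x i ≤ p
  sum_right : ∑ i, y i ≤ q
  eq : pairGain (fun i => x i * a i) (fun i => y i * b i) = v

variable {S T : Set (ι → ℝ)} {p q v : ℝ} {a b x y : ι → ℝ}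

/-- The hops enter `pairGain` symmetrically. With `Attains.symm`, this lets every exchange result
proved for the second hop be used for the first. -/
theorem GainBound.symm (h : GainBound S T p q v) : GainBound T S q p v :=
  ⟨h.pos_right, h.pos_left, h.perm_right, h.perm_left, fun a ha b hb x y hx hy hxq hyp => by
    rw [pairGain_comm]; exact h.le b hb a ha y x hy hx hyp hxq⟩

theorem Attains.symm (h : Attains S T p q v a b x y) : Attains T S q p v b a y x :=
  ⟨h.mem_right, h.mem_left, h.pos_right, h.pos_left, h.sum_right, h.sum_left, by
    rw [pairGain_comm]; exact h.eq⟩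

theorem link_lt_link {m d e : ℝ} (hm : 0 < m) (hd : 0 < d) (hde : d < e) :
    (1 + m) * (1 + d) / (1 + m + d) < (1 + m) * (1 + e) / (1 + m + e) := by
  rw [div_lt_div_iff₀ (by linarith) (by linarith)]
  nlinarith [mul_pos hm (sub_pos.mpr hde), mul_pos (mul_pos hm hm) (sub_pos.mpr hde)]

theorem link_pos {m d : ℝ} (hm : 0 < m) (hd : 0 < d) : 0 < (1 + m) * (1 + d) / (1 + m + d) := by
  positivity

variable [DecidableEq ι]

/-- Unspent power given to link `i` would strictly raise its gain, as both of its signal-to-noise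
ratios are positive. The argument `i` supplies a link to receive it. -/
theorem Attains.sum_right_eq (hB : GainBound S T p q v) (h : Attains S T p q v a b x y) (i : ι) :
    ∑ k, y k = q := by
  by_contra hne
  have hlt : ∑ k, y k < q := lt_of_le_of_ne h.sum_right hne
  have hm : ∀ k, 0 < x k * a k := fun k => mul_pos (h.pos_left k) (hB.pos_left a h.mem_left k)
  have hb := hB.pos_right b h.mem_right
  have hd : ∀ k, 0 < y k * b k := fun k => mul_pos (h.pos_right k) (hb k)
  let y' := Function.update y i (y i + (q - ∑ k, y k))
  have hyi : y' i = y i + (q - ∑ k, y k) := by simp [y']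
  have hyk : ∀ k, k ≠ i → y' k = y k := fun k hk => by simp [y', hk]
  have hyy : ∀ k, y k ≤ y' k := by
    intro k
    by_cases hk : k = i
    · subst hk; rw [hyi]; linarith
    · rw [hyk k hk]
  have hsum : ∑ k, y' k = q := by
    have : ∑ k, (y' k - y k) = y' i - y i :=
      Finset.sum_eq_single i (fun k _ hk => by rw [hyk k hk, sub_self]) (by simp)
    rw [Finset.sum_sub_distrib, hyi] at this
    linarith
  have hle := hB.le a h.mem_left b h.mem_right x y' (fun k => (h.pos_left k).le)
    (fun k => (h.pos_right k).le.trans (hyy k)) h.sum_left hsum.le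
  rw [← h.eq] at hle
  refine absurd hle (not_le.mpr ?_)
  refine Finset.prod_lt_prod (fun k _ => link_pos (hm k) (hd k)) (fun k _ => ?_)
    ⟨i, Finset.mem_univ _, ?_⟩
  · by_cases hk : k = i
    · subst hk
      refine (link_lt_link (hm k) (hd k) ?_).le
      show y k * b k < y' k * b k
      rw [hyi]
      exact mul_lt_mul_of_pos_right (by linarith) (hb k)
    · simp only [hyk k hk]; exact le_rfl
  · refine link_lt_link (hm i) (hd i) ?_
    show y i * b i < y' i * b i
    rw [hyi]
    exact mul_lt_mul_of_pos_right (by linarith) (hb i)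

theorem eq_zero_of_forall_mul_add_sq_nonpos {L K δ : ℝ} (hδ : 0 < δ)
    (h : ∀ ε : ℝ, |ε| < δ → ε * L + ε ^ 2 * K ≤ 0) : L = 0 := by
  by_contra hL
  set s := |L| with hs
  have hspos : 0 < s := abs_pos.mpr hL
  set t := min (δ / 2) (s / (2 * (|K| + 1))) with ht
  have hK : 0 < |K| + 1 := by positivity
  have htpos : 0 < t := lt_min (by linarith) (by positivity)
  have htδ : t < δ := (min_le_left _ _).trans_lt (by linarith)
  have htK : t * (|K| + 1) ≤ s / 2 := by
    have : t ≤ s / (2 * (|K| + 1)) := min_le_right _ _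
    rw [le_div_iff₀ (by positivity)] at this
    linarith
  have hmain : t * s - t ^ 2 * |K| ≤ 0 := by
    rcases lt_or_gt_of_ne hL with h0 | h0
    · have := h (-t) (by rwa [abs_neg, abs_of_pos htpos])
      rw [hs, abs_of_neg h0]
      nlinarith [neg_abs_le K, sq_nonneg t, mul_nonneg (sq_nonneg t) (by linarith [neg_abs_le K] : 0 ≤ K + |K|)]
    · have := h t (by rwa [abs_of_pos htpos])
      rw [hs, abs_of_pos h0]
      nlinarith [mul_nonneg (sq_nonneg t) (by linarith [neg_abs_le K] : 0 ≤ K + |K|)]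
  have : t * (s - t * |K|) ≤ 0 := by linarith [hmain, sq t]
  have h2 : s - t * |K| ≤ 0 := nonpos_of_mul_nonpos_right this htpos
  nlinarith

/-- Each side is the derivative of the logarithm of a link's gain in its power `y`. Moving a small
power of either sign between two links keeps the budget, so at an optimum these derivatives agree.
-/
theorem Attains.marginal_eq (hB : GainBound S T p q v) (h : Attains S T p q v a b x y) {i j : ι}
    (hij : i ≠ j) :
    b i * (x i * a i / ((1 + y i * b i) * (1 + x i * a i + y i * b i)))
      = b j * (x j * a j / ((1 + y j * b j) * (1 + x j * a j + y j * b j))) := by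
  have hm : ∀ k, 0 < x k * a k := fun k => mul_pos (h.pos_left k) (hB.pos_left a h.mem_left k)
  have hb := hB.pos_right b h.mem_right
  have hd : ∀ k, 0 < y k * b k := fun k => mul_pos (h.pos_right k) (hb k)
  have hδ : 0 < min (y i) (y j) := lt_min (h.pos_right i) (h.pos_right j)
  set mi := x i * a i with hmi
  set mj := x j * a j with hmj
  set di := y i * b i with hdi
  set dj := y j * b j with hdj
  -- `L` and `K` are the coefficients of `ε` and `ε²` in the optimality inequality for moving power
  -- `ε` from link `j` to link `i`, with denominators cleared and the factor `(1 + mi) * (1 + mj)`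
  -- cancelled.
  have h0 := eq_zero_of_forall_mul_add_sq_nonpos
    (L := (b i * (1 + dj) - b j * (1 + di)) * ((1 + mi + di) * (1 + mj + dj))
      - ((1 + di) * (1 + dj)) * (b i * (1 + mj + dj) - b j * (1 + mi + di)))
    (K := - (b i * b j) * ((1 + mi + di) * (1 + mj + dj)) + ((1 + di) * (1 + dj)) * (b i * b j))
    hδ (by
    intro ε hε
    have hεi : |ε| < y i := hε.trans_le (min_le_left _ _)
    have hεj : |ε| < y j := hε.trans_le (min_le_right _ _)
    rw [abs_lt] at hεi hεj
    let y' := Function.update (Function.update y i (y i + ε)) j (y j - ε)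
    have hyi : y' i = y i + ε := by simp [y', hij]
    have hyj : y' j = y j - ε := by simp [y']
    have hyk : ∀ k, k ≠ i → k ≠ j → y' k = y k := fun k hk hk' => by simp [y', hk, hk']
    have hpos : ∀ k, 0 < y' k := by
      intro k
      by_cases hk : k = i
      · subst hk; rw [hyi]; linarith
      · by_cases hk' : k = j
        · subst hk'; rw [hyj]; linarith
        · rw [hyk k hk hk']; exact h.pos_right k
    have hsum := sum_sub_sum_two hij hyk
    rw [hyi, hyj] at hsum
    have hle := hB.le a h.mem_left b h.mem_right x y' (fun k => (h.pos_left k).le)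
      (fun k => (hpos k).le) h.sum_left (by linarith [h.sum_right])
    rw [← h.eq] at hle
    have h2 := prod_two_le (fun k => link_pos (hm k) (hd k)) hij (fun k hk hk' => by simp only [hyk k hk hk']) hle
    simp only [hyi, hyj, add_mul, sub_mul, ← hmi, ← hmj, ← hdi, ← hdj] at h2
    have p1 : 0 < 1 + mi + (di + ε * b i) := by
      have := mul_pos (hpos i) (hb i); rw [hyi, add_mul, ← hdi] at this; linarith [hm i]
    have p2 : 0 < 1 + mj + (dj - ε * b j) := by
      have := mul_pos (hpos j) (hb j); rw [hyj, sub_mul, ← hdj] at this; linarith [hm j]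
    have p3 : 0 < 1 + mi + di := by linarith [hm i, hd i]
    have p4 : 0 < 1 + mj + dj := by linarith [hm j, hd j]
    rw [div_mul_div_comm, div_mul_div_comm, div_le_div_iff₀ (mul_pos p1 p2) (mul_pos p3 p4)] at h2
    have q1 : 0 < (1 + mi) * (1 + mj) := mul_pos (by linarith [hm i]) (by linarith [hm j])
    refine nonpos_of_mul_nonpos_right ?_ q1
    linarith)
  have e1 : 1 + di ≠ 0 := by linarith [hd i]
  have e2 : 1 + dj ≠ 0 := by linarith [hd j]
  have e3 : 1 + mi + di ≠ 0 := by linarith [hm i, hd i]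
  have e4 : 1 + mj + dj ≠ 0 := by linarith [hm j, hd j]
  field_simp
  linarith

/-- Swapping the second-hop ratios of two links preserves the numerators and replaces `(1 + mᵢ +
dᵢ)(1 + mⱼ + dⱼ)` by `(1 + mᵢ + dⱼ)(1 + mⱼ + dᵢ)`. The latter minus the former is exactly the
product in the statement. -/
theorem Attains.no_inversion (hB : GainBound S T p q v) (h : Attains S T p q v a b x y) {i j : ι}
    (hij : i ≠ j) : 0 ≤ (x i * a i - x j * a j) * (y i * b i - y j * b j) := by
  have hm : ∀ k, 0 < x k * a k := fun k => mul_pos (h.pos_left k) (hB.pos_left a h.mem_left k)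
  have hd : ∀ k, 0 < y k * b k :=
    fun k => mul_pos (h.pos_right k) (hB.pos_right b h.mem_right k)
  have hle := hB.le a h.mem_left _ (hB.perm_right b h.mem_right (Equiv.swap i j)) x
    (y ∘ Equiv.swap i j) (fun k => (h.pos_left k).le) (fun k => (h.pos_right _).le) h.sum_left
    ((Equiv.sum_comp (Equiv.swap i j) y).trans_le h.sum_right)
  rw [← h.eq] at hle
  have h2 := prod_two_le (fun k => link_pos (hm k) (hd k)) hij
    (fun k hk hk' => by simp only [Function.comp_apply, Equiv.swap_apply_of_ne_of_ne hk hk']) hle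
  simp only [Function.comp_apply, Equiv.swap_apply_left, Equiv.swap_apply_right] at h2
  rw [div_mul_div_comm, div_mul_div_comm] at h2
  have hm1 := hm i
  have hm2 := hm j
  have hd1 := hd i
  have hd2 := hd j
  generalize x i * a i = mi at *
  generalize x j * a j = mj at *
  generalize y i * b i = di at *
  generalize y j * b j = dj at *
  rw [show (1 + mi) * (1 + di) * ((1 + mj) * (1 + dj)) = (1 + mi) * (1 + dj) * ((1 + mj) * (1 + di))
    by ring, div_le_div_iff_of_pos_left (by positivity) (by positivity) (by positivity)] at h2
  linarith

/-- Suppose `b i < b j`. Swapping these coefficients while keeping all signal-to-noise ratios costs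
no more power, by rearrangement, so the swapped configuration is optimal too. With `g` the marginal
factor, which depends only on the ratios, equal marginals give `bᵢ gᵢ = bⱼ gⱼ` before and `bⱼ gᵢ =
bᵢ gⱼ` after the swap; for positive `g` this is impossible. -/
theorem Attains.gain_le (hB : GainBound S T p q v) (h : Attains S T p q v a b x y) {i j : ι}
    (hm : x j * a j ≤ x i * a i) (hd : y j * b j ≤ y i * b i) : b j ≤ b i := by
  by_contra hlt
  push Not at hlt
  have hij : i ≠ j := fun h => by subst h; exact lt_irrefl _ hlt
  have hb := hB.pos_right b h.mem_right
  have hdp : ∀ k, 0 < y k * b k := fun k => mul_pos (h.pos_right k) (hb k)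
  set σ := Equiv.swap i j with hσ
  set y' : ι → ℝ := fun k => y k * b k / b (σ k) with hy'
  have hyb : ∀ k, y' k * (b ∘ σ) k = y k * b k := fun k => div_mul_cancel₀ _ (hb _).ne'
  have hyk : ∀ k, k ≠ i → k ≠ j → y' k = y k := by
    intro k hk hk'
    simp only [hy', hσ, Equiv.swap_apply_of_ne_of_ne hk hk']
    exact mul_div_cancel_right₀ _ (hb k).ne'
  have hsum := sum_sub_sum_two hij hyk
  have hyi : y' i = y i * b i / b j := by simp [hy', hσ]
  have hyj : y' j = y j * b j / b i := by simp [hy', hσ]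
  have hdiff : y' i - y i + (y' j - y j)
      = - ((y i * b i - y j * b j) * (b j - b i) / (b i * b j)) := by
    rw [hyi, hyj]
    have := (hb i).ne'
    have := (hb j).ne'
    field_simp
    ring
  have hpos : 0 ≤ (y i * b i - y j * b j) * (b j - b i) / (b i * b j) :=
    div_nonneg (mul_nonneg (by linarith) (by linarith)) (mul_pos (hb i) (hb j)).le
  have hA : Attains S T p q v a (b ∘ σ) x y' :=
    ⟨h.mem_left, hB.perm_right b h.mem_right σ, h.pos_left,
      fun k => div_pos (hdp k) (hb _), h.sum_left, by linarith [h.sum_right], by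
      simp only [hyb]; exact h.eq⟩
  have s1 := h.sum_right_eq hB i
  have s2 := hA.sum_right_eq hB i
  have hz : (y i * b i - y j * b j) * (b j - b i) / (b i * b j) = 0 := by linarith
  have hdd : y i * b i = y j * b j := by
    rcases div_eq_zero_iff.mp hz with hz | hz
    · rcases mul_eq_zero.mp hz with hz | hz
      · linarith
      · linarith
    · exact absurd hz (mul_pos (hb i) (hb j)).ne'
  have k1 := h.marginal_eq hB hij
  have k2 := hA.marginal_eq hB hij
  rw [hyb, hyb] at k2
  have hσi : (b ∘ σ) i = b j := by simp [hσ]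
  have hσj : (b ∘ σ) j = b i := by simp [hσ]
  rw [hσi, hσj] at k2
  have g1 : 0 < x i * a i / ((1 + y i * b i) * (1 + x i * a i + y i * b i)) := by
    have := hdp i
    have := mul_pos (h.pos_left i) (hB.pos_left a h.mem_left i)
    positivity
  have g2 : 0 < x j * a j / ((1 + y j * b j) * (1 + x j * a j + y j * b j)) := by
    have := hdp j
    have := mul_pos (h.pos_left j) (hB.pos_left a h.mem_left j)
    positivity
  nlinarith [hb i, hb j, mul_pos (sub_pos.mpr hlt) g1, mul_pos (sub_pos.mpr hlt) g2]

/-- A larger coefficient would reach the same signal-to-noise ratio with less power, giving an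
optimal configuration that leaves power unspent, against `Attains.sum_right_eq`. -/
theorem Attains.update_le (hB : GainBound S T p q v) (h : Attains S T p q v a b x y) {i : ι} {τ : ℝ}
    (hτ : Function.update b i τ ∈ T) : τ ≤ b i := by
  by_contra hlt
  push Not at hlt
  have hb := hB.pos_right b h.mem_right
  have hτ0 : 0 < τ := (hb i).trans hlt
  have hlt' : y i * b i / τ < y i := by
    rw [div_lt_iff₀ hτ0]
    exact mul_lt_mul_of_pos_left hlt (h.pos_right i)
  -- Power rescaled so that the product with the new coefficient, and hence the gain, is unchanged.
  set y' := Function.update y i (y i * b i / τ) with hy'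
  have hyb : ∀ k, y' k * Function.update b i τ k = y k * b k := by
    intro k
    by_cases hk : k = i
    · subst hk
      simp [hy', hτ0.ne']
    · simp [hy', hk]
  have hsum : ∑ k, y' k - ∑ k, y k = y' i - y i := by
    rw [← Finset.sum_sub_distrib]
    exact Finset.sum_eq_single i (fun k _ hk => by simp [hy', hk]) (by simp)
  have hyi : y' i = y i * b i / τ := by simp [hy']
  rw [hyi] at hsum
  have hA : Attains S T p q v a (Function.update b i τ) x y' :=
    ⟨h.mem_left, hτ, h.pos_left, fun k => by
      by_cases hk : k = i
      · subst hk; rw [hyi]; exact div_pos (mul_pos (h.pos_right k) (hb k)) hτ0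
      · simp only [hy', Function.update_of_ne hk]; exact h.pos_right k,
      h.sum_left, by linarith [h.sum_right], by simp only [hyb]; exact h.eq⟩
  have s1 := h.sum_right_eq hB i
  have s2 := hA.sum_right_eq hB i
  linarith

end ScalarOrder

/-! ### Evaluating the gain on orthonormal frames -/

section Frames

/-- The complex diagonal matrix with real diagonal `a`. -/
def realDiag {ι : Type*} [DecidableEq ι] (a : ι → ℝ) : Matrix ι ι ℂ := diagonal fun i => (a i : ℂ)

theorem realDiag_mul_realDiag {ι : Type*} [Fintype ι] [DecidableEq ι] (a b : ι → ℝ) :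
    realDiag a * realDiag b = realDiag fun i => a i * b i := by
  simp [realDiag, diagonal_mul_diagonal]

theorem realDiag_conjTranspose {ι : Type*} [DecidableEq ι] (a : ι → ℝ) :
    (realDiag a)ᴴ = realDiag a := by
  simp [realDiag, diagonal_conjTranspose, Pi.star_def]

theorem realDiag_one {ι : Type*} [DecidableEq ι] : (realDiag fun _ : ι => (1 : ℝ)) = 1 := by
  simp [realDiag]

theorem realDiag_add {ι : Type*} [DecidableEq ι] (a b : ι → ℝ) :
    realDiag a + realDiag b = realDiag fun i => a i + b i := by
  simp [realDiag, diagonal_add]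

theorem realDiag_smul {ι : Type*} [DecidableEq ι] (c : ℝ) (a : ι → ℝ) :
    (c : ℂ) • realDiag a = realDiag fun i => c * a i := by
  ext i j
  simp [realDiag, diagonal_apply]

theorem realDiag_injective {ι : Type*} [DecidableEq ι] {a b : ι → ℝ}
    (h : realDiag a = realDiag b) : a = b := by
  ext i
  have := congrFun (congrFun h i) i
  simpa [realDiag] using this

theorem trace_realDiag {ι : Type*} [Fintype ι] [DecidableEq ι] (a : ι → ℝ) :
    (realDiag a).trace = ((∑ i, a i : ℝ) : ℂ) := by
  simp [realDiag, trace_diagonal]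

theorem det_realDiag {ι : Type*} [Fintype ι] [DecidableEq ι] (a : ι → ℝ) :
    (realDiag a).det = ((∏ i, a i : ℝ) : ℂ) := by
  simp [realDiag, det_diagonal]

theorem mul_submatrix_id {m n l r : ℕ} (A : Matrix (Fin m) (Fin n) ℂ) (W : Matrix (Fin n) (Fin l) ℂ)
    (e : Fin r → Fin l) : A * W.submatrix id e = (A * W).submatrix id e := by
  ext i j
  simp [Matrix.mul_apply]

theorem submatrix_mul_realDiag {n l r : ℕ} (W : Matrix (Fin n) (Fin l) ℂ) (a : Fin l → ℝ)
    (e : Fin r → Fin l) :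
    (W * realDiag a).submatrix id e = W.submatrix id e * realDiag (a ∘ e) := by
  ext i j
  simp [realDiag, mul_diagonal]

theorem conjTranspose_mul_submatrix {n l r : ℕ} (X Y : Matrix (Fin n) (Fin l) ℂ)
    (e : Fin r → Fin l) :
    (X.submatrix id e)ᴴ * Y.submatrix id e = (Xᴴ * Y).submatrix e e := by
  ext i j
  simp [Matrix.mul_apply]

theorem realDiag_submatrix {l r : ℕ} (a : Fin l → ℝ) {e : Fin r → Fin l}
    (he : Function.Injective e) : (realDiag a).submatrix e e = realDiag (a ∘ e) := by
  ext i j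
  simp [realDiag, diagonal_apply, he.eq_iff]

/-- `X * Yᴴ` is a sum over common column indices, so columns whose contribution vanishes may be
dropped. This isolates the active modes. -/
theorem mul_conjTranspose_eq_submatrix {m n l r : ℕ} (X : Matrix (Fin m) (Fin l) ℂ)
    (Y : Matrix (Fin n) (Fin l) ℂ) {e : Fin r → Fin l} (he : Function.Injective e)
    (h : ∀ i ∉ Set.range e, ∀ x y, X x i * star (Y y i) = 0) :
    X * Yᴴ = X.submatrix id e * (Y.submatrix id e)ᴴ := by
  ext x y
  simp only [Matrix.mul_apply, conjTranspose_apply, submatrix_apply, id_eq]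
  exact (Fintype.sum_of_injective e he _ _ (fun i hi => h i hi x y) fun i => rfl).symm

theorem inv_mul_eq_mul_realDiag {n : ℕ} {A W : Matrix (Fin n) (Fin n) ℂ} {a : Fin n → ℝ}
    (hA : IsUnit A.det) (ha : ∀ i, a i ≠ 0) (h : A * W = W * realDiag a) :
    A⁻¹ * W = W * realDiag fun i => (a i)⁻¹ := by
  have h1 : W * realDiag a * realDiag (fun i => (a i)⁻¹) = W := by
    rw [Matrix.mul_assoc, realDiag_mul_realDiag]
    simp [ha, realDiag_one]
  calc A⁻¹ * W = A⁻¹ * (A * W * realDiag (fun i => (a i)⁻¹)) := by rw [h, h1]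
    _ = _ := by rw [← Matrix.mul_assoc, ← Matrix.mul_assoc, nonsing_inv_mul _ hA, Matrix.one_mul]

theorem det_of_mul_eq_mul_realDiag {n : ℕ} {A W : Matrix (Fin n) (Fin n) ℂ} {a : Fin n → ℝ}
    (hW : W ∈ unitaryGroup (Fin n) ℂ) (h : A * W = W * realDiag a) : A.det.re = ∏ i, a i := by
  have hA : A = W * realDiag a * Wᴴ := by
    rw [← h, Matrix.mul_assoc, unitary_mul_conjTranspose hW, Matrix.mul_one]
  rw [hA, det_mul_right_comm, unitary_mul_conjTranspose hW, Matrix.one_mul, det_realDiag,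
    Complex.ofReal_re]

theorem det_one_add_frame {n r : ℕ} {w : Matrix (Fin n) (Fin r) ℂ} (hw : wᴴ * w = 1)
    (c : Fin r → ℝ) : (1 + w * realDiag c * wᴴ).det.re = ∏ i, (1 + c i) := by
  rw [Matrix.mul_assoc, det_one_add_mul_comm, Matrix.mul_assoc, hw, Matrix.mul_one,
    ← realDiag_one, realDiag_add, det_realDiag, Complex.ofReal_re]

theorem energy_frame {m n r : ℕ} {v : Matrix (Fin m) (Fin r) ℂ} {w : Matrix (Fin n) (Fin r) ℂ}
    (hv : vᴴ * v = 1) (hw : wᴴ * w = 1) {y : Fin r → ℝ} (hy : ∀ i, 0 ≤ y i) :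
    energy (v * realDiag (fun i => Real.sqrt (y i)) * wᴴ) = ∑ i, y i := by
  have h : (v * realDiag (fun i => Real.sqrt (y i)) * wᴴ) *
      (v * realDiag (fun i => Real.sqrt (y i)) * wᴴ)ᴴ = v * (realDiag y * vᴴ) := by
    have : realDiag y = realDiag (fun i => Real.sqrt (y i)) * realDiag fun i => Real.sqrt (y i) := by
      rw [realDiag_mul_realDiag]; simp only [Real.mul_self_sqrt (hy _)]
    rw [this]
    simp only [conjTranspose_mul, conjTranspose_conjTranspose, realDiag_conjTranspose]
    calc _ = v * realDiag (fun i => Real.sqrt (y i)) * (wᴴ * w) *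
          realDiag (fun i => Real.sqrt (y i)) * vᴴ := by simp only [Matrix.mul_assoc]
      _ = _ := by rw [hw]; simp only [Matrix.mul_assoc, Matrix.one_mul]
  rw [energy, h, trace_mul_comm, Matrix.mul_assoc, hv, Matrix.mul_one, trace_realDiag,
    Complex.ofReal_re]

variable {Ns Nr Nd k r : ℕ} {P : Matrix (Fin Nr) (Fin Ns) ℂ} {Q : Matrix (Fin Nd) (Fin Nr) ℂ}

theorem hopCov_frame {w : Matrix (Fin Nr) (Fin r) ℂ} {pp : Matrix (Fin Ns) (Fin r) ℂ}
    {φ : Matrix (Fin k) (Fin r) ℂ} {a x : Fin r → ℝ} (hφ : φᴴ * φ = 1) (ha : ∀ i, 0 ≤ a i)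
    (hx : ∀ i, 0 ≤ x i) (hw : P * pp = w * realDiag fun i => Real.sqrt (a i)) :
    hopCov P (pp * realDiag (fun i => Real.sqrt (x i)) * φᴴ)
      = 1 + w * realDiag (fun i => x i * a i) * wᴴ := by
  have h1 : P * (pp * realDiag (fun i => Real.sqrt (x i)) * φᴴ)
      = w * realDiag (fun i => Real.sqrt (a i) * Real.sqrt (x i)) * φᴴ := by
    rw [← Matrix.mul_assoc, ← Matrix.mul_assoc, hw, Matrix.mul_assoc w, realDiag_mul_realDiag]
  rw [hopCov, h1]
  congr 1
  have : realDiag (fun i => x i * a i) = realDiag (fun i => Real.sqrt (a i) * Real.sqrt (x i)) *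
      realDiag fun i => Real.sqrt (a i) * Real.sqrt (x i) := by
    rw [realDiag_mul_realDiag]
    congr 1
    ext i
    rw [mul_mul_mul_comm, Real.mul_self_sqrt (ha i), Real.mul_self_sqrt (hx i), mul_comm]
  rw [this]
  simp only [conjTranspose_mul, conjTranspose_conjTranspose, realDiag_conjTranspose]
  calc _ = w * realDiag (fun i => Real.sqrt (a i) * Real.sqrt (x i)) * (φᴴ * φ) *
        realDiag (fun i => Real.sqrt (a i) * Real.sqrt (x i)) * wᴴ := by simp only [Matrix.mul_assoc]
    _ = _ := by rw [hφ]; simp only [Matrix.mul_assoc, Matrix.one_mul]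

theorem hopGram_frame {w v : Matrix (Fin Nr) (Fin r) ℂ} {b y : Fin r → ℝ}
    (hy : ∀ i, 0 ≤ y i) (hQ : (Q * v)ᴴ * (Q * v) = realDiag b) :
    hopGram Q (v * realDiag (fun i => Real.sqrt (y i)) * wᴴ)
      = w * realDiag (fun i => y i * b i) * wᴴ := by
  have : realDiag (fun i => y i * b i) = realDiag (fun i => Real.sqrt (y i)) * realDiag b *
      realDiag fun i => Real.sqrt (y i) := by
    rw [realDiag_mul_realDiag, realDiag_mul_realDiag]
    congr 1
    ext i
    rw [mul_right_comm, Real.mul_self_sqrt (hy i)]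
  rw [this, ← hQ, hopGram]
  simp only [conjTranspose_mul, conjTranspose_conjTranspose, realDiag_conjTranspose, Matrix.mul_assoc]

/-- Matched frames `w` make all three determinants in `gain` diagonal simultaneously, so the gain
factors over the modes. -/
theorem gain_frame {w v : Matrix (Fin Nr) (Fin r) ℂ} {pp : Matrix (Fin Ns) (Fin r) ℂ}
    {φ : Matrix (Fin k) (Fin r) ℂ} {a b x y : Fin r → ℝ} (hw : wᴴ * w = 1) (hφ : φᴴ * φ = 1)
    (ha : ∀ i, 0 ≤ a i) (hx : ∀ i, 0 ≤ x i) (hy : ∀ i, 0 ≤ y i)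
    (hP : P * pp = w * realDiag fun i => Real.sqrt (a i))
    (hQ : (Q * v)ᴴ * (Q * v) = realDiag b) :
    gain P Q (pp * realDiag (fun i => Real.sqrt (x i)) * φᴴ)
      (v * realDiag (fun i => Real.sqrt (y i)) * wᴴ)
      = pairGain (fun i => x i * a i) (fun i => y i * b i) := by
  have hsum : 1 + w * realDiag (fun i => x i * a i) * wᴴ + w * realDiag (fun i => y i * b i) * wᴴ
      = 1 + w * realDiag (fun i => x i * a i + y i * b i) * wᴴ := by
    rw [← realDiag_add, Matrix.mul_add, Matrix.add_mul, add_assoc]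
  rw [gain, hopCov_frame hφ ha hx hP, hopGram_frame hy hQ, hsum, det_one_add_frame hw,
    det_one_add_frame hw, det_one_add_frame hw, pairGain, Finset.prod_div_distrib,
    Finset.prod_mul_distrib]
  simp only [add_assoc]

end Frames

/-! ### Joint eigenbasis of a gain maximiser -/

section Structure

variable {Ns Nr Nd k : ℕ} {P : Matrix (Fin Nr) (Fin Ns) ℂ} {Q : Matrix (Fin Nd) (Fin Nr) ℂ}
  {F : Matrix (Fin Ns) (Fin k) ℂ} {Z : Matrix (Fin Nr) (Fin Nr) ℂ} {p q : ℝ}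

theorem realDiag_sub {ι : Type*} [DecidableEq ι] (a b : ι → ℝ) :
    realDiag a - realDiag b = realDiag fun i => a i - b i := by
  simp [realDiag, diagonal_sub]

theorem inv_commute {n : ℕ} {A B : Matrix (Fin n) (Fin n) ℂ} (hA : IsUnit A.det)
    (h : A * B = B * A) : A⁻¹ * B = B * A⁻¹ := by
  calc A⁻¹ * B = A⁻¹ * (B * A) * A⁻¹ := by
        rw [Matrix.mul_assoc, Matrix.mul_assoc, mul_nonsing_inv _ hA, Matrix.mul_one]
    _ = B * A⁻¹ := by rw [← h, ← Matrix.mul_assoc, nonsing_inv_mul _ hA, Matrix.one_mul]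

theorem commute_of_inv_commute {n : ℕ} {A B : Matrix (Fin n) (Fin n) ℂ} (hA : IsUnit A.det)
    (h : A⁻¹ * B = B * A⁻¹) : A * B = B * A := by
  have := inv_commute (isUnit_nonsing_inv_det A hA) h
  rwa [nonsing_inv_nonsing_inv _ hA] at this

theorem gain_zero_left : gain P Q (0 : Matrix (Fin Ns) (Fin k) ℂ) Z = 1 := by
  have h : hopCov P (0 : Matrix (Fin Ns) (Fin k) ℂ) = 1 := by simp [hopCov]
  rw [gain, h]
  simp [div_self (one_add_hopGram_posDef Q Z).det_re_pos.ne']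

theorem gain_zero_right : gain P Q F 0 = 1 := by
  have h : hopGram Q 0 = 0 := by simp [hopGram]
  rw [gain, h]
  simp [div_self (hopCov_posDef P F).det_re_pos.ne']

/-- Multiplying the stationarity condition by `Zᴴ` gives `D Γ = ν Zᴴ Z`, which is Hermitian; hence
`D` commutes with `Γ`. It also commutes with `(1 + D)⁻¹`, so it commutes with `(C + D)⁻¹` and
therefore with `C`. -/
theorem hopCov_hopGram_commute {ν : ℝ}
    (h : Qᴴ * Q * Z * ((1 + hopGram Q Z)⁻¹ - (hopCov P F + hopGram Q Z)⁻¹) = (ν : ℂ) • Z) :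
    hopCov P F * hopGram Q Z = hopGram Q Z * hopCov P F := by
  set D := hopGram Q Z with hD
  have hDH : Dᴴ = D := (hopGram_posSemidef Q Z).1
  have h1 := (one_add_hopGram_posDef Q Z)
  have h2 := (hopCov_add_hopGram_posDef P Q F Z)
  rw [← hD] at h1 h2
  set Γ := (1 + D)⁻¹ - (hopCov P F + D)⁻¹ with hΓ
  have hΓH : Γᴴ = Γ := by rw [hΓ, conjTranspose_sub, h1.inv.1.eq, h2.inv.1.eq]
  have e1 : D * Γ = (ν : ℂ) • (Zᴴ * Z) := by
    rw [← Matrix.mul_smul, ← h, hD, hopGram]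
    simp only [conjTranspose_mul, Matrix.mul_assoc]
  have e2 : D * Γ = Γ * D := by
    have := congrArg conjTranspose e1
    rw [conjTranspose_mul, hΓH, hDH, conjTranspose_smul, conjTranspose_mul,
      conjTranspose_conjTranspose, Complex.star_def, Complex.conj_ofReal, ← e1] at this
    exact this.symm
  have e3 : (1 + D)⁻¹ * D = D * (1 + D)⁻¹ :=
    inv_commute h1.isUnit_det' (by rw [Matrix.add_mul, Matrix.mul_add, Matrix.one_mul, Matrix.mul_one])
  have e4 : (hopCov P F + D)⁻¹ * D = D * (hopCov P F + D)⁻¹ := by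
    have e5 : (hopCov P F + D)⁻¹ = (1 + D)⁻¹ - Γ := by rw [hΓ]; abel
    rw [e5, Matrix.sub_mul, Matrix.mul_sub, e2, e3]
  have e6 := commute_of_inv_commute h2.isUnit_det' e4
  rw [Matrix.add_mul, Matrix.mul_add] at e6
  exact add_right_cancel e6

/-- Marginal gain with respect to the second argument. -/
def marginal (m d : ℝ) : ℝ := (1 + d)⁻¹ - (1 + m + d)⁻¹

theorem marginal_pos {m d : ℝ} (hm : 0 < m) (hd : 0 ≤ d) : 0 < marginal m d :=
  sub_pos.mpr (inv_strictAnti₀ (by linarith) (by linarith))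

theorem marginal_zero (d : ℝ) : marginal 0 d = 0 := by simp [marginal]

/-- The gain maximiser in the joint eigenbasis of both hop matrices. -/
structure JointBasis (P : Matrix (Fin Nr) (Fin Ns) ℂ) (Q : Matrix (Fin Nd) (Fin Nr) ℂ)
    (F : Matrix (Fin Ns) (Fin k) ℂ) (Z W : Matrix (Fin Nr) (Fin Nr) ℂ) (m d : Fin Nr → ℝ)
    (ν κ : ℝ) : Prop where
  unitary : W ∈ unitaryGroup (Fin Nr) ℂ
  m_nonneg : ∀ i, 0 ≤ m i
  d_nonneg : ∀ i, 0 ≤ d i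
  gram_left : (P * F) * (P * F)ᴴ * W = W * realDiag m
  gram_right : hopGram Q Z * W = W * realDiag d
  ν_pos : 0 < ν
  κ_pos : 0 < κ
  relay : Qᴴ * Q * (Z * W) * realDiag (fun i => marginal (m i) (d i)) = (ν : ℂ) • (Z * W)
  source : Pᴴ * W * realDiag (fun i => marginal (d i) (m i)) * Wᴴ * (P * F) = (κ : ℂ) • F

/-- The bound `1 < gain` guarantees a mode active on both hops. Such a mode makes both Lagrange
multipliers strictly positive, so they can be divided by later. -/
theorem exists_jointBasis (hF : energy F ≤ p) (hZ : energy Z ≤ q)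
    (hmax : ∀ (F' : Matrix (Fin Ns) (Fin k) ℂ) (Z' : Matrix (Fin Nr) (Fin Nr) ℂ),
      energy F' ≤ p → energy Z' ≤ q → gain P Q F' Z' ≤ gain P Q F Z)
    (hgain : 1 < gain P Q F Z) : ∃ W m d ν κ, JointBasis P Q F Z W m d ν κ := by
  have hF0 : F ≠ 0 := by
    rintro rfl
    rw [gain_zero_left] at hgain
    exact lt_irrefl _ hgain
  have hZ0 : Z ≠ 0 := by
    rintro rfl
    rw [gain_zero_right] at hgain
    exact lt_irrefl _ hgain
  obtain ⟨ν, hν, hνeq⟩ := stationary_relay hZ0 hZ fun Z' h => hmax F Z' hF h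
  obtain ⟨κ, hκ, hκeq⟩ := stationary_source hF0 hF fun F' h => hmax F' Z h hZ
  have hC := hopCov_posDef P F
  have hD := hopGram_posSemidef Q Z
  have h1D := one_add_hopGram_posDef Q Z
  have hCD := hopCov_add_hopGram_posDef P Q F Z
  obtain ⟨W, hW, c, d, hcW', hdW'⟩ := exists_joint_diagonalization hC.1 hD.1
    (hopCov_hopGram_commute hνeq)
  have hcW : hopCov P F * W = W * realDiag c := hcW'
  have hdW : hopGram Q Z * W = W * realDiag d := hdW'
  have hWW := unitary_conjTranspose_mul hW
  set m : Fin Nr → ℝ := fun i => c i - 1 with hm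
  have hcm : ∀ i, c i = 1 + m i := fun i => by simp [hm]
  have hmW : (P * F) * (P * F)ᴴ * W = W * realDiag m := by
    have e : (P * F) * (P * F)ᴴ = hopCov P F - 1 := by rw [hopCov]; abel
    have e2 : realDiag m = realDiag c - 1 := by rw [← realDiag_one, realDiag_sub]
    rw [e, e2, Matrix.sub_mul, Matrix.mul_sub, hcW, Matrix.one_mul, Matrix.mul_one]
  have nonneg_of : ∀ {S : Matrix (Fin Nr) (Fin Nr) ℂ} {a : Fin Nr → ℝ}, S.PosSemidef →
      S * W = W * realDiag a → ∀ i, 0 ≤ a i := by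
    intro S a hS h i
    have h1 := (hS.conjTranspose_mul_mul_same W).diag_nonneg (i := i)
    rw [Matrix.mul_assoc, h, ← Matrix.mul_assoc, hWW, Matrix.one_mul, realDiag,
      diagonal_apply_eq] at h1
    exact_mod_cast h1
  have hm0 : ∀ i, 0 ≤ m i := nonneg_of (posSemidef_self_mul_conjTranspose _) hmW
  have hd0 : ∀ i, 0 ≤ d i := nonneg_of hD hdW
  have h1dW : (1 + hopGram Q Z) * W = W * realDiag fun i => 1 + d i := by
    rw [← realDiag_add, realDiag_one, Matrix.add_mul, Matrix.mul_add, hdW, Matrix.one_mul,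
      Matrix.mul_one]
  have hcdW : (hopCov P F + hopGram Q Z) * W = W * realDiag fun i => 1 + m i + d i := by
    rw [Matrix.add_mul, hcW, hdW, ← Matrix.mul_add, realDiag_add]
    simp only [hcm]
  have hi1 := inv_mul_eq_mul_realDiag h1D.isUnit_det' (fun i => by linarith [hd0 i]) h1dW
  have hi2 := inv_mul_eq_mul_realDiag hCD.isUnit_det' (fun i => by linarith [hd0 i, hm0 i]) hcdW
  have hi3 := inv_mul_eq_mul_realDiag hC.isUnit_det' (fun i => by linarith [hcm i, hm0 i]) hcW
  have hΓ : ((1 + hopGram Q Z)⁻¹ - (hopCov P F + hopGram Q Z)⁻¹) * W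
      = W * realDiag fun i => marginal (m i) (d i) := by
    rw [Matrix.sub_mul, hi1, hi2, ← Matrix.mul_sub, realDiag_sub]; rfl
  have hΓ' : ((hopCov P F)⁻¹ - (hopCov P F + hopGram Q Z)⁻¹) * W
      = W * realDiag fun i => marginal (d i) (m i) := by
    rw [Matrix.sub_mul, hi3, hi2, ← Matrix.mul_sub, realDiag_sub]
    congr 2
    ext i
    rw [marginal, hcm, add_right_comm]
  have hrelay : Qᴴ * Q * (Z * W) * realDiag (fun i => marginal (m i) (d i)) = (ν : ℂ) • (Z * W) := by
    rw [← Matrix.smul_mul, ← hνeq, Matrix.mul_assoc _ _ W, hΓ]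
    simp only [Matrix.mul_assoc]
  have hsource : Pᴴ * W * realDiag (fun i => marginal (d i) (m i)) * Wᴴ * (P * F)
      = (κ : ℂ) • F := by
    rw [← hκeq, Matrix.mul_assoc Pᴴ W, ← hΓ']
    simp only [Matrix.mul_assoc]
    rw [← Matrix.mul_assoc W, unitary_mul_conjTranspose hW, Matrix.one_mul]
  have hgain' : gain P Q F Z = ∏ i, ((1 + m i) * (1 + d i) / (1 + m i + d i)) := by
    rw [gain, det_of_mul_eq_mul_realDiag hW hcW, det_of_mul_eq_mul_realDiag hW h1dW,
      det_of_mul_eq_mul_realDiag hW hcdW, ← Finset.prod_mul_distrib, ← Finset.prod_div_distrib]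
    simp only [hcm]
  -- A mode with `m i = 0` or `d i = 0` contributes the factor `1` to the gain.
  have hne : ∃ i, 0 < m i ∧ 0 < d i := by
    by_contra hno
    push Not at hno
    rw [hgain', Finset.prod_eq_one] at hgain
    · exact lt_irrefl _ hgain
    · intro i _
      rcases (hm0 i).eq_or_lt with h0 | h0
      · rw [← h0, add_zero, one_mul]
        exact div_self (by linarith [hd0 i])
      · rw [le_antisymm (hno i h0) (hd0 i), add_zero, mul_one, add_zero]
        exact div_self (by linarith)
  obtain ⟨i, hmi, hdi⟩ := hne
  refine ⟨W, m, d, ν, κ, hW, hm0, hd0, hmW, hdW, ?_, ?_, hrelay, hsource⟩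
  · refine lt_of_le_of_ne hν fun h0 => ?_
    rw [← h0, Complex.ofReal_zero, zero_smul] at hrelay
    -- With `ν = 0`, compressing the relay equation by `Z * W` gives `d i * marginal (m i) (d i) =
    -- 0` in every mode, contrary to the active one.
    have h1 : realDiag (fun i => d i * marginal (m i) (d i)) = realDiag fun _ => 0 := by
      rw [← realDiag_mul_realDiag, ← Matrix.one_mul (realDiag d), ← hWW, Matrix.mul_assoc Wᴴ,
        ← hdW, hopGram]
      have : Wᴴ * ((Q * Z)ᴴ * (Q * Z) * W) * realDiag (fun i => marginal (m i) (d i))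
          = Wᴴ * Zᴴ * (Qᴴ * Q * (Z * W) * realDiag (fun i => marginal (m i) (d i))) := by
        simp only [conjTranspose_mul, Matrix.mul_assoc]
      rw [this, hrelay, Matrix.mul_zero]
      simp [realDiag]
    have h2 := congrFun (realDiag_injective h1) i
    exact (mul_pos hdi (marginal_pos hmi (hd0 i))).ne' h2
  · refine lt_of_le_of_ne hκ fun h0 => ?_
    rw [← h0, Complex.ofReal_zero, zero_smul] at hsource
    have h1 : realDiag (fun i => m i * marginal (d i) (m i) * m i) = realDiag fun _ => 0 := by
      have hm' : realDiag m = Wᴴ * ((P * F) * (P * F)ᴴ * W) := by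
        rw [hmW, ← Matrix.mul_assoc, hWW, Matrix.one_mul]
      rw [← realDiag_mul_realDiag, ← realDiag_mul_realDiag]
      conv_lhs => rw [hm']
      have : Wᴴ * ((P * F) * (P * F)ᴴ * W) * realDiag (fun i => marginal (d i) (m i)) *
          (Wᴴ * ((P * F) * (P * F)ᴴ * W))
          = Wᴴ * (P * F) * Fᴴ * (Pᴴ * W * realDiag (fun i => marginal (d i) (m i)) * Wᴴ * (P * F))
            * ((P * F)ᴴ * W) := by
        simp only [conjTranspose_mul, Matrix.mul_assoc]
      rw [this, hsource, Matrix.mul_zero, Matrix.zero_mul]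
      simp [realDiag]
    have h2 := congrFun (realDiag_injective h1) i
    exact (mul_pos (mul_pos hmi (marginal_pos hdi (hm0 i))) hmi).ne' h2

end Structure

/-! ### Splitting a maximiser into matched scalar links -/

section LinkFrames

variable {Ns Nr Nd k r : ℕ} {P : Matrix (Fin Nr) (Fin Ns) ℂ} {Q : Matrix (Fin Nd) (Fin Nr) ℂ}
  {F : Matrix (Fin Ns) (Fin k) ℂ} {Z : Matrix (Fin Nr) (Fin Nr) ℂ} {p q : ℝ}

/-- Diagonalisation of both hops along matched singular vectors. -/
structure LinkFrames (P : Matrix (Fin Nr) (Fin Ns) ℂ) (Q : Matrix (Fin Nd) (Fin Nr) ℂ)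
    (F : Matrix (Fin Ns) (Fin k) ℂ) (Z : Matrix (Fin Nr) (Fin Nr) ℂ)
    (w v : Matrix (Fin Nr) (Fin r) ℂ) (u : Matrix (Fin Ns) (Fin r) ℂ)
    (φ : Matrix (Fin k) (Fin r) ℂ) (a b x y : Fin r → ℝ) : Prop where
  w_orth : wᴴ * w = 1
  v_orth : vᴴ * v = 1
  u_orth : uᴴ * u = 1
  φ_orth : φᴴ * φ = 1
  a_pos : ∀ i, 0 < a i
  b_pos : ∀ i, 0 < b i
  x_pos : ∀ i, 0 < x i
  y_pos : ∀ i, 0 < y i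
  P_mul : P * u = w * realDiag fun i => Real.sqrt (a i)
  P_eig : Pᴴ * P * u = u * realDiag a
  Q_eig : Qᴴ * Q * v = v * realDiag b
  F_eq : F = u * realDiag (fun i => Real.sqrt (x i)) * φᴴ
  Z_eq : Z = v * realDiag (fun i => Real.sqrt (y i)) * wᴴ

theorem exists_sorted_range {n : ℕ} (s : Set (Fin n)) (f : Fin n → ℝ) :
    ∃ (r : ℕ) (e : Fin r → Fin n), Function.Injective e ∧ Set.range e = s ∧
      Antitone fun i => f (e i) := by
  classical
  let e₀ := (Fintype.equivFin s).symm
  let g : Fin (Fintype.card s) → ℝ := fun i => -f (e₀ i)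
  refine ⟨Fintype.card s, fun i => e₀ (Tuple.sort g i), ?_, ?_, ?_⟩
  · exact Subtype.val_injective.comp (e₀.injective.comp (Tuple.sort g).injective)
  · ext x
    constructor
    · rintro ⟨i, rfl⟩
      exact (e₀ _).2
    · intro hx
      exact ⟨(Tuple.sort g).symm (e₀.symm ⟨x, hx⟩), by simp⟩
  · intro i j hij
    have := Tuple.monotone_sort g hij
    simp only [g, Function.comp_apply] at this
    linarith

theorem col_eq_zero_of_gram {m n : ℕ} {X : Matrix (Fin m) (Fin n) ℂ} {j : Fin n}
    (h : (Xᴴ * X) j j = 0) (i : Fin m) : X i j = 0 := by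
  have h1 : ∑ x, Complex.normSq (X x j) = 0 := by
    have : ((∑ x, Complex.normSq (X x j) : ℝ) : ℂ) = 0 := by
      rw [Complex.ofReal_sum, ← h]
      simp [Matrix.mul_apply, Complex.normSq_eq_conj_mul_self]
    exact_mod_cast this
  exact Complex.normSq_eq_zero.mp ((Finset.sum_eq_zero_iff_of_nonneg
    (fun x _ => Complex.normSq_nonneg _)).mp h1 i (Finset.mem_univ _))

theorem mul_realDiag_apply {m n : ℕ} (X : Matrix (Fin m) (Fin n) ℂ) (a : Fin n → ℝ) (i : Fin m)
    (j : Fin n) : (X * realDiag a) i j = X i j * a j := by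
  rw [realDiag, mul_diagonal]

theorem mul_realDiag_cancel {m n : ℕ} (X : Matrix (Fin m) (Fin n) ℂ) {a b : Fin n → ℝ}
    (h : ∀ i, a i * b i = 1) : X * realDiag a * realDiag b = X := by
  rw [Matrix.mul_assoc, realDiag_mul_realDiag]
  simp [h, realDiag_one]

/-- Normalisation of a matrix with orthogonal nonzero columns. -/
theorem normalize_columns {m n : ℕ} {X : Matrix (Fin m) (Fin n) ℂ} {y : Fin n → ℝ}
    (hy : ∀ i, 0 < y i) (h : Xᴴ * X = realDiag y) :
    (X * realDiag fun i => (Real.sqrt (y i))⁻¹)ᴴ * (X * realDiag fun i => (Real.sqrt (y i))⁻¹)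
      = 1 := by
  rw [conjTranspose_mul, realDiag_conjTranspose, Matrix.mul_assoc, ← Matrix.mul_assoc Xᴴ, h,
    realDiag_mul_realDiag, realDiag_mul_realDiag, ← realDiag_one]
  congr 1
  ext i
  have h1 := Real.sqrt_pos.mpr (hy i)
  have h2 := Real.mul_self_sqrt (hy i).le
  field_simp
  rw [sq, h2]

/-- Read column by column, the relay condition makes the active columns of `Z * W` eigenvectors of
`Qᴴ * Q` with eigenvalue `ν / c i`. The source condition makes the active columns of `W`
eigenvectors of `P * Pᴴ` with eigenvalue `κ / c' i`. Normalising these columns gives the frames, and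
the column norms give the powers. Modes are listed by decreasing `m + d`, which later sorts `m` and
`d` separately. -/
theorem JointBasis.exists_linkFrames {W : Matrix (Fin Nr) (Fin Nr) ℂ} {m d : Fin Nr → ℝ} {ν κ : ℝ}
    (h : JointBasis P Q F Z W m d ν κ) :
    ∃ (r : ℕ) (w v : Matrix (Fin Nr) (Fin r) ℂ) (u : Matrix (Fin Ns) (Fin r) ℂ)
      (φ : Matrix (Fin k) (Fin r) ℂ) (a b x y : Fin r → ℝ),
      LinkFrames P Q F Z w v u φ a b x y ∧ Antitone fun i => x i * a i + y i * b i := by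
  have hWW := unitary_conjTranspose_mul h.unitary
  have hWW' := unitary_mul_conjTranspose h.unitary
  have hνC : (ν : ℂ) ≠ 0 := by exact_mod_cast h.ν_pos.ne'
  have hκC : (κ : ℂ) ≠ 0 := by exact_mod_cast h.κ_pos.ne'
  set c : Fin Nr → ℝ := fun i => marginal (m i) (d i) with hc
  set c' : Fin Nr → ℝ := fun i => marginal (d i) (m i) with hc'
  have hgram : (Q * (Z * W))ᴴ * (Q * (Z * W)) = realDiag d := by
    have := h.gram_right
    rw [hopGram] at this
    rw [← Matrix.mul_assoc Q, conjTranspose_mul, Matrix.mul_assoc, ← Matrix.mul_assoc _ _ W, this,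
      ← Matrix.mul_assoc, hWW, Matrix.one_mul]
  have hgramM : (Wᴴ * (P * F)) * (Wᴴ * (P * F))ᴴ = realDiag m := by
    rw [conjTranspose_mul, conjTranspose_conjTranspose, Matrix.mul_assoc, ← Matrix.mul_assoc (P * F),
      h.gram_left, ← Matrix.mul_assoc, hWW, Matrix.one_mul]
  -- The source condition multiplied by `P` on the left and `(P * F)ᴴ * W` on the right becomes an
  -- eigenvalue equation for `P * Pᴴ`.
  have hPP : P * Pᴴ * W * realDiag (fun i => c' i * m i) = (κ : ℂ) • (W * realDiag m) := by
    rw [← realDiag_mul_realDiag, ← h.gram_left, ← hgramM, ← Matrix.smul_mul, ← Matrix.smul_mul,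
      ← Matrix.mul_smul, ← h.source]
    simp only [conjTranspose_mul, conjTranspose_conjTranspose, Matrix.mul_assoc, hc']
  -- inactive indices
  have hZ0 : ∀ i, ¬ 0 < d i → ∀ x, (Z * W) x i = 0 := by
    intro i hi x
    have hdi : d i = 0 := le_antisymm (not_lt.mp hi) (h.d_nonneg i)
    have hQ : ∀ y, (Q * (Z * W)) y i = 0 := col_eq_zero_of_gram (by rw [hgram, realDiag]; simp [hdi])
    have h1 := congrFun (congrFun h.relay x) i
    rw [mul_realDiag_apply, Matrix.mul_assoc, Matrix.mul_apply] at h1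
    simp only [hQ, mul_zero, Finset.sum_const_zero, zero_mul] at h1
    rw [Matrix.smul_apply, smul_eq_mul] at h1
    exact (mul_eq_zero.mp h1.symm).resolve_left hνC
  -- If `m i = 0` the marginal gain vanishes, so the relay condition kills column `i` of `Z * W` and
  -- hence `d i`. With `hd_of_m`, a mode is active on both hops or on neither.
  have hm_of_d : ∀ i, 0 < d i → 0 < m i := by
    intro i hi
    refine lt_of_le_of_ne (h.m_nonneg i) fun h0 => ?_
    have hz : ∀ x, (Z * W) x i = 0 := by
      intro x
      have h1 := congrFun (congrFun h.relay x) i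
      rw [mul_realDiag_apply, ← h0, marginal_zero, Complex.ofReal_zero, mul_zero, Matrix.smul_apply,
        smul_eq_mul] at h1
      exact (mul_eq_zero.mp h1.symm).resolve_left hνC
    have h2 := congrFun (congrFun hgram i) i
    rw [Matrix.mul_apply, realDiag, diagonal_apply_eq] at h2
    have h3 : ∀ x, (Q * (Z * W)) x i = 0 := fun x => by simp [Matrix.mul_apply (M := Q), hz]
    simp only [h3, mul_zero, Finset.sum_const_zero] at h2
    exact hi.ne (by exact_mod_cast h2)
  have hd_of_m : ∀ i, 0 < m i → 0 < d i := by
    intro i hi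
    refine lt_of_le_of_ne (h.d_nonneg i) fun h0 => ?_
    have hmC : (m i : ℂ) ≠ 0 := by exact_mod_cast hi.ne'
    have hW0 : ∀ x, W x i = 0 := by
      intro x
      have h1 := congrFun (congrFun hPP x) i
      rw [mul_realDiag_apply, hc', Matrix.smul_apply, mul_realDiag_apply] at h1
      simp only [← h0, marginal_zero, zero_mul, Complex.ofReal_zero, mul_zero, smul_eq_mul] at h1
      exact (mul_eq_zero.mp ((mul_eq_zero.mp h1.symm).resolve_left hκC)).resolve_right hmC
    have h2 := congrFun (congrFun hWW i) i
    simp [Matrix.mul_apply, hW0] at h2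
  -- `e` enumerates the active modes, sorted by `m + d`; `r` is their number.
  obtain ⟨r, e, he, hrange, hanti⟩ := exists_sorted_range {i | 0 < d i} fun i => m i + d i
  have hde : ∀ i, 0 < d (e i) := fun i => by
    have : e i ∈ Set.range e := ⟨i, rfl⟩
    rwa [hrange] at this
  have hme : ∀ i, 0 < m (e i) := fun i => hm_of_d _ (hde i)
  have hce : ∀ i, 0 < c (e i) := fun i => marginal_pos (hme i) (hde i).le
  have hce' : ∀ i, 0 < c' (e i) := fun i => marginal_pos (hde i) (hme i).le
  set w := W.submatrix id e with hw
  have hww : wᴴ * w = 1 := by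
    rw [hw, conjTranspose_mul_submatrix, hWW, submatrix_one _ he]
  -- the relay side
  set X := (Z * W).submatrix id e with hX
  have hXQ : Qᴴ * Q * X = X * realDiag fun i => ν / c (e i) := by
    have h1 := congrArg (fun Y => Y.submatrix id e) h.relay
    rw [submatrix_mul_realDiag, ← mul_submatrix_id] at h1
    calc Qᴴ * Q * X = Qᴴ * Q * X * realDiag (c ∘ e) * realDiag (fun i => (c (e i))⁻¹) :=
          (mul_realDiag_cancel _ fun i => mul_inv_cancel₀ (hce i).ne').symm
      _ = _ := by
        rw [h1]
        have : (((ν : ℂ) • (Z * W)).submatrix id e) = (ν : ℂ) • X := rfl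
        rw [this, Matrix.smul_mul, ← Matrix.mul_smul, realDiag_smul]
        rfl
  have hXd : (Q * X)ᴴ * (Q * X) = realDiag (d ∘ e) := by
    rw [hX, mul_submatrix_id, conjTranspose_mul_submatrix, hgram, realDiag_submatrix _ he]
  set y : Fin r → ℝ := fun i => d (e i) * c (e i) / ν with hy
  have hy0 : ∀ i, 0 < y i := fun i => div_pos (mul_pos (hde i) (hce i)) h.ν_pos
  have hXX : Xᴴ * X = realDiag y := by
    have h1 : Xᴴ * X * realDiag (fun i => ν / c (e i)) = realDiag (d ∘ e) := by
      rw [← hXd, Matrix.mul_assoc, ← hXQ, conjTranspose_mul]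
      simp only [Matrix.mul_assoc]
    rw [← mul_realDiag_cancel (Xᴴ * X) (a := fun i => ν / c (e i)) (b := fun i => c (e i) / ν)
      (fun i => by have := (hce i).ne'; have := h.ν_pos.ne'; field_simp), h1, realDiag_mul_realDiag]
    congr 1
    ext i
    simp only [hy, Function.comp_apply, mul_div_assoc]
  have hZX : Z = X * wᴴ := by
    calc Z = Z * W * Wᴴ := by rw [Matrix.mul_assoc, hWW', Matrix.mul_one]
      _ = _ := mul_conjTranspose_eq_submatrix _ _ he fun i hi x y => by
        rw [hrange] at hi
        rw [hZ0 i hi, zero_mul]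
  -- the source side
  set X' := (Wᴴ * (P * F))ᴴ.submatrix id e with hX'
  have hXX' : X'ᴴ * X' = realDiag (m ∘ e) := by
    rw [hX', conjTranspose_mul_submatrix, conjTranspose_conjTranspose, hgramM,
      realDiag_submatrix _ he]
  have hPF : P * F = w * X'ᴴ := by
    calc P * F = W * (Wᴴ * (P * F)) := by rw [← Matrix.mul_assoc, hWW', Matrix.one_mul]
      _ = W * ((Wᴴ * (P * F))ᴴ)ᴴ := by rw [conjTranspose_conjTranspose]
      _ = _ := mul_conjTranspose_eq_submatrix _ _ he fun i hi x y => by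
        rw [hrange] at hi
        have hmi : m i = 0 := by
          by_contra hne
          exact hi (hd_of_m i (lt_of_le_of_ne (h.m_nonneg i) (Ne.symm hne)))
        have := col_eq_zero_of_gram (X := (Wᴴ * (P * F))ᴴ) (j := i) (by
          rw [conjTranspose_conjTranspose, hgramM, realDiag]; simp [hmi]) y
        rw [this, star_zero, mul_zero]
  set a : Fin r → ℝ := fun i => κ / c' (e i) with ha
  have ha0 : ∀ i, 0 < a i := fun i => div_pos h.κ_pos (hce' i)
  have hPw : P * Pᴴ * w = w * realDiag a := by
    have h1 := congrArg (fun Y => Y.submatrix id e) hPP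
    rw [submatrix_mul_realDiag, ← mul_submatrix_id] at h1
    have h2 : ((κ : ℂ) • (W * realDiag m)).submatrix id e = w * realDiag fun i => κ * m (e i) := by
      have : ((κ : ℂ) • (W * realDiag m)).submatrix id e
        = (κ : ℂ) • (W * realDiag m).submatrix id e := rfl
      rw [this, submatrix_mul_realDiag, ← Matrix.mul_smul, realDiag_smul]; rfl
    rw [h2] at h1
    rw [← mul_realDiag_cancel (P * Pᴴ * w) (a := (fun i => c' i * m i) ∘ e)
      (b := fun i => (c' (e i) * m (e i))⁻¹)
      (fun i => mul_inv_cancel₀ (mul_pos (hce' i) (hme i)).ne'), h1, Matrix.mul_assoc,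
      realDiag_mul_realDiag]
    congr 2
    ext i
    have := (hce' i).ne'
    have := (hme i).ne'
    simp only [ha]
    field_simp
  have hu1 : (Pᴴ * w)ᴴ * (Pᴴ * w) = realDiag a := by
    rw [conjTranspose_mul, conjTranspose_conjTranspose, Matrix.mul_assoc, ← Matrix.mul_assoc P,
      hPw, ← Matrix.mul_assoc, hww, Matrix.one_mul]
  set u := Pᴴ * w * realDiag fun i => (Real.sqrt (a i))⁻¹ with hu
  have hsa : ∀ i, Real.sqrt (a i) ≠ 0 := fun i => (Real.sqrt_pos.mpr (ha0 i)).ne'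
  have hPu : P * u = w * realDiag fun i => Real.sqrt (a i) := by
    rw [hu, ← Matrix.mul_assoc, ← Matrix.mul_assoc, hPw, Matrix.mul_assoc, realDiag_mul_realDiag]
    congr 2
    ext i
    have := hsa i
    field_simp
    rw [Real.sq_sqrt (ha0 i).le]
  have hPwu : Pᴴ * w = u * realDiag fun i => Real.sqrt (a i) := by
    rw [hu, mul_realDiag_cancel _ fun i => inv_mul_cancel₀ (hsa i)]
  have hsm : ∀ i, Real.sqrt (m (e i)) ≠ 0 := fun i => (Real.sqrt_pos.mpr (hme i)).ne'
  refine ⟨r, w, X * realDiag fun i => (Real.sqrt (y i))⁻¹, u,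
    X' * realDiag fun i => (Real.sqrt (m (e i)))⁻¹, a, fun i => ν / c (e i),
    fun i => m (e i) / a i, y, ⟨hww, normalize_columns hy0 hXX, normalize_columns ha0 hu1,
      normalize_columns hme hXX', ha0, fun i => div_pos h.ν_pos (hce i),
      fun i => div_pos (hme i) (ha0 i), hy0, hPu, ?_, ?_, ?_, ?_⟩, ?_⟩
  · rw [Matrix.mul_assoc, hPu, ← Matrix.mul_assoc, hPwu, Matrix.mul_assoc, realDiag_mul_realDiag]
    simp only [Real.mul_self_sqrt (ha0 _).le]
  · rw [← Matrix.mul_assoc, hXQ, Matrix.mul_assoc, Matrix.mul_assoc, realDiag_mul_realDiag,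
      realDiag_mul_realDiag]
    simp only [mul_comm]
  · have h1 := h.source
    have h2 : Pᴴ * W * realDiag c' * Wᴴ * (P * F)
        = u * realDiag (fun i => Real.sqrt (a i) * c' (e i)) * X'ᴴ := by
      have e1 : W * realDiag c' * Wᴴ * (P * F) = w * realDiag (c' ∘ e) * X'ᴴ := by
        have : Wᴴ * w = (1 : Matrix (Fin Nr) (Fin Nr) ℂ).submatrix id e := by
          rw [hw, mul_submatrix_id, hWW]
        rw [hPF, ← Matrix.mul_assoc, Matrix.mul_assoc _ Wᴴ, this, mul_submatrix_id, Matrix.mul_one,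
          submatrix_mul_realDiag]
      calc _ = Pᴴ * (W * realDiag c' * Wᴴ * (P * F)) := by simp only [Matrix.mul_assoc]
        _ = Pᴴ * w * realDiag (c' ∘ e) * X'ᴴ := by rw [e1]; simp only [Matrix.mul_assoc]
        _ = _ := by rw [hPwu, Matrix.mul_assoc u, realDiag_mul_realDiag]; rfl
    rw [h2] at h1
    have h3 : F = ((κ⁻¹ : ℝ) : ℂ) • ((κ : ℂ) • F) := by
      rw [smul_smul, ← Complex.ofReal_mul, inv_mul_cancel₀ h.κ_pos.ne']; simp
    conv_lhs => rw [h3, ← h1, ← Matrix.smul_mul, ← Matrix.mul_smul, realDiag_smul]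
    rw [conjTranspose_mul, realDiag_conjTranspose, ← Matrix.mul_assoc,
      Matrix.mul_assoc u (realDiag fun i => Real.sqrt (m (e i) / a i)), realDiag_mul_realDiag]
    congr 3
    ext i
    rw [Real.sqrt_div (hme i).le]
    have e1 := hsa i
    have e2 := hsm i
    have e3 := h.κ_pos.ne'
    have e4 := (hce' i).ne'
    have e5 : Real.sqrt (a i) * Real.sqrt (a i) * c' (e i) = κ := by
      rw [Real.mul_self_sqrt (ha0 i).le]
      simp only [ha]
      field_simp
    field_simp
    rw [← e5]; ring
  · rw [mul_realDiag_cancel _ fun i => inv_mul_cancel₀ (Real.sqrt_pos.mpr (hy0 i)).ne']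
    exact hZX
  · intro i j hij
    have := hanti hij
    have e1 : ∀ i, m (e i) / a i * a i + y i * (ν / c (e i)) = m (e i) + d (e i) := by
      intro i
      have := (ha0 i).ne'
      have := (hce i).ne'
      have := h.ν_pos.ne'
      simp only [hy]
      field_simp
    simp only [e1]
    exact this

end LinkFrames

/-! ### From optimal frames to sorted singular value decompositions -/

section Ordering

variable {Ns Nr Nd k r : ℕ}

/-- Squared channel gains along `r` orthonormal input directions with orthogonal outputs. -/
def squaredGains {m n : ℕ} (H : Matrix (Fin m) (Fin n) ℂ) (r : ℕ) : Set (Fin r → ℝ) :=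
  {a | (∀ i, 0 < a i) ∧ ∃ u : Matrix (Fin n) (Fin r) ℂ, uᴴ * u = 1 ∧ uᴴ * (Hᴴ * H) * u = realDiag a}

theorem squaredGains_perm {m n : ℕ} {H : Matrix (Fin m) (Fin n) ℂ} {a : Fin r → ℝ}
    (ha : a ∈ squaredGains H r) (σ : Equiv.Perm (Fin r)) : a ∘ σ ∈ squaredGains H r := by
  obtain ⟨h0, u, h1, h2⟩ := ha
  refine ⟨fun i => h0 _, u.submatrix id σ, ?_, ?_⟩
  · rw [conjTranspose_mul_submatrix, h1, submatrix_one _ σ.injective]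
  · rw [Matrix.mul_assoc, mul_submatrix_id, conjTranspose_mul_submatrix, ← Matrix.mul_assoc, h2,
      realDiag_submatrix _ σ.injective]

theorem conj_gram_apply {n : ℕ} (A : Matrix (Fin n) (Fin r) ℂ) (M : Matrix (Fin n) (Fin n) ℂ)
    (j l : Fin r) :
    (Aᴴ * M * A) j l = star (fun x => A x j) ⬝ᵥ M *ᵥ fun x => A x l := by
  rw [Matrix.mul_assoc, Matrix.mul_apply]
  simp [dotProduct, mulVec, Matrix.mul_apply]

/-- A replacement column orthogonal to the old frame in the form `M` keeps the Gram matrix diagonal.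
This is applied with `M = 1` for orthonormality and with `M = Hᴴ * H` for orthogonal outputs. -/
theorem updateCol_gram {n : ℕ} {M : Matrix (Fin n) (Fin n) ℂ} (hM : M.IsHermitian)
    {v : Matrix (Fin n) (Fin r) ℂ} {b : Fin r → ℝ} (h : vᴴ * M * v = realDiag b) {z : Fin n → ℂ}
    (hz : vᴴ *ᵥ (M *ᵥ z) = 0) {τ : ℝ} (hzz : star z ⬝ᵥ M *ᵥ z = τ) (i : Fin r) :
    (v.updateCol i z)ᴴ * M * v.updateCol i z = realDiag (Function.update b i τ) := by
  have hz' : ∀ l, star (fun x => v x l) ⬝ᵥ M *ᵥ z = 0 := fun l => congrFun hz l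
  have hz'' : ∀ l, star z ⬝ᵥ M *ᵥ (fun x => v x l) = 0 := by
    intro l
    have := congrArg star (hz' l)
    rwa [← star_dotProduct_star, star_star, star_mulVec, hM.eq, ← dotProduct_mulVec,
      star_zero] at this
  have hcol : ∀ l, (fun x => v.updateCol i z x l) = if l = i then z else fun x => v x l := by
    intro l
    split_ifs with hl
    · subst hl; ext x; simp
    · ext x; simp [hl]
  ext j l
  rw [conj_gram_apply, hcol, hcol]
  by_cases hj : j = i <;> by_cases hl : l = i
  · subst hj; subst hl
    simp [hzz, realDiag]
  · subst hj
    have : j ≠ l := fun h => hl h.symm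
    simp only [if_true, if_neg hl, hz'', realDiag, diagonal_apply_ne _ this]
  · subst hl
    simp only [if_true, if_neg hj, hz', realDiag, diagonal_apply_ne _ hj]
  · simp only [if_neg hj, if_neg hl]
    rw [← conj_gram_apply, h]
    by_cases hjl : j = l
    · subst hjl; simp [realDiag, hj]
    · simp [realDiag, hjl]

/-- If no orthonormal replacement improves a gain, the frame dominates its complement. -/
theorem quadForm_le_of_update_le {m n : ℕ} {H : Matrix (Fin m) (Fin n) ℂ}
    {v : Matrix (Fin n) (Fin r) ℂ} {b : Fin r → ℝ} (hb : ∀ i, 0 < b i) (hv : vᴴ * v = 1)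
    (heig : Hᴴ * H * v = v * realDiag b)
    (hup : ∀ i τ, Function.update b i τ ∈ squaredGains H r → τ ≤ b i)
    (z : Fin n → ℂ) (hz : vᴴ *ᵥ z = 0) (i : Fin r) :
    (star z ⬝ᵥ (Hᴴ * H) *ᵥ z).re ≤ b i * (star z ⬝ᵥ z).re := by
  have hH := posSemidef_conjTranspose_mul_self H
  by_cases hz0 : z = 0
  · simp [hz0]
  have hpos : 0 < star z ⬝ᵥ z := dotProduct_star_self_pos_iff.mpr hz0
  obtain ⟨hs, hs0⟩ := Complex.pos_iff.mp hpos
  set s := (star z ⬝ᵥ z).re with hsdef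
  have hsz : star z ⬝ᵥ z = (s : ℂ) := Complex.ext rfl (by simpa using hs0.symm)
  have hqn := hH.dotProduct_mulVec_nonneg z
  obtain ⟨hq, hq0⟩ := Complex.nonneg_iff.mp hqn
  set t := (star z ⬝ᵥ (Hᴴ * H) *ᵥ z).re with htdef
  have htz : star z ⬝ᵥ (Hᴴ * H) *ᵥ z = (t : ℂ) := Complex.ext rfl (by simpa using hq0.symm)
  by_contra hlt
  push Not at hlt
  have hts : b i < t / s := by rwa [lt_div_iff₀ hs]
  set ρ : ℂ := (((Real.sqrt s)⁻¹ : ℝ) : ℂ) with hρ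
  have hρ2 : ρ * ρ = ((s⁻¹ : ℝ) : ℂ) := by
    rw [hρ, ← Complex.ofReal_mul, ← mul_inv, Real.mul_self_sqrt hs.le]
  have hρs : star ρ = ρ := by rw [hρ, Complex.star_def, Complex.conj_ofReal]
  have hvz : vᴴ *ᵥ (ρ • z) = 0 := by rw [mulVec_smul, hz, smul_zero]
  -- The columns of `v` span an invariant subspace of `Hᴴ * H`, so a vector orthogonal to them also
  -- has output orthogonal to theirs.
  have hvHz : vᴴ *ᵥ ((Hᴴ * H) *ᵥ (ρ • z)) = 0 := by
    have : vᴴ * (Hᴴ * H) = realDiag b * vᴴ := by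
      have := congrArg conjTranspose heig
      rw [conjTranspose_mul, conjTranspose_mul v, realDiag_conjTranspose, hH.1.eq] at this
      exact this
    rw [mulVec_mulVec, this, ← mulVec_mulVec, hvz, mulVec_zero]
  -- Replacing column `i` by the normalised `z` produces the Rayleigh quotient `t / s` as a new
  -- squared gain; if it exceeded `b i` it would contradict `hup`.
  have hmem : Function.update b i (t / s) ∈ squaredGains H r := by
    refine ⟨fun j => ?_, v.updateCol i (ρ • z), ?_, ?_⟩
    · by_cases hj : j = i
      · subst hj; simpa using (hb j).trans hts
      · simpa [hj] using hb j
    · have h1 := updateCol_gram (isHermitian_one (n := Fin n) (α := ℂ)) (v := v) (b := fun _ => 1)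
        (by rw [Matrix.mul_one, hv, realDiag_one]) (z := ρ • z) (by rw [one_mulVec, hvz]) (τ := 1)
        (by rw [one_mulVec, star_smul, smul_dotProduct, dotProduct_smul, hρs, smul_smul, hρ2, hsz,
              smul_eq_mul, ← Complex.ofReal_mul, inv_mul_cancel₀ hs.ne']) i
      rw [Matrix.mul_one] at h1
      rw [h1, ← realDiag_one]
      congr 1
      ext j
      by_cases hj : j = i
      · subst hj; simp
      · simp [hj]
    · refine updateCol_gram hH.1 ?_ hvHz ?_ i
      · rw [Matrix.mul_assoc, heig, ← Matrix.mul_assoc, hv, Matrix.one_mul]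
      · rw [mulVec_smul, star_smul, smul_dotProduct, dotProduct_smul, hρs, smul_smul, hρ2, htz,
          smul_eq_mul, ← Complex.ofReal_mul, inv_mul_eq_div]
  exact absurd (hup i _ hmem) (not_le.mpr hts)

variable {P : Matrix (Fin Nr) (Fin Ns) ℂ} {Q : Matrix (Fin Nd) (Fin Nr) ℂ}
  {F : Matrix (Fin Ns) (Fin k) ℂ} {Z : Matrix (Fin Nr) (Fin Nr) ℂ} {p q : ℝ}

/-- Any pair of such gain vectors is realised by matrices: take the normalised outputs of the first
frame as relay input directions and `φ` as symbol directions. The scalar gain is then a matrix gain,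
bounded by the maximum. -/
theorem gainBound_squaredGains {φ : Matrix (Fin k) (Fin r) ℂ} (hφ : φᴴ * φ = 1)
    (hmax : ∀ (F' : Matrix (Fin Ns) (Fin k) ℂ) (Z' : Matrix (Fin Nr) (Fin Nr) ℂ),
      energy F' ≤ p → energy Z' ≤ q → gain P Q F' Z' ≤ gain P Q F Z) :
    GainBound (squaredGains P r) (squaredGains Q r) p q (gain P Q F Z) := by
  refine ⟨fun a ha => ha.1, fun b hb => hb.1, fun a ha σ => squaredGains_perm ha σ,
    fun b hb σ => squaredGains_perm hb σ, ?_⟩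
  rintro a ⟨ha, u, hu, hPu⟩ b ⟨hb, v, hv, hQv⟩ x y hx hy hxp hyq
  have hPu' : (P * u)ᴴ * (P * u) = realDiag a := by
    rw [← hPu, conjTranspose_mul]; simp only [Matrix.mul_assoc]
  have hQv' : (Q * v)ᴴ * (Q * v) = realDiag b := by
    rw [← hQv, conjTranspose_mul]; simp only [Matrix.mul_assoc]
  have hw := normalize_columns ha hPu'
  rw [← gain_frame (P := P) (Q := Q) (φ := φ) hw hφ (fun i => (ha i).le) hx hy
    (mul_realDiag_cancel _ fun i => inv_mul_cancel₀ (Real.sqrt_pos.mpr (ha i)).ne').symm hQv']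
  exact hmax _ _ ((energy_frame hu hφ hx).trans_le hxp) ((energy_frame hv hw hy).trans_le hyq)

theorem LinkFrames.attains {w v : Matrix (Fin Nr) (Fin r) ℂ} {u : Matrix (Fin Ns) (Fin r) ℂ}
    {φ : Matrix (Fin k) (Fin r) ℂ} {a b x y : Fin r → ℝ} (h : LinkFrames P Q F Z w v u φ a b x y)
    (hF : energy F ≤ p) (hZ : energy Z ≤ q) :
    Attains (squaredGains P r) (squaredGains Q r) p q (gain P Q F Z) a b x y := by
  have hQ : vᴴ * (Qᴴ * Q) * v = realDiag b := by
    rw [Matrix.mul_assoc, h.Q_eig, ← Matrix.mul_assoc, h.v_orth, Matrix.one_mul]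
  refine ⟨⟨h.a_pos, u, h.u_orth, ?_⟩, ⟨h.b_pos, v, h.v_orth, hQ⟩, h.x_pos, h.y_pos, ?_, ?_, ?_⟩
  · rw [Matrix.mul_assoc, h.P_eig, ← Matrix.mul_assoc, h.u_orth, Matrix.one_mul]
  · rwa [h.F_eq, energy_frame h.u_orth h.φ_orth fun i => (h.x_pos i).le] at hF
  · rwa [h.Z_eq, energy_frame h.v_orth h.w_orth fun i => (h.y_pos i).le] at hZ
  · rw [h.F_eq, h.Z_eq, gain_frame h.w_orth h.φ_orth (fun i => (h.a_pos i).le)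
      (fun i => (h.x_pos i).le) (fun i => (h.y_pos i).le) h.P_mul]
    rw [← hQ, conjTranspose_mul]; simp only [Matrix.mul_assoc]

theorem frame_eq_rectDiag {m n : ℕ} (hm : r ≤ m) (hn : r ≤ n) {u : Matrix (Fin m) (Fin r) ℂ}
    {φ : Matrix (Fin n) (Fin r) ℂ} {V : Matrix (Fin m) (Fin m) ℂ} {Ψ : Matrix (Fin n) (Fin n) ℂ}
    (hV : ∀ i j, V i (Fin.castLE hm j) = u i j) (hΨ : ∀ i j, Ψ i (Fin.castLE hn j) = φ i j)
    (s : Fin r → ℝ) : u * realDiag s * φᴴ = V * rectDiag m n (zeroExt s) * Ψᴴ := by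
  ext i l
  simp only [Matrix.mul_apply (N := φᴴ), Matrix.mul_apply (N := Ψᴴ), mul_realDiag_apply,
    mul_rectDiag_apply, conjTranspose_apply]
  refine Fintype.sum_of_injective (Fin.castLE hn) (Fin.castLE_injective hn) _ _ ?_ ?_
  · intro j hj
    have : ¬ (j : ℕ) < r := fun h => hj ⟨⟨j, h⟩, rfl⟩
    simp [zeroExt, this]
  · intro j
    have hjm : (j : ℕ) < m := by omega
    have := hV i j
    simp only [Fin.val_castLE, hjm, dite_true, zeroExt, j.2, hΨ]
    rw [← this]
    rfl

/-- Maximisers of the gain are diagonal with respect to suitable singular value decompositions. -/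
theorem exists_svd_form (hF : energy F ≤ p) (hZ : energy Z ≤ q)
    (hmax : ∀ (F' : Matrix (Fin Ns) (Fin k) ℂ) (Z' : Matrix (Fin Nr) (Fin Nr) ℂ),
      energy F' ≤ p → energy Z' ≤ q → gain P Q F' Z' ≤ gain P Q F Z)
    (hgain : 1 < gain P Q F Z) :
    ∃ U₁ l₁ V₁ U₂ l₂ V₂, IsSVD P U₁ l₁ V₁ ∧ IsSVD Q U₂ l₂ V₂ ∧
      ∃ (r : ℕ) (s t : Fin r → ℝ), r ≤ Nr ∧ r ≤ k ∧ (∀ i, 0 ≤ s i) ∧ (∀ i, 0 ≤ t i) ∧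
        ∃ Φ ∈ unitaryGroup (Fin k) ℂ, F = V₁ * rectDiag Ns k (zeroExt s) * Φ ∧
          Z = V₂ * rectDiag Nr Nr (zeroExt t) * U₁ᴴ := by
  obtain ⟨W, m, d, ν, κ, hJ⟩ := exists_jointBasis hF hZ hmax hgain
  obtain ⟨r, w, v, u, φ, a, b, x, y, h, hanti⟩ := hJ.exists_linkFrames
  have hA := h.attains hF hZ
  have hB := gainBound_squaredGains (r := r) h.φ_orth hmax
  -- The sums `m + d` are sorted and `no_inversion` forbids opposite orders, so `m` and `d` are
  -- sorted individually.
  have hboth : ∀ i j, i ≤ j → x j * a j ≤ x i * a i ∧ y j * b j ≤ y i * b i := by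
    intro i j hij
    rcases hij.eq_or_lt with rfl | hlt
    · exact ⟨le_rfl, le_rfl⟩
    · have h1 := hA.no_inversion hB hlt.ne
      have h2 := hanti hij
      simp only at h2
      constructor <;> by_contra hc <;> push Not at hc <;> nlinarith
  have ha : Antitone a := fun i j hij => hA.symm.gain_le hB.symm (hboth i j hij).2 (hboth i j hij).1
  have hb : Antitone b := fun i j hij => hA.gain_le hB (hboth i j hij).1 (hboth i j hij).2
  have hrNs : r ≤ Ns := by simpa using card_le_of_conjTranspose_mul_self h.u_orth
  have hrNr : r ≤ Nr := by simpa using card_le_of_conjTranspose_mul_self h.w_orth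
  have hrk : r ≤ k := by simpa using card_le_of_conjTranspose_mul_self h.φ_orth
  obtain ⟨U₁, l₁, V₁, hsvd₁, hV₁, hl₁⟩ := exists_svd_extending P u a h.u_orth h.P_eig ha hrNs
    (quadForm_le_of_update_le h.a_pos h.u_orth h.P_eig
      fun i τ hτ => hA.symm.update_le hB.symm hτ)
  obtain ⟨U₂, l₂, V₂, hsvd₂, hV₂, hl₂⟩ := exists_svd_extending Q v b h.v_orth h.Q_eig hb hrNr
    (quadForm_le_of_update_le h.b_pos h.v_orth h.Q_eig fun i τ hτ => hA.update_le hB hτ)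
  obtain ⟨Ψ, hΨ, hΨφ⟩ := exists_unitary_extending hrk φ h.φ_orth
  refine ⟨U₁, l₁, V₁, U₂, l₂, V₂, hsvd₁, hsvd₂, r, _, _, hrNr, hrk, fun i => Real.sqrt_nonneg _,
    fun i => Real.sqrt_nonneg _, Ψᴴ, Unitary.star_mem hΨ,
    h.F_eq.trans (frame_eq_rectDiag hrNs hrk hV₁ hΨφ _),
    h.Z_eq.trans (frame_eq_rectDiag hrNr hrNr hV₂ ?_ _)⟩
  -- The leading columns of `U₁` must be `w`: both arise by applying `P` to the same right singular
  -- vectors and dividing by the same positive singular values.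
  intro i j
  have h1 : P * V₁ = U₁ * rectDiag Nr Ns l₁ := by
    conv_lhs => rw [hsvd₁.eq]
    rw [Matrix.mul_assoc, unitary_conjTranspose_mul hsvd₁.unitary_right, Matrix.mul_one]
  have h2 := congrFun (congrFun h1 i) (Fin.castLE hrNs j)
  have hj : ((Fin.castLE hrNs j : Fin Ns) : ℕ) < Nr := by
    simp only [Fin.val_castLE]; omega
  rw [mul_rectDiag_apply, dif_pos hj] at h2
  have h3 := congrFun (congrFun h.P_mul i) j
  rw [mul_realDiag_apply, Matrix.mul_apply] at h3
  simp only [Matrix.mul_apply, hV₁, h3, Fin.val_castLE, hl₁] at h2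
  have hne : ((Real.sqrt (a j) : ℝ) : ℂ) ≠ 0 := by
    exact_mod_cast (Real.sqrt_pos.mpr (h.a_pos j)).ne'
  exact (mul_right_cancel₀ hne h2).symm

end Ordering

/-! ### Existence of a maximiser, and the gain as a determinant ratio -/

section Existence

variable {Ns Nr Nd k : ℕ} {P : Matrix (Fin Nr) (Fin Ns) ℂ} {Q : Matrix (Fin Nd) (Fin Nr) ℂ}
  {F : Matrix (Fin Ns) (Fin k) ℂ} {Z : Matrix (Fin Nr) (Fin Nr) ℂ}

theorem gain_pos : 0 < gain P Q F Z :=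
  div_pos (mul_pos (hopCov_posDef P F).det_re_pos (one_add_hopGram_posDef Q Z).det_re_pos)
    (hopCov_add_hopGram_posDef P Q F Z).det_re_pos

theorem normSq_apply_le_energy {m n : ℕ} (A : Matrix (Fin m) (Fin n) ℂ) (i : Fin m) (j : Fin n) :
    ‖A i j‖ ^ 2 ≤ energy A := by
  have h : energy A = ∑ i, ∑ j, ‖A i j‖ ^ 2 := by
    simp only [energy, trace, diag_apply, Matrix.mul_apply, conjTranspose_apply, Complex.re_sum]
    refine Finset.sum_congr rfl fun i _ => Finset.sum_congr rfl fun j _ => ?_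
    rw [Complex.star_def, Complex.mul_conj, Complex.ofReal_re, Complex.normSq_eq_norm_sq]
  rw [h]
  calc ‖A i j‖ ^ 2 ≤ ∑ j, ‖A i j‖ ^ 2 :=
        Finset.single_le_sum (f := fun j => ‖A i j‖ ^ 2) (fun _ _ => sq_nonneg _) (Finset.mem_univ j)
    _ ≤ _ := Finset.single_le_sum (f := fun i => ∑ j, ‖A i j‖ ^ 2)
        (fun _ _ => Finset.sum_nonneg fun _ _ => sq_nonneg _) (Finset.mem_univ i)

theorem continuous_energy {m n : ℕ} :
    Continuous (energy : Matrix (Fin m) (Fin n) ℂ → ℝ) := by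
  unfold energy
  exact Complex.continuous_re.comp (Continuous.matrix_trace
    (continuous_id.matrix_mul continuous_id.matrix_conjTranspose))

theorem isCompact_energy_le {m n : ℕ} (p : ℝ) :
    IsCompact {A : Matrix (Fin m) (Fin n) ℂ | energy A ≤ p} := by
  have hc : IsCompact (Set.pi Set.univ fun _ : Fin m => Set.pi Set.univ fun _ : Fin n =>
      Metric.closedBall (0 : ℂ) (Real.sqrt p)) :=
    isCompact_univ_pi fun _ => isCompact_univ_pi fun _ => isCompact_closedBall _ _
  refine hc.of_isClosed_subset (isClosed_le continuous_energy continuous_const) ?_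
  intro A hA i _ j _
  rw [mem_closedBall_zero_iff]
  exact Real.le_sqrt_of_sq_le ((normSq_apply_le_energy A i j).trans hA)

theorem exists_gain_maximizer (P : Matrix (Fin Nr) (Fin Ns) ℂ) (Q : Matrix (Fin Nd) (Fin Nr) ℂ)
    (k : ℕ) {p q : ℝ} (hp : 0 ≤ p) (hq : 0 ≤ q) :
    ∃ (F : Matrix (Fin Ns) (Fin k) ℂ) (Z : Matrix (Fin Nr) (Fin Nr) ℂ),
      energy F ≤ p ∧ energy Z ≤ q ∧ ∀ (F' : Matrix (Fin Ns) (Fin k) ℂ)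
        (Z' : Matrix (Fin Nr) (Fin Nr) ℂ), energy F' ≤ p → energy Z' ≤ q →
          gain P Q F' Z' ≤ gain P Q F Z := by
  have hcont : Continuous fun x : Matrix (Fin Ns) (Fin k) ℂ × Matrix (Fin Nr) (Fin Nr) ℂ =>
      gain P Q x.1 x.2 := by
    have h1 : Continuous fun x : Matrix (Fin Ns) (Fin k) ℂ × Matrix (Fin Nr) (Fin Nr) ℂ =>
        hopCov P x.1 := by
      have : Continuous fun x : Matrix (Fin Ns) (Fin k) ℂ × Matrix (Fin Nr) (Fin Nr) ℂ => P * x.1 :=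
        continuous_const.matrix_mul continuous_fst
      exact continuous_const.add (this.matrix_mul this.matrix_conjTranspose)
    have h2 : Continuous fun x : Matrix (Fin Ns) (Fin k) ℂ × Matrix (Fin Nr) (Fin Nr) ℂ =>
        hopGram Q x.2 := by
      have : Continuous fun x : Matrix (Fin Ns) (Fin k) ℂ × Matrix (Fin Nr) (Fin Nr) ℂ => Q * x.2 :=
        continuous_const.matrix_mul continuous_snd
      exact this.matrix_conjTranspose.matrix_mul this
    have h3 : Continuous fun x : Matrix (Fin Ns) (Fin k) ℂ × Matrix (Fin Nr) (Fin Nr) ℂ =>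
        (hopCov P x.1).det.re := Complex.continuous_re.comp h1.matrix_det
    have h4 : Continuous fun x : Matrix (Fin Ns) (Fin k) ℂ × Matrix (Fin Nr) (Fin Nr) ℂ =>
        (1 + hopGram Q x.2).det.re := Complex.continuous_re.comp (continuous_const.add h2).matrix_det
    have h5 : Continuous fun x : Matrix (Fin Ns) (Fin k) ℂ × Matrix (Fin Nr) (Fin Nr) ℂ =>
        (hopCov P x.1 + hopGram Q x.2).det.re := Complex.continuous_re.comp (h1.add h2).matrix_det
    simp only [gain]
    exact (h3.mul h4).div₀ h5 fun x => (hopCov_add_hopGram_posDef P Q x.1 x.2).det_re_pos.ne'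
  have h0 : energy (0 : Matrix (Fin Ns) (Fin k) ℂ) ≤ p := by simp [energy, hp]
  have h0' : energy (0 : Matrix (Fin Nr) (Fin Nr) ℂ) ≤ q := by simp [energy, hq]
  obtain ⟨x, hx, hmax⟩ := ((isCompact_energy_le (m := Ns) (n := k) p).prod
    (isCompact_energy_le (m := Nr) (n := Nr) q)).exists_isMaxOn
    ⟨((0 : Matrix (Fin Ns) (Fin k) ℂ), (0 : Matrix (Fin Nr) (Fin Nr) ℂ)), h0, h0'⟩
    hcont.continuousOn
  refine ⟨x.1, x.2, hx.1, hx.2, fun F' Z' h1 h2 => ?_⟩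
  exact isMaxOn_iff.mp hmax (F', Z') ⟨h1, h2⟩

/-- Normalised noise-to-signal ratio of the two-hop link with relay matrix `X`. -/
def linkRatio {Ns Nr Nd k : ℕ} (P : Matrix (Fin Nr) (Fin Ns) ℂ) (Q : Matrix (Fin Nd) (Fin Nr) ℂ)
    (F : Matrix (Fin Ns) (Fin k) ℂ) (X : Matrix (Fin Nr) (Fin Nr) ℂ) : ℝ :=
  (1 + (Q * X) * (Q * X)ᴴ).det.re / (1 + (Q * X) * hopCov P F * (Q * X)ᴴ).det.re

/-- The determinant ratio of the relay link in terms of the gain. -/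
theorem linkRatio_eq_inv_gain {X R : Matrix (Fin Nr) (Fin Nr) ℂ} (hR : R.PosDef)
    (hRC : R * R = hopCov P F) :
    linkRatio P Q F X = (gain P Q F (X * R))⁻¹ := by
  rw [linkRatio]
  have hC := hopCov_posDef P F
  have hRu := hR.isUnit_det'
  have hRi : R⁻¹ᴴ = R⁻¹ := hR.inv.1
  set N := Q * (X * R) with hN
  have hD : hopGram Q (X * R) = Nᴴ * N := rfl
  have hQX : Q * X = N * R⁻¹ := by
    rw [hN, Matrix.mul_assoc, Matrix.mul_assoc X, mul_nonsing_inv _ hRu, Matrix.mul_one]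
  -- Since `R² = C`, the matrix is `1 + N * Nᴴ`, which Sylvester's identity turns into `1 + Nᴴ * N`.
  -- In `h2` the same identity is used after factoring `R` out of `C + D`.
  have h1 : (1 + (Q * X) * hopCov P F * (Q * X)ᴴ).det = (1 + hopGram Q (X * R)).det := by
    have : (Q * X) * hopCov P F * (Q * X)ᴴ = N * Nᴴ := by
      rw [← hRC, hN, conjTranspose_mul Q (X * R), conjTranspose_mul X, hR.1.eq, conjTranspose_mul]
      simp only [Matrix.mul_assoc]
    rw [this, det_one_add_mul_comm, hD]
  have h2 : (hopCov P F + hopGram Q (X * R)).det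
      = (hopCov P F).det * (1 + (Q * X) * (Q * X)ᴴ).det := by
    have e1 : hopCov P F + hopGram Q (X * R) = R * (1 + (R⁻¹ * Nᴴ) * (N * R⁻¹)) * R := by
      rw [hD, ← hRC, Matrix.mul_add, Matrix.add_mul, Matrix.mul_one]
      congr 1
      calc Nᴴ * N = (R * R⁻¹) * Nᴴ * N * (R⁻¹ * R) := by
            rw [mul_nonsing_inv _ hRu, nonsing_inv_mul _ hRu, Matrix.one_mul, Matrix.mul_one]
        _ = _ := by simp only [Matrix.mul_assoc]
    rw [e1, det_mul_right_comm, hRC, det_mul, det_one_add_mul_comm, hQX]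
    congr 3
    rw [conjTranspose_mul N R⁻¹, hRi]
  have h3 : ((hopCov P F).det * (1 + (Q * X) * (Q * X)ᴴ).det).re
      = (hopCov P F).det.re * (1 + (Q * X) * (Q * X)ᴴ).det.re := by
    rw [hC.det_eq_re, Complex.re_ofReal_mul, Complex.ofReal_re]
  rw [gain, h1, inv_div, h2, h3, mul_div_mul_left _ _ hC.det_re_pos.ne']

theorem trace_hopCov_conj {X R : Matrix (Fin Nr) (Fin Nr) ℂ} (hR : R.PosDef)
    (hRC : R * R = hopCov P F) : (X * hopCov P F * Xᴴ).trace.re = energy (X * R) := by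
  rw [energy, conjTranspose_mul, hR.1.eq, ← hRC]
  simp only [Matrix.mul_assoc]

end Existence

/-! ### Factors of the noise covariances -/

section Whitening

theorem exists_whitening {n : ℕ} {S U : Matrix (Fin n) (Fin n) ℂ} {d : Fin n → ℝ}
    (h : IsEVD S U d) {α β : ℝ} (he : ∀ i, 0 < α * d i + β) :
    ∃ L : Matrix (Fin n) (Fin n) ℂ, L * Lᴴ = α • S + β • (1 : Matrix (Fin n) (Fin n) ℂ) ∧
      L * (invSqrtDiag (fun i => α * d i + β) * Uᴴ) = 1 ∧
      invSqrtDiag (fun i => α * d i + β) * Uᴴ * L = 1 := by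
  have hU := unitary_conjTranspose_mul h.unitary
  have hU' := unitary_mul_conjTranspose h.unitary
  set e : Fin n → ℝ := fun i => α * d i + β with hee
  have hs : ∀ i, Real.sqrt (e i) ≠ 0 := fun i => (Real.sqrt_pos.mpr (he i)).ne'
  have hinv : invSqrtDiag e = realDiag fun i => (Real.sqrt (e i))⁻¹ := rfl
  have h2 : invSqrtDiag e * Uᴴ * (U * realDiag fun i => Real.sqrt (e i)) = 1 := by
    rw [Matrix.mul_assoc, ← Matrix.mul_assoc Uᴴ, hU, Matrix.one_mul, hinv, realDiag_mul_realDiag,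
      ← realDiag_one]
    congr 1
    ext i
    exact inv_mul_cancel₀ (hs i)
  refine ⟨U * realDiag fun i => Real.sqrt (e i), ?_, mul_eq_one_comm.mp h2, h2⟩
  have h3 : realDiag e = (α : ℂ) • realDiag d + (β : ℂ) • (1 : Matrix (Fin n) (Fin n) ℂ) := by
    rw [← realDiag_one, realDiag_smul, realDiag_smul, realDiag_add]
    simp [hee]
  rw [conjTranspose_mul, realDiag_conjTranspose, Matrix.mul_assoc, ← Matrix.mul_assoc (realDiag _),
    realDiag_mul_realDiag]
  have h6 : (fun i => Real.sqrt (e i) * Real.sqrt (e i)) = e :=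
    funext fun i => Real.mul_self_sqrt (he i).le
  rw [h6]
  have h4 : S = U * realDiag d * Uᴴ := h.eq
  rw [h3, h4, Matrix.add_mul, Matrix.mul_add, Matrix.smul_mul, Matrix.smul_mul, Matrix.one_mul,
    Matrix.mul_smul, Matrix.mul_smul, hU', Matrix.mul_assoc]
  ext i j
  simp

theorem eigenvalues_nonneg_of_isEVD {n : ℕ} {S U : Matrix (Fin n) (Fin n) ℂ} {d : Fin n → ℝ}
    (h : IsEVD S U d) (hS : S.PosSemidef) (i : Fin n) : 0 ≤ d i := by
  have hU := unitary_conjTranspose_mul h.unitary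
  have h1 := (hS.conjTranspose_mul_mul_same U).diag_nonneg (i := i)
  have h2 : Uᴴ * S * U = realDiag d := by
    rw [h.eq]
    calc _ = (Uᴴ * U) * realDiag d * (Uᴴ * U) := by simp only [Matrix.mul_assoc]; rfl
      _ = _ := by rw [hU, Matrix.one_mul, Matrix.mul_one]
  rw [h2, realDiag, diagonal_apply_eq] at h1
  exact_mod_cast h1

end Whitening

/-- Scaling the channel by `t` and the noise covariance by `t²` leaves the signal-to-noise ratio
unchanged. -/
theorem mseDet_smul {n k : ℕ} (c : ℝ) (B : Matrix (Fin n) (Fin n) ℂ) (G : Matrix (Fin n) (Fin k) ℂ)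
    {t : ℝ} (ht : t ≠ 0) : mseDet c ((t ^ 2) • B) (t • G) = mseDet c B G := by
  have h : ((t ^ 2) • B)⁻¹ = ((t ^ 2)⁻¹ : ℝ) • B⁻¹ := by
    -- For singular `B` both inverses are zero by convention, so no invertibility has to be assumed.
    by_cases hB : IsUnit B.det
    · refine inv_eq_right_inv ?_
      rw [Matrix.smul_mul, Matrix.mul_smul, smul_smul, mul_inv_cancel₀ (pow_ne_zero 2 ht), one_smul,
        mul_nonsing_inv _ hB]
    · have h1 : (t ^ 2) • B = ((t ^ 2 : ℝ) : ℂ) • B := by ext; simp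
      have hB' : ¬ IsUnit ((t ^ 2) • B).det := by
        rw [h1, det_smul]
        simpa [ht] using hB
      rw [nonsing_inv_apply_not_isUnit _ hB, nonsing_inv_apply_not_isUnit _ hB', smul_zero]
  rw [mseDet, mseDet, h, conjTranspose_smul, star_trivial]
  simp only [Matrix.smul_mul, Matrix.mul_smul, smul_smul]
  rw [show t * ((t ^ 2)⁻¹ * t) = 1 by field_simp, one_smul]

theorem energy_real_smul {m n : ℕ} (t : ℝ) (A : Matrix (Fin m) (Fin n) ℂ) :
    energy (t • A) = t ^ 2 * energy A := by
  rw [← energy_smul, Complex.coe_smul]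

/-! ### Scaling precoders up to full power -/

namespace RelayModel

variable {Ns Nr Nd : ℕ} {M : RelayModel Ns Nr Nd}

/-- Positive powers and deviations, positive semidefinite receive-side covariances and identity
transmit-side covariances. -/
structure Regular (M : RelayModel Ns Nr Nd) : Prop where
  σs_pos : 0 < M.σs
  σnsr_pos : 0 < M.σnsr
  σnrd_pos : 0 < M.σnrd
  Ps_pos : 0 < M.Ps
  Pr_pos : 0 < M.Pr
  posSemidef_sr : M.Sigmasr.PosSemidef
  posSemidef_rd : M.Sigmard.PosSemidef
  Psisr_eq : M.Psisr = 1
  Psird_eq : M.Psird = 1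

namespace Regular

theorem alpha1_eq (h : M.Regular) (Fs : Matrix (Fin Ns) (Fin Nd) ℂ) : M.alpha1 Fs = energy Fs := by
  rw [alpha1, h.Psisr_eq, transpose_one, Matrix.mul_one, energy]

theorem sourcePower_eq (Fs : Matrix (Fin Ns) (Fin Nd) ℂ) :
    M.sourcePower Fs = M.σs ^ 2 * energy Fs := by
  rw [sourcePower, trace_smul, Complex.smul_re, energy, smul_eq_mul]

theorem alpha2_eq (h : M.Regular)
    (Fs : Matrix (Fin Ns) (Fin Nd) ℂ) (Fr : Matrix (Fin Nr) (Fin Nr) ℂ) :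
    M.alpha2 Fs Fr = M.relayPower Fs Fr := by
  rw [alpha2, h.Psird_eq, transpose_one, Matrix.mul_one, relayPower]

theorem posSemidef_rdT (h : M.Regular) : M.SigmardT.PosSemidef :=
  h.posSemidef_rd.mul_mul_conjTranspose_same _

theorem sourcePower_nonneg (Fs : Matrix (Fin Ns) (Fin Nd) ℂ) : 0 ≤ M.sourcePower Fs := by
  rw [sourcePower_eq]
  exact mul_nonneg (sq_nonneg _) (energy_nonneg _)

/-- With identity transmit covariance, the error-induced noise depends on the precoder only through
the source power. -/
theorem noiseCov_eq (h : M.Regular) (Fs : Matrix (Fin Ns) (Fin Nd) ℂ) : M.noiseCov Fs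
    = M.sourcePower Fs • M.Sigmasr + (M.σnsr ^ 2) • (1 : Matrix (Fin Nr) (Fin Nr) ℂ) := by
  rw [noiseCov, h.alpha1_eq, sourcePower_eq]

theorem noiseCov_posDef (h : M.Regular)
    (Fs : Matrix (Fin Ns) (Fin Nd) ℂ) : (M.noiseCov Fs).PosDef := by
  rw [h.noiseCov_eq]
  exact PosDef.posSemidef_add (h.posSemidef_sr.smul (sourcePower_nonneg Fs))
    (posDef_smul_one (pow_pos h.σnsr_pos 2))

theorem relayCov_posDef (h : M.Regular)
    (Fs : Matrix (Fin Ns) (Fin Nd) ℂ) : (M.relayCov Fs).PosDef := by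
  refine PosDef.posSemidef_add (PosSemidef.smul ?_ (sq_nonneg _)) (h.noiseCov_posDef Fs)
  have := posSemidef_self_mul_conjTranspose (M.Hsr * Fs)
  rwa [conjTranspose_mul, ← Matrix.mul_assoc] at this

theorem relayPower_nonneg (h : M.Regular)
    (Fs : Matrix (Fin Ns) (Fin Nd) ℂ) (Fr : Matrix (Fin Nr) (Fin Nr) ℂ) :
    0 ≤ M.relayPower Fs Fr :=
  ((h.relayCov_posDef Fs).posSemidef.mul_mul_conjTranspose_same Fr).trace_re_nonneg

theorem relayPower_pos (h : M.Regular)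
    (Fs : Matrix (Fin Ns) (Fin Nd) ℂ) {Fr : Matrix (Fin Nr) (Fin Nr) ℂ}
    (hFr : Fr ≠ 0) : 0 < M.relayPower Fs Fr := by
  refine ((h.relayCov_posDef Fs).posSemidef.mul_mul_conjTranspose_same Fr).trace_re_pos ?_
  have := conj_ne_zero_of_posDef (h.relayCov_posDef Fs) (G := Frᴴ) (by simpa using hFr)
  rwa [conjTranspose_conjTranspose] at this

theorem B_posDef (h : M.Regular)
    (Fs : Matrix (Fin Ns) (Fin Nd) ℂ) (Fr : Matrix (Fin Nr) (Fin Nr) ℂ) :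
    (M.B Fs Fr).PosDef := by
  refine PosDef.posSemidef_add (PosSemidef.add ?_ (h.posSemidef_rdT.smul ?_))
    (posDef_smul_one (pow_pos h.σnrd_pos 2))
  · have := (h.noiseCov_posDef Fs).posSemidef.mul_mul_conjTranspose_same (M.HrdT * Fr)
    rwa [conjTranspose_mul, ← Matrix.mul_assoc] at this
  · rw [h.alpha2_eq]
    exact h.relayPower_nonneg Fs Fr

theorem J_eq (Fs : Matrix (Fin Ns) (Fin Nd) ℂ) (Fr : Matrix (Fin Nr) (Fin Nr) ℂ) :
    M.J Fs Fr = mseDet (M.σs ^ 2)⁻¹ (M.B Fs Fr) (M.Hbar Fr * Fs) := by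
  rw [J, mseDet, conjTranspose_mul]
  simp only [Matrix.mul_assoc]

theorem J_le (h : M.Regular) (Fs : Matrix (Fin Ns) (Fin Nd) ℂ) (Fr : Matrix (Fin Nr) (Fin Nr) ℂ) :
    M.J Fs Fr ≤ (M.σs ^ 2) ^ Nd := by
  have := mseDet_le (inv_pos.mpr (pow_pos h.σs_pos 2)) (h.B_posDef Fs Fr) (M.Hbar Fr * Fs)
  rwa [← J_eq, inv_inv] at this

theorem J_eq_of_zero (h : M.Regular)
    {Fs : Matrix (Fin Ns) (Fin Nd) ℂ} {Fr : Matrix (Fin Nr) (Fin Nr) ℂ}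
    (h0 : M.Hbar Fr * Fs = 0) : M.J Fs Fr = (M.σs ^ 2) ^ Nd := by
  rw [J_eq, h0, mseDet_zero (inv_pos.mpr (pow_pos h.σs_pos 2)) (h.B_posDef Fs Fr), inv_inv]

theorem J_lt (h : M.Regular) {Fs : Matrix (Fin Ns) (Fin Nd) ℂ} {Fr : Matrix (Fin Nr) (Fin Nr) ℂ}
    (h0 : M.Hbar Fr * Fs ≠ 0) : M.J Fs Fr < (M.σs ^ 2) ^ Nd := by
  have := mseDet_lt (inv_pos.mpr (pow_pos h.σs_pos 2)) (h.B_posDef Fs Fr) h0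
  rwa [← J_eq, inv_inv] at this

/-! Joint scaling of the precoders. -/

theorem sourcePower_smul (c : ℝ) (Fs : Matrix (Fin Ns) (Fin Nd) ℂ) :
    M.sourcePower (c • Fs) = c ^ 2 * M.sourcePower Fs := by
  rw [sourcePower_eq, sourcePower_eq, energy_real_smul]
  ring

/-- Signal and error-induced noise scale by `c²`, whereas the thermal noise does not; the subtracted
term is this discrepancy. -/
theorem relayCov_smul (h : M.Regular) {c : ℝ} (hc : c ≠ 0) (Fs : Matrix (Fin Ns) (Fin Nd) ℂ) :
    M.relayCov (c • Fs) = (c ^ 2) • (M.relayCov Fs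
      - ((1 - (c ^ 2)⁻¹) * M.σnsr ^ 2) • (1 : Matrix (Fin Nr) (Fin Nr) ℂ)) := by
  have hc2 : c ^ 2 ≠ 0 := pow_ne_zero 2 hc
  rw [relayCov, relayCov, h.noiseCov_eq, h.noiseCov_eq, sourcePower_smul, conjTranspose_smul,
    star_trivial]
  simp only [Matrix.smul_mul, Matrix.mul_smul, smul_smul, smul_add, smul_sub]
  have e1 : c ^ 2 * ((1 - (c ^ 2)⁻¹) * M.σnsr ^ 2) = c ^ 2 * M.σnsr ^ 2 - M.σnsr ^ 2 := by
    field_simp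
  rw [e1]
  module

theorem relayPower_smul (h : M.Regular)
    {c : ℝ} (hc : c ≠ 0) (t : ℝ) (Fs : Matrix (Fin Ns) (Fin Nd) ℂ)
    (Fr : Matrix (Fin Nr) (Fin Nr) ℂ) : M.relayPower (c • Fs) ((t / c) • Fr)
      = t ^ 2 * (M.relayPower Fs Fr - (1 - (c ^ 2)⁻¹) * M.σnsr ^ 2 * energy Fr) := by
  rw [relayPower, relayPower, h.relayCov_smul hc, conjTranspose_smul, star_trivial, energy]
  simp only [Matrix.smul_mul, Matrix.mul_smul, smul_smul, Matrix.mul_sub, Matrix.sub_mul,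
    trace_smul, trace_sub, Complex.smul_re, Complex.sub_re, Matrix.mul_one, smul_eq_mul]
  field_simp

/-- Scaling by `c` at the source and `t / c` at the relay multiplies the end-to-end signal by `t`.
Relative to the signal, the noise loses exactly the last summand, which is positive semidefinite
when `c², t² ≥ 1`. -/
theorem B_eq_add (h : M.Regular)
    {c t : ℝ} (hc : c ≠ 0) (ht : t ≠ 0) (Fs : Matrix (Fin Ns) (Fin Nd) ℂ)
    (Fr : Matrix (Fin Nr) (Fin Nr) ℂ) :
    M.B Fs Fr = ((t ^ 2)⁻¹ : ℝ) • M.B (c • Fs) ((t / c) • Fr)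
      + (((1 - (c ^ 2)⁻¹) * M.σnsr ^ 2) • (M.HrdT * Fr * (M.HrdT * Fr)ᴴ
          + energy Fr • M.SigmardT)
        + ((1 - (t ^ 2)⁻¹) * M.σnrd ^ 2) • (1 : Matrix (Fin Nd) (Fin Nd) ℂ)) := by
  rw [B, B, h.alpha2_eq, h.alpha2_eq, h.relayPower_smul hc, h.noiseCov_eq, h.noiseCov_eq,
    sourcePower_smul, conjTranspose_smul, star_trivial, conjTranspose_mul]
  simp only [Matrix.smul_mul, Matrix.mul_smul, smul_smul, smul_add, Matrix.mul_add,
    Matrix.add_mul, Matrix.mul_one, ← Matrix.mul_assoc]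
  match_scalars <;> field_simp <;> ring

theorem J_scale {c t : ℝ} (hc : c ≠ 0) (ht : t ≠ 0) (Fs : Matrix (Fin Ns) (Fin Nd) ℂ)
    (Fr : Matrix (Fin Nr) (Fin Nr) ℂ) :
    M.J (c • Fs) ((t / c) • Fr)
      = mseDet (M.σs ^ 2)⁻¹ (((t ^ 2)⁻¹ : ℝ) • M.B (c • Fs) ((t / c) • Fr)) (M.Hbar Fr * Fs) := by
  rw [← mseDet_smul _ _ (M.Hbar Fr * Fs) ht, smul_smul, mul_inv_cancel₀ (pow_ne_zero 2 ht), one_smul,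
    J_eq]
  congr 1
  rw [Hbar, Hbar]
  simp only [Matrix.smul_mul, Matrix.mul_smul, smul_smul]
  congr 1
  field_simp

/-- The source power fixes `c`. The relay power is then `t² ρ`, where `ρ` is its value at `t = 1`
and is positive, so `t` can be solved for. -/
theorem exists_tight_scaling (h : M.Regular)
    {Fs : Matrix (Fin Ns) (Fin Nd) ℂ} {Fr : Matrix (Fin Nr) (Fin Nr) ℂ}
    (hFs : Fs ≠ 0) (hFr : Fr ≠ 0) : ∃ c t : ℝ, 0 < c ∧ 0 < t ∧
      M.sourcePower (c • Fs) = M.Ps ∧ M.relayPower (c • Fs) ((t / c) • Fr) = M.Pr := by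
  have hp : 0 < M.sourcePower Fs := by
    rw [sourcePower_eq]
    exact mul_pos (pow_pos h.σs_pos 2) (energy_pos hFs)
  set c := Real.sqrt (M.Ps / M.sourcePower Fs) with hcdef
  have hc : 0 < c := Real.sqrt_pos.mpr (div_pos h.Ps_pos hp)
  have h1 : M.sourcePower (c • Fs) = M.Ps := by
    rw [sourcePower_smul, Real.sq_sqrt (div_pos h.Ps_pos hp).le, div_mul_cancel₀ _ hp.ne']
  set ρ := M.relayPower Fs Fr - (1 - (c ^ 2)⁻¹) * M.σnsr ^ 2 * energy Fr with hρ
  have hρ0 : 0 < ρ := by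
    have := h.relayPower_smul hc.ne' 1 Fs Fr
    rw [one_pow, one_mul] at this
    rw [hρ, ← this]
    exact h.relayPower_pos _ (smul_ne_zero (by positivity) hFr)
  refine ⟨c, Real.sqrt (M.Pr / ρ), hc, Real.sqrt_pos.mpr (div_pos h.Pr_pos hρ0), h1, ?_⟩
  rw [h.relayPower_smul hc.ne', Real.sq_sqrt (div_pos h.Pr_pos hρ0).le, ← hρ,
    div_mul_cancel₀ _ hρ0.ne']

/-- Scaling a feasible pair up to both power budgets does not increase the objective, and
decreases it if the pair transmits and some budget is not exhausted. -/
theorem exists_tight_improvement (h : M.Regular) {Fs : Matrix (Fin Ns) (Fin Nd) ℂ}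
    {Fr : Matrix (Fin Nr) (Fin Nr) ℂ} (hFs : Fs ≠ 0) (hFr : Fr ≠ 0) (hf : M.Feasible Fs Fr) :
    ∃ Fs' Fr', M.sourcePower Fs' = M.Ps ∧ M.relayPower Fs' Fr' = M.Pr ∧
      M.J Fs' Fr' ≤ M.J Fs Fr ∧ (M.Hbar Fr * Fs ≠ 0 →
        ¬ (M.sourcePower Fs = M.Ps ∧ M.relayPower Fs Fr = M.Pr) → M.J Fs' Fr' < M.J Fs Fr) := by
  obtain ⟨c, t, hc, ht, h1, h2⟩ := h.exists_tight_scaling hFs hFr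
  have hp : 0 < M.sourcePower Fs := by
    rw [sourcePower_eq]
    exact mul_pos (pow_pos h.σs_pos 2) (energy_pos hFs)
  have hσ : 0 < (M.σs ^ 2)⁻¹ := inv_pos.mpr (pow_pos h.σs_pos 2)
  have hn : 0 < M.σnsr ^ 2 * energy Fr := mul_pos (pow_pos h.σnsr_pos 2) (energy_pos hFr)
  have h1' := h1
  have h2' := h2
  rw [sourcePower_smul] at h1'
  rw [h.relayPower_smul hc.ne'] at h2'
  have hc1 : 1 ≤ c ^ 2 := by
    by_contra hlt
    push Not at hlt
    nlinarith [hf.1]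
  have hci : 0 ≤ 1 - (c ^ 2)⁻¹ := sub_nonneg.mpr (inv_le_one_of_one_le₀ hc1)
  have hρ : M.relayPower Fs Fr - (1 - (c ^ 2)⁻¹) * M.σnsr ^ 2 * energy Fr ≤ M.Pr := by
    nlinarith [hf.2, mul_nonneg hci hn.le]
  have ht1 : 1 ≤ t ^ 2 := by
    by_contra hlt
    push Not at hlt
    nlinarith [h.Pr_pos, pow_pos ht 2]
  have hti : 0 ≤ 1 - (t ^ 2)⁻¹ := sub_nonneg.mpr (inv_le_one_of_one_le₀ ht1)
  have hE1 : (((1 - (c ^ 2)⁻¹) * M.σnsr ^ 2) • (M.HrdT * Fr * (M.HrdT * Fr)ᴴ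
      + energy Fr • M.SigmardT)).PosSemidef :=
    ((posSemidef_self_mul_conjTranspose _).add (h.posSemidef_rdT.smul (energy_nonneg _))).smul
      (mul_nonneg hci (sq_nonneg _))
  have hB : (((t ^ 2)⁻¹ : ℝ) • M.B (c • Fs) ((t / c) • Fr)).PosDef :=
    (h.B_posDef _ _).smul (inv_pos.mpr (pow_pos ht 2))
  refine ⟨c • Fs, (t / c) • Fr, h1, h2, ?_, fun h0 hnt => ?_⟩
  · rw [J_scale hc.ne' ht.ne', J_eq, h.B_eq_add hc.ne' ht.ne' Fs Fr]
    refine mseDet_mono hσ hB (hE1.add ?_) _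
    exact PosSemidef.one.smul (mul_nonneg hti (sq_nonneg _))
  · rw [J_scale hc.ne' ht.ne', J_eq, h.B_eq_add hc.ne' ht.ne' Fs Fr]
    refine mseDet_strictMono hσ hB (PosDef.posSemidef_add hE1 (posDef_smul_one ?_)) h0
    -- Strictness comes from `1 < t²`. If `t² = 1`, the relay budget equation leaves no room for a
    -- positive thermal-noise reduction, so `c² = 1` and the pair was already tight.
    refine mul_pos (sub_pos.mpr (inv_lt_one_of_one_lt₀ (lt_of_le_of_ne ht1 fun he => hnt ?_)))
      (pow_pos h.σnrd_pos 2)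
    rw [← he, one_mul] at h2'
    have hc0 : 1 - (c ^ 2)⁻¹ = 0 := by
      refine le_antisymm ?_ hci
      by_contra hgt
      push Not at hgt
      nlinarith [hf.2, mul_pos hgt hn]
    have hc2 : c ^ 2 = 1 := by
      have : (c ^ 2)⁻¹ = 1 := by linarith
      exact inv_eq_one.mp this
    rw [hc2, one_mul] at h1'
    rw [hc0] at h2'
    exact ⟨h1', by linarith⟩

end Regular

end RelayModel

theorem gain_zero_zero {Ns Nr Nd k : ℕ} {P : Matrix (Fin Nr) (Fin Ns) ℂ}
    {Q : Matrix (Fin Nd) (Fin Nr) ℂ} :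
    gain P Q (0 : Matrix (Fin Ns) (Fin k) ℂ) 0 = 1 := by
  simp [gain, hopCov, hopGram]

theorem exists_nonzero_matrix {m n : ℕ} (hm : 0 < m) (hn : 0 < n) :
    ∃ A : Matrix (Fin m) (Fin n) ℂ, A ≠ 0 :=
  ⟨Matrix.of fun _ _ => 1, fun h => one_ne_zero (congrFun (congrFun h ⟨0, hm⟩) ⟨0, hn⟩)⟩

/-! ### Equivalence with gain maximisation -/

namespace RelayModel

variable {Ns Nr Nd : ℕ} {M : RelayModel Ns Nr Nd}

/-- Factors of the full-power noise covariances, and the channels whitened by them. -/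
structure IsWhitened (M : RelayModel Ns Nr Nd) (L K : Matrix (Fin Nr) (Fin Nr) ℂ)
    (L' : Matrix (Fin Nd) (Fin Nd) ℂ) (P : Matrix (Fin Nr) (Fin Ns) ℂ)
    (Q : Matrix (Fin Nd) (Fin Nr) ℂ) : Prop where
  mul_left : L * K = 1
  mul_right : K * L = 1
  cov_sr : L * Lᴴ = M.Ps • M.Sigmasr + (M.σnsr ^ 2) • (1 : Matrix (Fin Nr) (Fin Nr) ℂ)
  cov_rd : L' * L'ᴴ = M.Pr • M.SigmardT + (M.σnrd ^ 2) • (1 : Matrix (Fin Nd) (Fin Nd) ℂ)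
  isUnit : IsUnit L'.det
  sr_eq : M.Hsr = L * P
  rd_eq : M.HrdT = L' * Q

namespace IsWhitened

variable {L K : Matrix (Fin Nr) (Fin Nr) ℂ} {L' : Matrix (Fin Nd) (Fin Nd) ℂ}
  {P : Matrix (Fin Nr) (Fin Ns) ℂ} {Q : Matrix (Fin Nd) (Fin Nr) ℂ}

/-- Whitening uses the noise at full source power; a source spending less sees less noise, and the
second summand is the deficit. It vanishes for a tight pair and is positive semidefinite for a
feasible one, as in `B_add`. -/
theorem relayCov_add (w : M.IsWhitened L K L' P Q) (h : M.Regular)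
    (Fs : Matrix (Fin Ns) (Fin Nd) ℂ) :
    M.relayCov Fs + (M.Ps - M.sourcePower Fs) • M.Sigmasr
      = L * hopCov P (M.σs • Fs) * Lᴴ := by
  have e : L * hopCov P (M.σs • Fs) * Lᴴ
      = L * Lᴴ + (M.σs ^ 2) • (M.Hsr * Fs * Fsᴴ * M.Hsrᴴ) := by
    rw [hopCov, w.sr_eq, Matrix.mul_add, Matrix.add_mul, Matrix.mul_one, conjTranspose_mul P,
      conjTranspose_smul, star_trivial, conjTranspose_mul L P]
    simp only [Matrix.smul_mul, Matrix.mul_smul, smul_smul, Matrix.mul_assoc, sq]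
  rw [e, w.cov_sr, relayCov, h.noiseCov_eq]
  module

theorem relayPower_add (w : M.IsWhitened L K L' P Q) (h : M.Regular)
    (Fs : Matrix (Fin Ns) (Fin Nd) ℂ) (Fr : Matrix (Fin Nr) (Fin Nr) ℂ) :
    M.relayPower Fs Fr + (M.Ps - M.sourcePower Fs) * (Fr * M.Sigmasr * Frᴴ).trace.re
      = ((Fr * L) * hopCov P (M.σs • Fs) * (Fr * L)ᴴ).trace.re := by
  have e : (Fr * L) * hopCov P (M.σs • Fs) * (Fr * L)ᴴ
      = Fr * (L * hopCov P (M.σs • Fs) * Lᴴ) * Frᴴ := by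
    rw [conjTranspose_mul]
    simp only [Matrix.mul_assoc]
  rw [e, ← w.relayCov_add h, relayPower, Matrix.mul_add, Matrix.add_mul, trace_add, Complex.add_re,
    Matrix.mul_smul, Matrix.smul_mul, trace_smul, Complex.smul_re, smul_eq_mul]

theorem relayPower_le (w : M.IsWhitened L K L' P Q) (h : M.Regular)
    {Fs : Matrix (Fin Ns) (Fin Nd) ℂ} (Fr : Matrix (Fin Nr) (Fin Nr) ℂ)
    (hp : M.sourcePower Fs ≤ M.Ps) :
    M.relayPower Fs Fr ≤ ((Fr * L) * hopCov P (M.σs • Fs) * (Fr * L)ᴴ).trace.re := by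
  rw [← w.relayPower_add h]
  exact le_add_of_nonneg_right (mul_nonneg (sub_nonneg.mpr hp)
    (h.posSemidef_sr.mul_mul_conjTranspose_same Fr).trace_re_nonneg)

theorem relayPower_eq (w : M.IsWhitened L K L' P Q) (h : M.Regular)
    {Fs : Matrix (Fin Ns) (Fin Nd) ℂ} (Fr : Matrix (Fin Nr) (Fin Nr) ℂ)
    (hp : M.sourcePower Fs = M.Ps) :
    M.relayPower Fs Fr = ((Fr * L) * hopCov P (M.σs • Fs) * (Fr * L)ᴴ).trace.re := by
  rw [← w.relayPower_add h, hp, sub_self, zero_mul, add_zero]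

theorem B_add (w : M.IsWhitened L K L' P Q) (h : M.Regular)
    (Fs : Matrix (Fin Ns) (Fin Nd) ℂ) (Fr : Matrix (Fin Nr) (Fin Nr) ℂ) :
    M.B Fs Fr + ((M.Ps - M.sourcePower Fs) • (M.HrdT * Fr * M.Sigmasr * (M.HrdT * Fr)ᴴ)
        + (M.Pr - M.relayPower Fs Fr) • M.SigmardT)
      = L' * (1 + (Q * (Fr * L)) * (Q * (Fr * L))ᴴ) * L'ᴴ := by
  have e : L' * (1 + (Q * (Fr * L)) * (Q * (Fr * L))ᴴ) * L'ᴴ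
      = L' * L'ᴴ + M.HrdT * Fr * (L * Lᴴ) * (M.HrdT * Fr)ᴴ := by
    rw [Matrix.mul_add, Matrix.add_mul, Matrix.mul_one, w.rd_eq]
    simp only [conjTranspose_mul, Matrix.mul_assoc]
  rw [e, w.cov_rd, w.cov_sr, B, h.alpha2_eq, h.noiseCov_eq, conjTranspose_mul]
  simp only [Matrix.mul_add, Matrix.add_mul, Matrix.mul_smul, Matrix.smul_mul, Matrix.mul_assoc]
  module

/-- Both the noise covariance and the received covariance are congruences by `L'`, so its
determinant cancels in the ratio of `mseDet_eq_ratio`. -/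
theorem mseDet_eq (w : M.IsWhitened L K L' P Q) (h : M.Regular)
    (Fs : Matrix (Fin Ns) (Fin Nd) ℂ) (Fr : Matrix (Fin Nr) (Fin Nr) ℂ) :
    mseDet (M.σs ^ 2)⁻¹ (L' * (1 + (Q * (Fr * L)) * (Q * (Fr * L))ᴴ) * L'ᴴ) (M.Hbar Fr * Fs)
      = (M.σs ^ 2) ^ Nd * linkRatio P Q (M.σs • Fs) (Fr * L) := by
  set Y := Q * (Fr * L) with hY
  have hinj : Function.Injective L'.vecMul := vecMul_injective_of_isUnit
    ((isUnit_iff_isUnit_det _).mpr w.isUnit)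
  have hB : (L' * (1 + Y * Yᴴ) * L'ᴴ).PosDef :=
    (PosDef.one.add_posSemidef (posSemidef_self_mul_conjTranspose Y)).mul_mul_conjTranspose_same
      hinj
  have hL : (L' * L'ᴴ).PosDef := by
    have := (PosDef.one (n := Fin Nd) (R := ℂ)).mul_mul_conjTranspose_same hinj
    rwa [Matrix.mul_one] at this
  have hG : M.Hbar Fr * Fs = L' * (Y * (P * Fs)) := by
    rw [Hbar, w.rd_eq, w.sr_eq, hY]
    simp only [Matrix.mul_assoc]
  have e2 : L' * (1 + Y * Yᴴ) * L'ᴴ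
      + (M.σs ^ 2) • ((M.Hbar Fr * Fs) * (M.Hbar Fr * Fs)ᴴ)
      = L' * (1 + Y * hopCov P (M.σs • Fs) * Yᴴ) * L'ᴴ := by
    rw [hG, hopCov]
    simp only [conjTranspose_mul, conjTranspose_smul, star_trivial, Matrix.mul_add, Matrix.add_mul,
      Matrix.mul_smul, Matrix.smul_mul, Matrix.mul_one, smul_smul, Matrix.mul_assoc, sq, add_assoc]
  have hdet : ∀ A : Matrix (Fin Nd) (Fin Nd) ℂ,
      (L' * A * L'ᴴ).det.re = (L' * L'ᴴ).det.re * A.det.re := by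
    intro A
    rw [det_mul_right_comm, det_re_mul_posDef hL]
  rw [mseDet_eq_ratio (inv_pos.mpr (pow_pos h.σs_pos 2)) hB, inv_inv, e2, hdet, hdet,
    mul_div_mul_left _ _ hL.det_re_pos.ne', linkRatio]

theorem J_le (w : M.IsWhitened L K L' P Q) (h : M.Regular)
    {Fs : Matrix (Fin Ns) (Fin Nd) ℂ} {Fr : Matrix (Fin Nr) (Fin Nr) ℂ} (hf : M.Feasible Fs Fr) :
    M.J Fs Fr ≤ (M.σs ^ 2) ^ Nd * linkRatio P Q (M.σs • Fs) (Fr * L) := by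
  rw [← w.mseDet_eq h, ← w.B_add h Fs Fr, Regular.J_eq]
  refine mseDet_mono (inv_pos.mpr (pow_pos h.σs_pos 2)) (h.B_posDef _ _) (PosSemidef.add ?_ ?_) _
  · exact (h.posSemidef_sr.mul_mul_conjTranspose_same _).smul (sub_nonneg.mpr hf.1)
  · exact h.posSemidef_rdT.smul (sub_nonneg.mpr hf.2)

theorem J_eq_of_tight (w : M.IsWhitened L K L' P Q) (h : M.Regular)
    {Fs : Matrix (Fin Ns) (Fin Nd) ℂ} {Fr : Matrix (Fin Nr) (Fin Nr) ℂ}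
    (hs : M.sourcePower Fs = M.Ps) (hr : M.relayPower Fs Fr = M.Pr) :
    M.J Fs Fr = (M.σs ^ 2) ^ Nd * linkRatio P Q (M.σs • Fs) (Fr * L) := by
  rw [← w.mseDet_eq h, ← w.B_add h Fs Fr, Regular.J_eq, hs, hr, sub_self, sub_self, zero_smul, zero_smul,
    add_zero, add_zero]

theorem energy_smul_eq (Fs : Matrix (Fin Ns) (Fin Nd) ℂ) :
    energy (M.σs • Fs) = M.sourcePower Fs := by
  rw [Regular.sourcePower_eq, energy_real_smul]

/-- Every pair of normalised precoders within the power budgets gives a feasible pair whose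
objective is at most the inverse gain. -/
theorem exists_feasible (w : M.IsWhitened L K L' P Q) (h : M.Regular)
    {F : Matrix (Fin Ns) (Fin Nd) ℂ} {Z : Matrix (Fin Nr) (Fin Nr) ℂ}
    (hF : energy F ≤ M.Ps) (hZ : energy Z ≤ M.Pr) : ∃ Fs Fr, M.Feasible Fs Fr ∧
      M.J Fs Fr ≤ (M.σs ^ 2) ^ Nd * (gain P Q F Z)⁻¹ := by
  obtain ⟨R, hR, hRC⟩ := exists_posDef_sqrt (hopCov_posDef P F)
  have hF' : M.σs • (M.σs⁻¹ • F) = F := by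
    rw [smul_smul, mul_inv_cancel₀ h.σs_pos.ne', one_smul]
  have hX : Z * R⁻¹ * K * L = Z * R⁻¹ := by rw [Matrix.mul_assoc, w.mul_right, Matrix.mul_one]
  have hZR : Z * R⁻¹ * R = Z := by
    rw [Matrix.mul_assoc, nonsing_inv_mul _ hR.isUnit_det', Matrix.mul_one]
  have hs : M.sourcePower (M.σs⁻¹ • F) ≤ M.Ps := by rwa [← energy_smul_eq, hF']
  have hf : M.Feasible (M.σs⁻¹ • F) (Z * R⁻¹ * K) := by
    refine ⟨hs, (w.relayPower_le h _ hs).trans ?_⟩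
    rwa [hF', hX, trace_hopCov_conj hR hRC, hZR]
  refine ⟨_, _, hf, (w.J_le h hf).trans_eq ?_⟩
  rw [hF', hX, linkRatio_eq_inv_gain hR hRC, hZR]

/-- For a tight pair, the objective is the inverse gain of the normalised precoders. -/
theorem J_eq_inv_gain (w : M.IsWhitened L K L' P Q) (h : M.Regular)
    {Fs : Matrix (Fin Ns) (Fin Nd) ℂ} {Fr R : Matrix (Fin Nr) (Fin Nr) ℂ}
    (hs : M.sourcePower Fs = M.Ps) (hr : M.relayPower Fs Fr = M.Pr) (hR : R.PosDef)
    (hRC : R * R = hopCov P (M.σs • Fs)) :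
    energy (Fr * L * R) = M.Pr ∧
      M.J Fs Fr = (M.σs ^ 2) ^ Nd * (gain P Q (M.σs • Fs) (Fr * L * R))⁻¹ := by
  refine ⟨?_, ?_⟩
  · rw [← trace_hopCov_conj hR hRC, ← w.relayPower_eq h _ hs, hr]
  · rw [w.J_eq_of_tight h hs hr, linkRatio_eq_inv_gain hR hRC]

/-- The objective of any feasible pair is bounded below by the inverse of the maximal gain. -/
theorem le_J (w : M.IsWhitened L K L' P Q) (h : M.Regular) {g : ℝ} (hg : 1 ≤ g)
    (hmax : ∀ (F : Matrix (Fin Ns) (Fin Nd) ℂ) (Z : Matrix (Fin Nr) (Fin Nr) ℂ),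
      energy F ≤ M.Ps → energy Z ≤ M.Pr → gain P Q F Z ≤ g)
    {Fs : Matrix (Fin Ns) (Fin Nd) ℂ} {Fr : Matrix (Fin Nr) (Fin Nr) ℂ} (hf : M.Feasible Fs Fr) :
    (M.σs ^ 2) ^ Nd * g⁻¹ ≤ M.J Fs Fr := by
  have hσ : 0 < (M.σs ^ 2) ^ Nd := pow_pos (pow_pos h.σs_pos 2) Nd
  -- A pair that conveys nothing has `J = σ_s^{2 N_d}`, and there `1 ≤ g` suffices. Otherwise both
  -- precoders are nonzero and can be scaled to full power.
  by_cases h0 : M.Hbar Fr * Fs = 0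
  · rw [h.J_eq_of_zero h0]
    exact mul_le_of_le_one_right hσ.le (inv_le_one_of_one_le₀ hg)
  have hFs : Fs ≠ 0 := by rintro rfl; exact h0 (Matrix.mul_zero _)
  have hFr : Fr ≠ 0 := by rintro rfl; exact h0 (by simp [Hbar])
  obtain ⟨Fs', Fr', hs, hr, hle, -⟩ := h.exists_tight_improvement hFs hFr hf
  refine le_trans ?_ hle
  obtain ⟨R, hR, hRC⟩ := exists_posDef_sqrt (hopCov_posDef P (M.σs • Fs'))
  obtain ⟨he, hJ⟩ := w.J_eq_inv_gain h hs hr hR hRC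
  rw [hJ]
  refine mul_le_mul_of_nonneg_left (inv_anti₀ gain_pos ?_) hσ.le
  exact hmax _ _ (by rw [energy_smul_eq, hs]) he.le

/-- A gain maximiser yields a feasible pair meeting the universal lower bound `le_J`, so no
compactness of the original feasible set is required. -/
theorem exists_isOptimal (w : M.IsWhitened L K L' P Q) (h : M.Regular) :
    ∃ Fs Fr, M.IsOptimal Fs Fr := by
  obtain ⟨F, Z, hF, hZ, hmax⟩ := exists_gain_maximizer P Q Nd h.Ps_pos.le h.Pr_pos.le
  obtain ⟨Fs, Fr, hf, hJ⟩ := w.exists_feasible h hF hZ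
  refine ⟨Fs, Fr, hf, fun Fs' Fr' hf' => hJ.trans (w.le_J h ?_ hmax hf')⟩
  rw [← gain_zero_zero (P := P) (Q := Q) (k := Nd)]
  exact hmax _ _ (by simp [energy, h.Ps_pos.le]) (by simp [energy, h.Pr_pos.le])

theorem exists_isOptimal_tight (w : M.IsWhitened L K L' P Q) (h : M.Regular) (hNs : 0 < Ns)
    (hNr : 0 < Nr) (hNd : 0 < Nd) : ∃ Fs Fr, M.IsOptimal Fs Fr ∧ M.sourcePower Fs = M.Ps ∧
      M.relayPower Fs Fr = M.Pr := by
  obtain ⟨Fs, Fr, hf, hopt⟩ := w.exists_isOptimal h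
  by_cases h0 : M.Hbar Fr * Fs = 0
  · obtain ⟨A, hA⟩ := exists_nonzero_matrix hNs hNd
    obtain ⟨C, hC⟩ := exists_nonzero_matrix hNr hNr
    obtain ⟨c, t, -, -, hs, hr⟩ := h.exists_tight_scaling hA hC
    refine ⟨_, _, ⟨⟨hs.le, hr.le⟩, fun Fs' Fr' hf' => ?_⟩, hs, hr⟩
    refine (h.J_le _ _).trans ?_
    rw [← h.J_eq_of_zero h0]
    exact hopt _ _ hf'
  · have hFs : Fs ≠ 0 := by rintro rfl; exact h0 (Matrix.mul_zero _)
    have hFr : Fr ≠ 0 := by rintro rfl; exact h0 (by simp [Hbar])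
    obtain ⟨Fs', Fr', hs, hr, hle, -⟩ := h.exists_tight_improvement hFs hFr hf
    exact ⟨Fs', Fr', ⟨⟨hs.le, hr.le⟩, fun A C hAC => hle.trans (hopt A C hAC)⟩, hs, hr⟩

end IsWhitened

namespace Regular

/-- Precoders with a single entry route one symbol through a nonzero entry of each channel. -/
theorem exists_feasible_lt (h : M.Regular) (hsr : M.Hsr ≠ 0) (hrd : M.HrdT ≠ 0) (hNd : 0 < Nd) :
    ∃ Fs Fr, M.Feasible Fs Fr ∧ M.J Fs Fr < (M.σs ^ 2) ^ Nd := by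
  obtain ⟨i, j, hij⟩ : ∃ i j, M.Hsr i j ≠ 0 := by
    by_contra hc
    push Not at hc
    exact hsr (Matrix.ext hc)
  obtain ⟨a, b, hab⟩ : ∃ a b, M.HrdT a b ≠ 0 := by
    by_contra hc
    push Not at hc
    exact hrd (Matrix.ext hc)
  set A : Matrix (Fin Ns) (Fin Nd) ℂ := single j ⟨0, hNd⟩ 1
  set C : Matrix (Fin Nr) (Fin Nr) ℂ := single b i 1
  have h1 : M.HrdT * C * M.Hsr * A ≠ 0 := by
    intro h0
    have := congrFun (congrFun h0 a) ⟨0, hNd⟩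
    rw [Matrix.mul_assoc, Matrix.mul_assoc, ← Matrix.mul_assoc C, single_mul_mul_single,
      mul_single_apply_same, one_mul, mul_one] at this
    exact mul_ne_zero hab hij this
  have hA : A ≠ 0 := by
    intro h0
    rw [h0] at h1
    exact h1 (Matrix.mul_zero _)
  have hC : C ≠ 0 := by
    intro h0
    rw [h0] at h1
    exact h1 (by simp)
  obtain ⟨c, t, hc, ht, hs, hr⟩ := h.exists_tight_scaling hA hC
  refine ⟨_, _, ⟨hs.le, hr.le⟩, h.J_lt ?_⟩
  rw [Hbar]
  simp only [Matrix.mul_smul, Matrix.smul_mul, smul_smul]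
  exact smul_ne_zero (by positivity) h1

/-- If both channels are nonzero, minimizers use the full power budgets. -/
theorem tight_of_isOptimal (h : M.Regular) (hsr : M.Hsr ≠ 0) (hrd : M.HrdT ≠ 0) (hNd : 0 < Nd)
    {Fs : Matrix (Fin Ns) (Fin Nd) ℂ} {Fr : Matrix (Fin Nr) (Fin Nr) ℂ}
    (hopt : M.IsOptimal Fs Fr) : M.J Fs Fr < (M.σs ^ 2) ^ Nd ∧
      M.sourcePower Fs = M.Ps ∧ M.relayPower Fs Fr = M.Pr := by
  obtain ⟨A, C, hf, hlt⟩ := h.exists_feasible_lt hsr hrd hNd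
  have hJ := (hopt.2 A C hf).trans_lt hlt
  refine ⟨hJ, ?_⟩
  have h0 : M.Hbar Fr * Fs ≠ 0 := fun h0 => hJ.ne (h.J_eq_of_zero h0)
  have hFs : Fs ≠ 0 := by rintro rfl; exact h0 (Matrix.mul_zero _)
  have hFr : Fr ≠ 0 := by rintro rfl; exact h0 (by simp [Hbar])
  obtain ⟨Fs', Fr', hs, hr, -, hstrict⟩ := h.exists_tight_improvement hFs hFr hopt.1
  by_contra hnt
  exact (hstrict h0 hnt).not_ge (hopt.2 _ _ ⟨hs.le, hr.le⟩)

end Regular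

/-- A tight minimizer which transmits corresponds to a maximizer of the gain. -/
theorem IsWhitened.gain_max {L K : Matrix (Fin Nr) (Fin Nr) ℂ} {L' : Matrix (Fin Nd) (Fin Nd) ℂ}
    {P : Matrix (Fin Nr) (Fin Ns) ℂ} {Q : Matrix (Fin Nd) (Fin Nr) ℂ}
    (w : M.IsWhitened L K L' P Q) (h : M.Regular)
    {Fs : Matrix (Fin Ns) (Fin Nd) ℂ} {Fr R : Matrix (Fin Nr) (Fin Nr) ℂ}
    (hopt : M.IsOptimal Fs Fr) (hJ : M.J Fs Fr < (M.σs ^ 2) ^ Nd)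
    (hs : M.sourcePower Fs = M.Ps) (hr : M.relayPower Fs Fr = M.Pr) (hR : R.PosDef)
    (hRC : R * R = hopCov P (M.σs • Fs)) :
    (∀ (F' : Matrix (Fin Ns) (Fin Nd) ℂ) (Z' : Matrix (Fin Nr) (Fin Nr) ℂ), energy F' ≤ M.Ps → energy Z' ≤ M.Pr →
      gain P Q F' Z' ≤ gain P Q (M.σs • Fs) (Fr * L * R)) ∧
    1 < gain P Q (M.σs • Fs) (Fr * L * R) := by
  have hσ : 0 < (M.σs ^ 2) ^ Nd := pow_pos (pow_pos h.σs_pos 2) Nd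
  obtain ⟨-, hJe⟩ := w.J_eq_inv_gain h hs hr hR hRC
  refine ⟨fun F' Z' hF' hZ' => ?_, ?_⟩
  · obtain ⟨A, C, hf, hle⟩ := w.exists_feasible h hF' hZ'
    have := (hopt.2 A C hf).trans hle
    rw [hJe] at this
    exact (inv_le_inv₀ gain_pos gain_pos).mp (le_of_mul_le_mul_left this hσ)
  · rw [hJe] at hJ
    by_contra hle
    push Not at hle
    exact hJ.not_ge (le_mul_of_one_le_right hσ.le (one_le_inv₀ gain_pos |>.mpr hle))

end RelayModel

/-! ### Padding and truncation of gain sequences -/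

section ZeroExt

theorem zeroExt_coe {k : ℕ} (v : Fin k → ℝ) (i : Fin k) : zeroExt v i = v i := by
  simp [zeroExt]

theorem zeroExt_of_le {k : ℕ} (v : Fin k → ℝ) {i : ℕ} (h : k ≤ i) : zeroExt v i = 0 := by
  simp [zeroExt, h]

theorem zeroExt_nonneg {k : ℕ} {v : Fin k → ℝ} (h : ∀ i, 0 ≤ v i) (i : ℕ) : 0 ≤ zeroExt v i := by
  unfold zeroExt
  split_ifs
  exacts [h _, le_rfl]

theorem zeroExt_restrict {k : ℕ} {f : ℕ → ℝ} (h : ∀ i, k ≤ i → f i = 0) :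
    zeroExt (fun i : Fin k => f i) = f := by
  ext i
  unfold zeroExt
  split_ifs with hi
  exacts [rfl, (h i (not_lt.mp hi)).symm]

theorem smul_rectDiag (m n : ℕ) (t : ℝ) (d : ℕ → ℝ) :
    t • rectDiag m n d = rectDiag m n fun i => t * d i := by
  ext i j
  simp [rectDiag]

theorem sum_fin_eq_of_eq_zero {m n : ℕ} {f : ℕ → ℝ} (h : ∀ i, min m n ≤ i → f i = 0) :
    ∑ i : Fin m, f i = ∑ i : Fin n, f i := by
  have key : ∀ k, min m n ≤ k → ∑ i ∈ Finset.range k, f i = ∑ i ∈ Finset.range (min m n), f i := by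
    intro k hk
    refine (Finset.sum_subset (Finset.range_subset_range.mpr hk) fun i _ hi => h i ?_).symm
    simpa [min_le_iff, imp_iff_not_or] using hi
  rw [Fin.sum_univ_eq_sum_range, Fin.sum_univ_eq_sum_range, key m (min_le_left _ _),
    key n (min_le_right _ _)]

end ZeroExt

/-! ### Power and determinant ratio of diagonal precoders -/

section Parallel

variable {Ns Nr Nd : ℕ} {P : Matrix (Fin Nr) (Fin Ns) ℂ} {Q : Matrix (Fin Nd) (Fin Nr) ℂ}
  {U₁ V₂ : Matrix (Fin Nr) (Fin Nr) ℂ} {V₁ : Matrix (Fin Ns) (Fin Ns) ℂ}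
  {U₂ Φ : Matrix (Fin Nd) (Fin Nd) ℂ} {l₁ l₂ a b : ℕ → ℝ}

theorem det_one_add_unitary_conj {n : ℕ} {U : Matrix (Fin n) (Fin n) ℂ}
    (hU : U ∈ unitaryGroup (Fin n) ℂ) (d : ℕ → ℝ) :
    (1 + U * rectDiag n n d * Uᴴ).det.re = ∏ i : Fin n, (1 + d i) := by
  rw [Matrix.mul_assoc, det_one_add_mul_comm, Matrix.mul_assoc, unitary_conjTranspose_mul hU,
    Matrix.mul_one, rectDiag_square, ← diagonal_one, diagonal_add, det_diagonal,
    ← Complex.ofReal_re (∏ i : Fin n, (1 + d i))]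
  push_cast
  rfl

theorem trace_unitary_conj {n : ℕ} {U : Matrix (Fin n) (Fin n) ℂ}
    (hU : U ∈ unitaryGroup (Fin n) ℂ) (d : ℕ → ℝ) :
    (U * rectDiag n n d * Uᴴ).trace.re = ∑ i : Fin n, d i := by
  rw [trace_mul_comm, ← Matrix.mul_assoc, unitary_conjTranspose_mul hU, Matrix.one_mul,
    rectDiag_square, trace_diagonal, Complex.re_sum]
  rfl

/-- The assumption `Nd ≤ Ns` ensures that no gain is cut off by the rectangular shape. -/
theorem energy_rectDiag_frame (hV : V₁ ∈ unitaryGroup (Fin Ns) ℂ)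
    (hΦ : Φ ∈ unitaryGroup (Fin Nd) ℂ) (h : Nd ≤ Ns) :
    energy (V₁ * rectDiag Ns Nd a * Φ) = ∑ i : Fin Nd, a i ^ 2 := by
  have e : (V₁ * rectDiag Ns Nd a * Φ)ᴴ * (V₁ * rectDiag Ns Nd a * Φ)
      = Φᴴ * rectDiag Nd Nd (fun i => a i * a i) * Φᴴᴴ := by
    rw [conjTranspose_mul, conjTranspose_mul, rectDiag_conjTranspose, conjTranspose_conjTranspose,
      ← rectDiag_mul_rectDiag (k := Ns) a a fun i _ hi hle => absurd (hi.trans_le (h.trans hle))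
        (lt_irrefl i)]
    calc _ = Φᴴ * rectDiag Nd Ns a * (V₁ᴴ * V₁) * rectDiag Ns Nd a * Φ := by
          simp only [Matrix.mul_assoc]
      _ = _ := by
          rw [unitary_conjTranspose_mul hV, Matrix.mul_one]
          simp only [Matrix.mul_assoc]
  have hΦ' : Φᴴ ∈ unitaryGroup (Fin Nd) ℂ := by
    rw [mem_unitaryGroup_iff, star_eq_conjTranspose, conjTranspose_conjTranspose]
    exact unitary_conjTranspose_mul hΦ
  rw [energy_eq, e, trace_unitary_conj hΦ']
  simp only [sq]

theorem hopCov_svd_frame (hP : IsSVD P U₁ l₁ V₁) (hΦ : Φ ∈ unitaryGroup (Fin Nd) ℂ)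
    (ha : ∀ i, Nd ≤ i → a i = 0) :
    hopCov P (V₁ * rectDiag Ns Nd a * Φ)
      = U₁ * rectDiag Nr Nr (fun i => 1 + l₁ i ^ 2 * a i ^ 2) * U₁ᴴ := by
  have e1 : P * (V₁ * rectDiag Ns Nd a * Φ) = U₁ * rectDiag Nr Nd (fun i => l₁ i * a i) * Φ := by
    rw [← rectDiag_mul_rectDiag (k := Ns) l₁ a fun i _ _ hi => by
      rw [hP.eq_zero i ((min_le_right _ _).trans hi), zero_mul]]
    conv_lhs => rw [hP.eq]
    calc _ = U₁ * rectDiag Nr Ns l₁ * (V₁ᴴ * V₁) * rectDiag Ns Nd a * Φ := by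
          simp only [Matrix.mul_assoc]
      _ = _ := by
          rw [unitary_conjTranspose_mul hP.unitary_right, Matrix.mul_one]
          simp only [Matrix.mul_assoc]
  have e2 : rectDiag Nr Nd (fun i => l₁ i * a i) * rectDiag Nd Nr (fun i => l₁ i * a i)
      = rectDiag Nr Nr fun i => l₁ i ^ 2 * a i ^ 2 := by
    rw [rectDiag_mul_rectDiag]
    · congr 1
      ext i
      ring
    · intro i _ _ hi
      rw [ha i hi, mul_zero, mul_zero]
  have e3 : rectDiag Nr Nr (fun i => 1 + l₁ i ^ 2 * a i ^ 2)
      = 1 + rectDiag Nr Nr fun i => l₁ i ^ 2 * a i ^ 2 := by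
    rw [rectDiag_square, rectDiag_square, ← diagonal_one, diagonal_add]
    congr 1
    ext i
    push_cast
    rfl
  rw [hopCov, e1, e3, Matrix.mul_add, Matrix.add_mul, Matrix.mul_one,
    unitary_mul_conjTranspose hP.unitary_left, ← e2, conjTranspose_mul, conjTranspose_mul,
    rectDiag_conjTranspose]
  congr 1
  calc _ = U₁ * rectDiag Nr Nd (fun i => l₁ i * a i) * (Φ * Φᴴ) *
        rectDiag Nd Nr (fun i => l₁ i * a i) * U₁ᴴ := by simp only [Matrix.mul_assoc]
    _ = _ := by
        rw [unitary_mul_conjTranspose hΦ, Matrix.mul_one]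
        simp only [Matrix.mul_assoc]

theorem frame_conj {m n : ℕ} {W : Matrix (Fin m) (Fin m) ℂ} {U : Matrix (Fin n) (Fin n) ℂ}
    (hU : U ∈ unitaryGroup (Fin n) ℂ) (c : ℕ → ℝ) (hb : ∀ i, i < m → n ≤ i → b i = 0) :
    (W * rectDiag m n b * Uᴴ) * (U * rectDiag n n c * Uᴴ) * (W * rectDiag m n b * Uᴴ)ᴴ
      = W * rectDiag m m (fun i => b i ^ 2 * c i) * Wᴴ := by
  have e : rectDiag m n b * rectDiag n n c * rectDiag n m b
      = rectDiag m m fun i => b i ^ 2 * c i := by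
    rw [rectDiag_mul_rectDiag b c fun i _ hi hle => absurd (hi.trans_le hle) (lt_irrefl i),
      rectDiag_mul_rectDiag]
    · congr 1
      ext i
      ring
    · intro i hi _ hle
      rw [hb i hi hle, mul_zero]
  rw [← e, conjTranspose_mul, conjTranspose_mul, rectDiag_conjTranspose,
    conjTranspose_conjTranspose]
  calc _ = W * rectDiag m n b * (Uᴴ * U) * rectDiag n n c * (Uᴴ * U) * rectDiag n m b * Wᴴ := by
        simp only [Matrix.mul_assoc]
    _ = _ := by
        rw [unitary_conjTranspose_mul hU, Matrix.mul_one, Matrix.mul_one]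
        simp only [Matrix.mul_assoc]

/-- In the singular bases all factors are diagonal. A second-hop gain without a relay antenna meets
a zero singular value, so no admissibility of `b` is needed. -/
theorem linkRatio_frame (hP : IsSVD P U₁ l₁ V₁) (hQ : IsSVD Q U₂ l₂ V₂)
    (hΦ : Φ ∈ unitaryGroup (Fin Nd) ℂ) (ha : ∀ i, Nd ≤ i → a i = 0) :
    linkRatio P Q (V₁ * rectDiag Ns Nd a * Φ) (V₂ * rectDiag Nr Nr b * U₁ᴴ)
      = ∏ i : Fin Nd, (1 + l₂ i ^ 2 * b i ^ 2) /
          (1 + l₂ i ^ 2 * b i ^ 2 * (1 + l₁ i ^ 2 * a i ^ 2)) := by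
  have e1 : Q * (V₂ * rectDiag Nr Nr b * U₁ᴴ)
      = U₂ * rectDiag Nd Nr (fun i => l₂ i * b i) * U₁ᴴ := by
    rw [← rectDiag_mul_rectDiag (k := Nr) l₂ b fun i _ hi hle =>
      absurd (hi.trans_le hle) (lt_irrefl i)]
    conv_lhs => rw [hQ.eq]
    calc _ = U₂ * rectDiag Nd Nr l₂ * (V₂ᴴ * V₂) * rectDiag Nr Nr b * U₁ᴴ := by
          simp only [Matrix.mul_assoc]
      _ = _ := by
          rw [unitary_conjTranspose_mul hQ.unitary_right, Matrix.mul_one]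
          simp only [Matrix.mul_assoc]
  have hz : ∀ i, i < Nd → Nr ≤ i → l₂ i * b i = 0 := fun i _ hi => by
    rw [hQ.eq_zero i ((min_le_right _ _).trans hi), zero_mul]
  have hone : U₁ * rectDiag Nr Nr (fun _ => 1) * U₁ᴴ = 1 := by
    rw [rectDiag_square]
    simp [unitary_mul_conjTranspose hP.unitary_left]
  have e2 := frame_conj (W := U₂) hP.unitary_left (fun _ => 1) hz
  rw [hone, Matrix.mul_one] at e2
  rw [linkRatio, hopCov_svd_frame hP hΦ ha, e1, e2, frame_conj hP.unitary_left _ hz,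
    det_one_add_unitary_conj hQ.unitary_left, det_one_add_unitary_conj hQ.unitary_left,
    ← Finset.prod_div_distrib]
  refine Finset.prod_congr rfl fun i _ => ?_
  simp only [mul_pow, mul_one]

theorem trace_hopCov_svd_frame (hP : IsSVD P U₁ l₁ V₁) (hV₂ : V₂ ∈ unitaryGroup (Fin Nr) ℂ)
    (hΦ : Φ ∈ unitaryGroup (Fin Nd) ℂ) (ha : ∀ i, Nd ≤ i → a i = 0) :
    ((V₂ * rectDiag Nr Nr b * U₁ᴴ) * hopCov P (V₁ * rectDiag Ns Nd a * Φ) *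
        (V₂ * rectDiag Nr Nr b * U₁ᴴ)ᴴ).trace.re
      = ∑ i : Fin Nr, b i ^ 2 * (1 + l₁ i ^ 2 * a i ^ 2) := by
  rw [hopCov_svd_frame hP hΦ ha, frame_conj hP.unitary_left _ fun i hi hle =>
    absurd (hi.trans_le hle) (lt_irrefl i), trace_unitary_conj hV₂]

end Parallel

/-! ### Change of variables from gains to powers -/

namespace RelayModel

variable {Ns Nr Nd : ℕ} {M : RelayModel Ns Nr Nd}

/-! The scalar and the logarithmic power-allocation problems. -/

theorem scalarObj_eq_prod (hσ : 0 < M.σs) (l1 l2 : ℕ → ℝ) (ls lr : Fin Nd → ℝ) :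
    M.scalarObj l1 l2 ls lr = (M.σs ^ 2) ^ Nd * ∏ i : Fin Nd, (1 + l2 i ^ 2 * lr i ^ 2) /
      (1 + l2 i ^ 2 * lr i ^ 2 * (1 + l1 i ^ 2 * (M.σs * ls i) ^ 2)) := by
  have hc : (M.σs ^ 2) ^ Nd = ∏ _i : Fin Nd, M.σs ^ 2 := by simp
  rw [scalarObj, hc, ← Finset.prod_mul_distrib]
  refine Finset.prod_congr rfl fun i _ => ?_
  have h1 : 0 < 1 + l2 i ^ 2 * lr i ^ 2 := by positivity
  have h2 : 0 < 1 + l2 i ^ 2 * lr i ^ 2 * (1 + l1 i ^ 2 * (M.σs * ls i) ^ 2) := by positivity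
  have h3 : (M.σs ^ 2)⁻¹ + l1 i ^ 2 * l2 i ^ 2 * ls i ^ 2 * lr i ^ 2 / (l2 i ^ 2 * lr i ^ 2 + 1)
      = (1 + l2 i ^ 2 * lr i ^ 2 * (1 + l1 i ^ 2 * (M.σs * ls i) ^ 2)) /
        (M.σs ^ 2 * (1 + l2 i ^ 2 * lr i ^ 2)) := by
    have : l2 i ^ 2 * lr i ^ 2 + 1 ≠ 0 := by positivity
    field_simp
    ring
  rw [h3, inv_div, mul_div_assoc]

/-- Numerator and denominator of the logarithm's argument share the factor `1 + l1² σ_s² ls²`; after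
cancelling, the reciprocal of the scalar mode factor remains. -/
theorem scalarObj_eq_exp (hσ : 0 < M.σs) (l1 l2 : ℕ → ℝ) (ls lr : Fin Nd → ℝ) :
    M.scalarObj l1 l2 ls lr
      = (M.σs ^ 2) ^ Nd * Real.exp (-powerObj l1 l2 (M.xOf ls) (M.yOf l1 ls lr)) := by
  rw [scalarObj_eq_prod hσ, powerObj, ← Finset.sum_neg_distrib, Real.exp_sum]
  congr 1
  refine Finset.prod_congr rfl fun i _ => ?_
  have h1 : 0 < 1 + l2 i ^ 2 * lr i ^ 2 := by positivity
  have h2 : 0 < 1 + l2 i ^ 2 * lr i ^ 2 * (1 + l1 i ^ 2 * (M.σs * ls i) ^ 2) := by positivity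
  have h3 : 0 < 1 + l1 i ^ 2 * (M.σs * ls i) ^ 2 := by positivity
  set x := M.xOf ls i with hx
  set y := M.yOf l1 ls lr i with hy
  have hden : y * l2 i ^ 2 + x * l1 i ^ 2 + 1
      = (1 + l1 i ^ 2 * (M.σs * ls i) ^ 2) * (1 + l2 i ^ 2 * lr i ^ 2) := by
    rw [hx, hy, xOf, yOf]; ring
  have hnum : y * l2 i ^ 2 * x * l1 i ^ 2 + y * l2 i ^ 2 + x * l1 i ^ 2 + 1
      = (1 + l1 i ^ 2 * (M.σs * ls i) ^ 2)
        * (1 + l2 i ^ 2 * lr i ^ 2 * (1 + l1 i ^ 2 * (M.σs * ls i) ^ 2)) := by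
    rw [hx, hy, xOf, yOf]; ring
  rw [hden, hnum, mul_div_mul_left _ _ h3.ne', Real.exp_neg, Real.exp_log (div_pos h2 h1), inv_div]

/-- `x` determines `ls`, and then `y` is a known positive multiple of `lr²`; both relations are
inverted by square roots. This surjectivity makes the two scalar problems equivalent. -/
theorem exists_gains (hσ : 0 < M.σs) (l1 : ℕ → ℝ) {x y : Fin Nd → ℝ} (hx : ∀ i, 0 ≤ x i)
    (hy : ∀ i, 0 ≤ y i) : ∃ ls lr : Fin Nd → ℝ, (∀ i, 0 ≤ ls i) ∧ (∀ i, 0 ≤ lr i) ∧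
      M.xOf ls = x ∧ M.yOf l1 ls lr = y := by
  have hd : ∀ i, 0 < x i * l1 i ^ 2 + 1 := fun i =>
    add_pos_of_nonneg_of_pos (mul_nonneg (hx i) (sq_nonneg _)) one_pos
  have h1 : ∀ i, M.σs ^ 2 * (Real.sqrt (x i) / M.σs) ^ 2 = x i := fun i => by
    rw [div_pow, Real.sq_sqrt (hx i)]
    field_simp
  refine ⟨fun i => Real.sqrt (x i) / M.σs, fun i => Real.sqrt (y i / (x i * l1 i ^ 2 + 1)),
    fun i => div_nonneg (Real.sqrt_nonneg _) hσ.le, fun i => Real.sqrt_nonneg _, funext h1,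
    funext fun i => ?_⟩
  rw [yOf, h1, Real.sq_sqrt (div_nonneg (hy i) (hd i).le), div_mul_cancel₀ _ (hd i).ne']

theorem scalarFeasible_iff (l1 : ℕ → ℝ) (ls lr : Fin Nd → ℝ) :
    M.ScalarFeasible l1 ls lr ↔ M.PowerFeasible (M.xOf ls) (M.yOf l1 ls lr) := by
  refine ⟨fun h => ⟨fun i => ?_, fun i => ?_, h.1, h.2⟩, fun h => ⟨h.2.2.1, h.2.2.2⟩⟩
  · rw [xOf]; positivity
  · rw [yOf]; positivity

theorem isScalarOptimal_iff (hσ : 0 < M.σs) (l1 l2 : ℕ → ℝ) (ls lr : Fin Nd → ℝ) :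
    M.IsScalarOptimal l1 l2 ls lr ↔ M.IsPowerOptimal l1 l2 (M.xOf ls) (M.yOf l1 ls lr) := by
  have hpos : 0 < (M.σs ^ 2) ^ Nd := by positivity
  have key : ∀ ls' lr', M.scalarObj l1 l2 ls lr ≤ M.scalarObj l1 l2 ls' lr' ↔
      powerObj l1 l2 (M.xOf ls') (M.yOf l1 ls' lr')
        ≤ powerObj l1 l2 (M.xOf ls) (M.yOf l1 ls lr) := by
    intro ls' lr'
    rw [scalarObj_eq_exp hσ, scalarObj_eq_exp hσ, mul_le_mul_iff_right₀ hpos, Real.exp_le_exp,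
      neg_le_neg_iff]
  refine ⟨fun h => ⟨(scalarFeasible_iff _ _ _).mp h.1, fun x' y' hf => ?_⟩,
    fun h => ⟨(scalarFeasible_iff _ _ _).mpr h.1, fun ls' lr' hf =>
      (key _ _).mpr (h.2 _ _ ((scalarFeasible_iff _ _ _).mp hf))⟩⟩
  obtain ⟨ls', lr', -, -, rfl, rfl⟩ := exists_gains hσ l1 hf.1 hf.2.1
  exact (key _ _).mp (h.2 _ _ ((scalarFeasible_iff _ _ _).mpr hf))

end RelayModel

/-! ### Structured precoders and the scalar problem -/

namespace RelayModel

variable {Ns Nr Nd : ℕ} {M : RelayModel Ns Nr Nd}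

theorem Regular.exists_isWhitened (h : M.Regular)
    {UCsr : Matrix (Fin Nr) (Fin Nr) ℂ} {dsr : Fin Nr → ℝ} (hsr : IsEVD M.Sigmasr UCsr dsr)
    {UCrd : Matrix (Fin Nd) (Fin Nd) ℂ} {drd : Fin Nd → ℝ} (hrd : IsEVD M.SigmardT UCrd drd) :
    ∃ L L', M.IsWhitened L (invSqrtDiag (M.eigSr dsr) * UCsrᴴ) L' (M.whitenedSr UCsr dsr)
      (M.whitenedRd UCrd drd) := by
  have hP : M.σs ^ 2 * (M.Ps / M.σs ^ 2) = M.Ps := mul_div_cancel₀ _ (pow_pos h.σs_pos 2).ne'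
  have e1 : ∀ i, 0 < M.σs ^ 2 * (M.Ps / M.σs ^ 2) * dsr i + M.σnsr ^ 2 := fun i => by
    rw [hP]
    exact add_pos_of_nonneg_of_pos
      (mul_nonneg h.Ps_pos.le (eigenvalues_nonneg_of_isEVD hsr h.posSemidef_sr i))
      (pow_pos h.σnsr_pos 2)
  have e2 : ∀ i, 0 < M.Pr * drd i + M.σnrd ^ 2 := fun i =>
    add_pos_of_nonneg_of_pos
      (mul_nonneg h.Pr_pos.le (eigenvalues_nonneg_of_isEVD hrd h.posSemidef_rdT i))
      (pow_pos h.σnrd_pos 2)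
  obtain ⟨L, hL, hL1, hL2⟩ := exists_whitening hsr e1
  obtain ⟨L', hL', hL1', -⟩ := exists_whitening hrd e2
  rw [hP] at hL
  change L * (invSqrtDiag (M.eigSr dsr) * UCsrᴴ) = 1 at hL1
  change L' * (invSqrtDiag (M.eigRd drd) * UCrdᴴ) = 1 at hL1'
  refine ⟨L, L', hL1, hL2, hL, hL', ?_, ?_, ?_⟩
  · exact isUnit_det_of_right_inverse hL1'
  · rw [whitenedSr, ← Matrix.mul_assoc, hL1, Matrix.one_mul]
  · rw [whitenedRd, ← Matrix.mul_assoc, hL1', Matrix.one_mul]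

namespace IsWhitened

variable {L K : Matrix (Fin Nr) (Fin Nr) ℂ} {L' : Matrix (Fin Nd) (Fin Nd) ℂ}
  {P : Matrix (Fin Nr) (Fin Ns) ℂ} {Q : Matrix (Fin Nd) (Fin Nr) ℂ}
  {U₁ V₂ : Matrix (Fin Nr) (Fin Nr) ℂ} {V₁ : Matrix (Fin Ns) (Fin Ns) ℂ}
  {U₂ Φ : Matrix (Fin Nd) (Fin Nd) ℂ} {l₁ l₂ : ℕ → ℝ} {ls lr : Fin Nd → ℝ}

theorem smul_sourcePrecoder : M.σs • sourcePrecoder V₁ ls Φ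
    = V₁ * rectDiag Ns Nd (fun i => M.σs * zeroExt ls i) * Φ := by
  rw [sourcePrecoder, ← smul_rectDiag, Matrix.mul_smul, Matrix.smul_mul]

theorem sourcePower_sourcePrecoder (hNs : Nd ≤ Ns) (hV₁ : V₁ ∈ unitaryGroup (Fin Ns) ℂ)
    (hΦ : Φ ∈ unitaryGroup (Fin Nd) ℂ) :
    M.sourcePower (sourcePrecoder V₁ ls Φ) = M.scalarSourcePower ls := by
  rw [← energy_smul_eq, smul_sourcePrecoder, energy_rectDiag_frame hV₁ hΦ hNs, scalarSourcePower]
  simp only [zeroExt_coe, mul_pow]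

theorem mul_zeroExt_of_le (i : ℕ) (hi : Nd ≤ i) : M.σs * zeroExt ls i = 0 := by
  rw [zeroExt_of_le ls hi, mul_zero]

/-- The relay power of the structured precoders with respect to the full-power noise. -/
theorem trace_structured (hP : IsSVD P U₁ l₁ V₁) (hV₂ : V₂ ∈ unitaryGroup (Fin Nr) ℂ)
    (hΦ : Φ ∈ unitaryGroup (Fin Nd) ℂ) :
    ((V₂ * rectDiag Nr Nr (zeroExt lr) * U₁ᴴ) * hopCov P (M.σs • sourcePrecoder V₁ ls Φ) *
        (V₂ * rectDiag Nr Nr (zeroExt lr) * U₁ᴴ)ᴴ).trace.re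
      = ∑ i : Fin Nr, zeroExt lr i ^ 2 * (1 + l₁ i ^ 2 * (M.σs * zeroExt ls i) ^ 2) := by
  rw [smul_sourcePrecoder, trace_hopCov_svd_frame hP hV₂ hΦ mul_zeroExt_of_le]

theorem scalarRelayPower_eq_sum : M.scalarRelayPower l₁ ls lr
    = ∑ i : Fin Nd, zeroExt lr i ^ 2 * (1 + l₁ i ^ 2 * (M.σs * zeroExt ls i) ^ 2) := by
  rw [scalarRelayPower]
  refine Finset.sum_congr rfl fun i _ => ?_
  rw [zeroExt_coe, zeroExt_coe]
  ring

theorem linkRatio_structured (h : M.Regular) (hP : IsSVD P U₁ l₁ V₁) (hQ : IsSVD Q U₂ l₂ V₂)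
    (hΦ : Φ ∈ unitaryGroup (Fin Nd) ℂ) :
    (M.σs ^ 2) ^ Nd * linkRatio P Q (M.σs • sourcePrecoder V₁ ls Φ)
      (V₂ * rectDiag Nr Nr (zeroExt lr) * U₁ᴴ) = M.scalarObj l₁ l₂ ls lr := by
  rw [smul_sourcePrecoder, linkRatio_frame hP hQ hΦ mul_zeroExt_of_le, scalarObj_eq_prod h.σs_pos]
  simp only [zeroExt_coe]

theorem structured_mul (w : M.IsWhitened L K L' P Q) :
    V₂ * rectDiag Nr Nr (zeroExt lr) * U₁ᴴ * K * L = V₂ * rectDiag Nr Nr (zeroExt lr) * U₁ᴴ := by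
  rw [Matrix.mul_assoc _ K, w.mul_right, Matrix.mul_one]

/-- Full source power makes the actual noise equal to the whitened one. Admissibility makes the
relay sum over `Nr` modes agree with the scalar sum over `Nd` modes. -/
theorem relayPower_structured (w : M.IsWhitened L K L' P Q) (h : M.Regular) (hNs : Nd ≤ Ns)
    (hP : IsSVD P U₁ l₁ V₁) (hV₂ : V₂ ∈ unitaryGroup (Fin Nr) ℂ)
    (hΦ : Φ ∈ unitaryGroup (Fin Nd) ℂ) (hlr : ∀ i : Fin Nd, Nr ≤ (i : ℕ) → lr i = 0)
    (hs : M.scalarSourcePower ls = M.Ps) :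
    M.relayPower (sourcePrecoder V₁ ls Φ) (V₂ * rectDiag Nr Nr (zeroExt lr) * U₁ᴴ * K)
      = M.scalarRelayPower l₁ ls lr := by
  have hs' : M.sourcePower (sourcePrecoder V₁ ls Φ) = M.Ps := by
    rw [sourcePower_sourcePrecoder hNs hP.unitary_right hΦ, hs]
  rw [w.relayPower_eq h _ hs', w.structured_mul, trace_structured hP hV₂ hΦ,
    scalarRelayPower_eq_sum]
  refine sum_fin_eq_of_eq_zero (f := fun i : ℕ =>
    zeroExt lr i ^ 2 * (1 + l₁ i ^ 2 * (M.σs * zeroExt ls i) ^ 2)) fun i hi => ?_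
  have : zeroExt lr i = 0 := by
    by_cases hd : i < Nd
    · have := hlr ⟨i, hd⟩ (by simpa [hd.not_ge] using hi)
      rw [zeroExt, dif_pos hd, this]
    · exact zeroExt_of_le lr (not_lt.mp hd)
  rw [this]
  ring

theorem J_structured (w : M.IsWhitened L K L' P Q) (h : M.Regular) (hNs : Nd ≤ Ns)
    (hP : IsSVD P U₁ l₁ V₁) (hQ : IsSVD Q U₂ l₂ V₂)
    (hΦ : Φ ∈ unitaryGroup (Fin Nd) ℂ) (hlr : ∀ i : Fin Nd, Nr ≤ (i : ℕ) → lr i = 0)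
    (hs : M.scalarSourcePower ls = M.Ps) (hr : M.scalarRelayPower l₁ ls lr = M.Pr) :
    M.J (sourcePrecoder V₁ ls Φ) (V₂ * rectDiag Nr Nr (zeroExt lr) * U₁ᴴ * K)
      = M.scalarObj l₁ l₂ ls lr := by
  rw [w.J_eq_of_tight h (by rw [sourcePower_sourcePrecoder hNs hP.unitary_right hΦ, hs])
    (by rw [w.relayPower_structured h hNs hP hQ.unitary_right hΦ hlr hs, hr]), w.structured_mul,
    linkRatio_structured h hP hQ hΦ]

/-- Feasible gains give feasible structured precoders, whose objective does not exceed the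
scalar one. -/
theorem feasible_structured (w : M.IsWhitened L K L' P Q) (h : M.Regular) (hNs : Nd ≤ Ns)
    (hP : IsSVD P U₁ l₁ V₁) (hQ : IsSVD Q U₂ l₂ V₂)
    (hΦ : Φ ∈ unitaryGroup (Fin Nd) ℂ) (hf : M.ScalarFeasible l₁ ls lr) :
    M.Feasible (sourcePrecoder V₁ ls Φ) (V₂ * rectDiag Nr Nr (zeroExt lr) * U₁ᴴ * K) ∧
    M.J (sourcePrecoder V₁ ls Φ) (V₂ * rectDiag Nr Nr (zeroExt lr) * U₁ᴴ * K)
      ≤ M.scalarObj l₁ l₂ ls lr := by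
  have hs : M.sourcePower (sourcePrecoder V₁ ls Φ) ≤ M.Ps := by
    rw [sourcePower_sourcePrecoder hNs hP.unitary_right hΦ]
    exact hf.1
  have hfe : M.Feasible (sourcePrecoder V₁ ls Φ)
      (V₂ * rectDiag Nr Nr (zeroExt lr) * U₁ᴴ * K) := by
    refine ⟨hs, (w.relayPower_le h _ hs).trans ?_⟩
    rw [w.structured_mul, trace_structured hP hQ.unitary_right hΦ]
    refine le_trans ?_ hf.2
    set f : ℕ → ℝ := fun i => zeroExt lr i ^ 2 * (1 + l₁ i ^ 2 * (M.σs * zeroExt ls i) ^ 2) with hfd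
    have h0 : ∀ i, 0 ≤ f i := fun i => by simp only [hfd]; positivity
    have hz : ∀ i, Nd ≤ i → f i = 0 := fun i hi => by
      simp only [hfd, zeroExt_of_le lr hi]
      ring
    -- Without admissibility the matrix sum may lose terms when `Nr < Nd`. They are nonnegative, so
    -- the budget is still met; when `Nd ≤ Nr` the extra terms vanish.
    rw [scalarRelayPower_eq_sum]
    change ∑ i : Fin Nr, f i ≤ ∑ i : Fin Nd, f i
    rw [Fin.sum_univ_eq_sum_range, Fin.sum_univ_eq_sum_range]
    rcases le_total Nr Nd with hle | hle
    · exact Finset.sum_le_sum_of_subset_of_nonneg (Finset.range_subset_range.mpr hle)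
        fun i _ _ => h0 i
    · refine (Finset.sum_subset (Finset.range_subset_range.mpr hle) fun i _ hi => hz i ?_).ge
      simpa using hi
  refine ⟨hfe, (w.J_le h hfe).trans_eq ?_⟩
  rw [w.structured_mul, linkRatio_structured h hP hQ hΦ]

/-- Minimizers are structured if both channels are nonzero. -/
theorem exists_structured (w : M.IsWhitened L K L' P Q) (h : M.Regular)
    {Fs : Matrix (Fin Ns) (Fin Nd) ℂ} {Fr : Matrix (Fin Nr) (Fin Nr) ℂ}
    (hopt : M.IsOptimal Fs Fr) (hJ : M.J Fs Fr < (M.σs ^ 2) ^ Nd)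
    (hs : M.sourcePower Fs = M.Ps) (hr : M.relayPower Fs Fr = M.Pr) :
    ∃ U₁ l₁ V₁ U₂ l₂ V₂, IsSVD P U₁ l₁ V₁ ∧ IsSVD Q U₂ l₂ V₂ ∧
      ∃ (ls lr : Fin Nd → ℝ), ∃ Φ ∈ unitaryGroup (Fin Nd) ℂ, (∀ i, 0 ≤ ls i) ∧ (∀ i, 0 ≤ lr i) ∧
        (∀ i : Fin Nd, Nr ≤ (i : ℕ) → lr i = 0) ∧ Fs = sourcePrecoder V₁ ls Φ ∧
        Fr = V₂ * rectDiag Nr Nr (zeroExt lr) * U₁ᴴ * K := by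
  obtain ⟨R, hR, hRC⟩ := exists_posDef_sqrt (hopCov_posDef P (M.σs • Fs))
  obtain ⟨hmax, hgain⟩ := w.gain_max h hopt hJ hs hr hR hRC
  obtain ⟨he, -⟩ := w.J_eq_inv_gain h hs hr hR hRC
  obtain ⟨U₁, l₁, V₁, U₂, l₂, V₂, hP, hQ, r, s, t, hrNr, hrNd, hs0, ht0, Φ, hΦ, hF, hZ⟩ :=
    exists_svd_form (by rw [energy_smul_eq, hs]) he.le hmax hgain
  have hz : ∀ i, Nd ≤ i → zeroExt s i = 0 := fun i hi => zeroExt_of_le s (hrNd.trans hi)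
  set c : ℕ → ℝ := fun i => 1 + l₁ i ^ 2 * zeroExt s i ^ 2 with hc
  have hcpos : ∀ i, 0 < c i := fun i => by simp only [hc]; positivity
  -- `C` is diagonal in the basis `U₁`, hence so is its square root `R`. Thus the `R⁻¹` needed to
  -- recover `F_r` from `Z` can be absorbed into the diagonal factor.
  have hCU : hopCov P (M.σs • Fs) * U₁ = U₁ * diagonal fun i : Fin Nr => (c i : ℂ) := by
    rw [hF, hopCov_svd_frame hP hΦ hz, Matrix.mul_assoc, unitary_conjTranspose_mul hP.unitary_left,
      Matrix.mul_one, rectDiag_square]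
  have hRU := sqrt_mul_of_mul hR hRC (fun i => (hcpos i).le) hCU
  have hUR : rectDiag Nr Nr (fun i => (Real.sqrt (c i))⁻¹) * U₁ᴴ = U₁ᴴ * R⁻¹ := by
    have h1 : U₁ᴴ * R = rectDiag Nr Nr (fun i => Real.sqrt (c i)) * U₁ᴴ := by
      have := congrArg conjTranspose hRU
      rw [conjTranspose_mul, conjTranspose_mul, hR.1.eq] at this
      rw [this, rectDiag_square]
      congr 1
      simp [diagonal_conjTranspose, Pi.star_def]
    have h2 : rectDiag Nr Nr (fun i => (Real.sqrt (c i))⁻¹) *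
        rectDiag Nr Nr (fun i => Real.sqrt (c i)) = 1 := by
      rw [rectDiag_mul_rectDiag _ _ fun i _ hi hle => absurd (hi.trans_le hle) (lt_irrefl i),
        rectDiag_square, ← diagonal_one]
      congr 1
      ext i
      rw [inv_mul_cancel₀ (Real.sqrt_pos.mpr (hcpos i)).ne', Complex.ofReal_one]
    calc _ = rectDiag Nr Nr (fun i => (Real.sqrt (c i))⁻¹) * (U₁ᴴ * R) * R⁻¹ := by
          rw [Matrix.mul_assoc, Matrix.mul_assoc U₁ᴴ, mul_nonsing_inv _ hR.isUnit_det',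
            Matrix.mul_one]
      _ = _ := by rw [h1, ← Matrix.mul_assoc, h2, Matrix.one_mul]
  -- The gains undo the normalisation: `F = σ_s F_s` contributes `σ_s⁻¹`, and `F_r = Z R⁻¹ K`
  -- contributes `1 / √(c i)` in mode `i`.
  refine ⟨U₁, l₁, V₁, U₂, l₂, V₂, hP, hQ, fun i => M.σs⁻¹ * zeroExt s i,
    fun i => zeroExt t i * (Real.sqrt (c i))⁻¹, Φ, hΦ,
    fun i => mul_nonneg (inv_pos.mpr h.σs_pos).le (zeroExt_nonneg hs0 i),
    fun i => mul_nonneg (zeroExt_nonneg ht0 i) (inv_nonneg.mpr (Real.sqrt_nonneg _)),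
    fun i hi => ?_, ?_, ?_⟩
  · simp only [zeroExt_of_le t (hrNr.trans hi), zero_mul]
  · rw [sourcePrecoder, zeroExt_restrict (f := fun i => M.σs⁻¹ * zeroExt s i) fun i hi => by
        rw [hz i hi, mul_zero], ← smul_rectDiag, Matrix.mul_smul, Matrix.smul_mul, ← hF, smul_smul,
      inv_mul_cancel₀ h.σs_pos.ne', one_smul]
  · rw [zeroExt_restrict (f := fun i => zeroExt t i * (Real.sqrt (c i))⁻¹) fun i hi => by
        rw [zeroExt_of_le t (hrNd.trans hi), zero_mul],
      ← rectDiag_mul_rectDiag (k := Nr) _ _ fun i _ hi hle =>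
        absurd (hi.trans_le hle) (lt_irrefl i), Matrix.mul_assoc V₂, Matrix.mul_assoc (rectDiag _ _ _),
      hUR, ← Matrix.mul_assoc, ← Matrix.mul_assoc, ← hZ, Matrix.mul_assoc _ R,
      mul_nonsing_inv _ hR.isUnit_det', Matrix.mul_one, Matrix.mul_assoc, w.mul_left,
      Matrix.mul_one]

/-- Structured minimizers come from minimizers of the scalar problem. -/
theorem isScalarOptimal_of_structured (w : M.IsWhitened L K L' P Q) (h : M.Regular)
    (hNs : Nd ≤ Ns) (hP : IsSVD P U₁ l₁ V₁) (hQ : IsSVD Q U₂ l₂ V₂)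
    (hΦ : Φ ∈ unitaryGroup (Fin Nd) ℂ) (hlr : ∀ i : Fin Nd, Nr ≤ (i : ℕ) → lr i = 0)
    (hopt : M.IsOptimal (sourcePrecoder V₁ ls Φ) (V₂ * rectDiag Nr Nr (zeroExt lr) * U₁ᴴ * K))
    (hs : M.sourcePower (sourcePrecoder V₁ ls Φ) = M.Ps)
    (hr : M.relayPower (sourcePrecoder V₁ ls Φ) (V₂ * rectDiag Nr Nr (zeroExt lr) * U₁ᴴ * K)
      = M.Pr) :
    M.IsScalarOptimal l₁ l₂ ls lr ∧ M.scalarSourcePower ls = M.Ps ∧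
      M.scalarRelayPower l₁ ls lr = M.Pr ∧
      M.scalarObj l₁ l₂ ls lr
        = M.J (sourcePrecoder V₁ ls Φ) (V₂ * rectDiag Nr Nr (zeroExt lr) * U₁ᴴ * K) := by
  rw [sourcePower_sourcePrecoder hNs hP.unitary_right hΦ] at hs
  rw [w.relayPower_structured h hNs hP hQ.unitary_right hΦ hlr hs] at hr
  have hJ := w.J_structured h hNs hP hQ hΦ hlr hs hr
  refine ⟨⟨⟨hs.le, hr.le⟩, fun ls' lr' hf' => ?_⟩, hs, hr, hJ.symm⟩
  obtain ⟨hf, hle⟩ := w.feasible_structured h hNs hP hQ hΦ hf'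
  rw [← hJ]
  exact (hopt.2 _ _ hf).trans hle

/-- The scalar problem attains the minimum of the matrix problem with full power budgets. -/
theorem exists_gains_attaining (w : M.IsWhitened L K L' P Q) (h : M.Regular) (hNd : 0 < Nd)
    (hNr : 0 < Nr) (hNs : Nd ≤ Ns) (hP : IsSVD P U₁ l₁ V₁) (hQ : IsSVD Q U₂ l₂ V₂) :
    ∃ ls lr : Fin Nd → ℝ, (∀ i, 0 ≤ ls i) ∧ (∀ i, 0 ≤ lr i) ∧
      (∀ i : Fin Nd, Nr ≤ (i : ℕ) → lr i = 0) ∧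
      M.scalarSourcePower ls = M.Ps ∧ M.scalarRelayPower l₁ ls lr = M.Pr ∧
      ∀ Fs Fr, M.Feasible Fs Fr → M.scalarObj l₁ l₂ ls lr ≤ M.J Fs Fr := by
  by_cases hdeg : M.Hsr ≠ 0 ∧ M.HrdT ≠ 0
  · obtain ⟨Fs, Fr, hopt⟩ := w.exists_isOptimal h
    obtain ⟨hJ, hs, hr⟩ := h.tight_of_isOptimal hdeg.1 hdeg.2 hNd hopt
    obtain ⟨U₁', l₁', V₁', U₂', l₂', V₂', hP', hQ', ls, lr, Φ, hΦ, hls, hlr, hadm, rfl, rfl⟩ :=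
      w.exists_structured h hopt hJ hs hr
    -- The minimiser chooses its own decompositions; only their singular values matter for the
    -- gains, and these agree with the prescribed ones.
    obtain rfl := isSVD_singularValues_unique hP' hP
    obtain rfl := isSVD_singularValues_unique hQ' hQ
    obtain ⟨-, hs', hr', hobj⟩ := w.isScalarOptimal_of_structured h hNs hP' hQ' hΦ hadm hopt hs hr
    exact ⟨ls, lr, hls, hlr, hadm, hs', hr', fun A C hAC => hobj.trans_le (hopt.2 A C hAC)⟩
  · let e : Fin Nd := ⟨0, hNd⟩
    obtain ⟨ls, lr, hls, hlr, hx, hy⟩ := exists_gains (M := M) h.σs_pos l₁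
      (x := Pi.single e M.Ps) (y := Pi.single e M.Pr)
      (fun i => by
        rw [Pi.single_apply]
        split_ifs
        exacts [h.Ps_pos.le, le_rfl])
      (fun i => by
        rw [Pi.single_apply]
        split_ifs
        exacts [h.Pr_pos.le, le_rfl])
    have hs : M.scalarSourcePower ls = M.Ps := by
      change ∑ i, M.xOf ls i = M.Ps
      rw [hx, Finset.sum_pi_single']
      simp
    have hr : M.scalarRelayPower l₁ ls lr = M.Pr := by
      change ∑ i, M.yOf l₁ ls lr i = M.Pr
      rw [hy, Finset.sum_pi_single']
      simp
    have hadm : ∀ i : Fin Nd, Nr ≤ (i : ℕ) → lr i = 0 := by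
      intro i hi
      have hne : i ≠ e := fun hie => by
        rw [hie] at hi
        exact absurd hNr (not_lt.mpr hi)
      have := congrFun hy i
      rw [Pi.single_eq_of_ne hne, yOf] at this
      have hp : 0 < M.σs ^ 2 * ls i ^ 2 * l₁ i ^ 2 + 1 := by positivity
      simpa [hp.ne'] using this
    refine ⟨ls, lr, hls, hlr, hadm, hs, hr, fun Fs Fr _ => ?_⟩
    have h0 : ∀ (Fs : Matrix (Fin Ns) (Fin Nd) ℂ) Fr, M.Hbar Fr * Fs = 0 := by
      intro Fs Fr
      rw [Hbar]
      by_cases h1 : M.Hsr = 0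
      · simp [h1]
      · have h2 : M.HrdT = 0 := by
          by_contra h2
          exact hdeg ⟨h1, h2⟩
        simp [h2]
    rw [← w.J_structured h hNs hP hQ (one_mem _) hadm hs hr, h.J_eq_of_zero (h0 _ _),
      h.J_eq_of_zero (h0 _ _)]

end IsWhitened

theorem HrdT_ne_zero (h : M.Hrd ≠ 0) : M.HrdT ≠ 0 := by
  intro h0
  refine h ?_
  have h1 : M.T.det ≠ 0 := by
    rw [T, det_permutation]
    simp
  have := congrArg (M.T⁻¹ * ·) h0
  simpa [HrdT, ← Matrix.mul_assoc, nonsing_inv_mul _ h1.isUnit] using this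

end RelayModel

end

/-! ### The main theorem -/

theorem mainTheorem1 {Ns Nr Nd : ℕ} (hNd : 0 < Nd) (hNr : 0 < Nr) (hNs : Nd ≤ Ns)
    (M : RelayModel Ns Nr Nd)
    (hσs : 0 < M.σs) (hσnsr : 0 < M.σnsr) (hσnrd : 0 < M.σnrd)
    (hPs : 0 < M.Ps) (hPr : 0 < M.Pr)
    (hSigmasr : M.Sigmasr.PosSemidef) (hSigmard : M.Sigmard.PosSemidef)
    (hPsisr : M.Psisr = 1) (hPsird : M.Psird = 1)
    -- eigenvalue decompositions of the two receive-side error covariances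
    (UCsr : Matrix (Fin Nr) (Fin Nr) ℂ) (dsr : Fin Nr → ℝ) (hEVDsr : IsEVD M.Sigmasr UCsr dsr)
    (UCrd : Matrix (Fin Nd) (Fin Nd) ℂ) (drd : Fin Nd → ℝ) (hEVDrd : IsEVD M.SigmardT UCrd drd) :
    -- the minimum is attained, with both power constraints tight
    (∃ Fs Fr, M.IsOptimal Fs Fr ∧ M.alpha1 Fs = M.Ps / M.σs ^ 2 ∧ M.alpha2 Fs Fr = M.Pr) ∧
    -- every minimizer is tight and has the stated structure
    (M.Hsr ≠ 0 → M.Hrd ≠ 0 → ∀ Fs Fr, M.IsOptimal Fs Fr →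
      (M.sourcePower Fs = M.Ps ∧ M.relayPower Fs Fr = M.Pr ∧
        M.alpha1 Fs = M.Ps / M.σs ^ 2 ∧ M.alpha2 Fs Fr = M.Pr) ∧
      ∃ Usr l1 Vsr Urd l2 Vrd,
        IsSVD (M.whitenedSr UCsr dsr) Usr l1 Vsr ∧ IsSVD (M.whitenedRd UCrd drd) Urd l2 Vrd ∧
        ∃ (ls lr : Fin Nd → ℝ), ∃ Φ ∈ Matrix.unitaryGroup (Fin Nd) ℂ,
          (∀ i, 0 ≤ ls i) ∧ (∀ i, 0 ≤ lr i) ∧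
          Fs = RelayModel.sourcePrecoder Vsr ls Φ ∧
          Fr = M.relayPrecoder Vrd lr Usr UCsr dsr ∧
          M.IsScalarOptimal l1 l2 ls lr) ∧
    -- for any singular value decompositions of the whitened channels
    (∀ Usr l1 Vsr Urd l2 Vrd,
      IsSVD (M.whitenedSr UCsr dsr) Usr l1 Vsr → IsSVD (M.whitenedRd UCrd drd) Urd l2 Vrd →
      -- a tight minimizer of the stated structure exists, with an arbitrary unitary factor
      (∃ ls lr : Fin Nd → ℝ, (∀ i, 0 ≤ ls i) ∧ (∀ i, 0 ≤ lr i) ∧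
        M.IsScalarOptimal l1 l2 ls lr ∧
        M.scalarSourcePower ls = M.Ps ∧ M.scalarRelayPower l1 ls lr = M.Pr ∧
        ∀ Φ ∈ Matrix.unitaryGroup (Fin Nd) ℂ,
          M.IsOptimal (RelayModel.sourcePrecoder Vsr ls Φ)
            (M.relayPrecoder Vrd lr Usr UCsr dsr) ∧
          M.alpha1 (RelayModel.sourcePrecoder Vsr ls Φ) = M.Ps / M.σs ^ 2 ∧
          M.alpha2 (RelayModel.sourcePrecoder Vsr ls Φ)
            (M.relayPrecoder Vrd lr Usr UCsr dsr) = M.Pr) ∧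
      -- substituting the structure turns constraints and objective into the scalar ones
      (∀ ls lr : Fin Nd → ℝ, (∀ i : Fin Nd, Nr ≤ (i : ℕ) → lr i = 0) →
        ∀ Φ ∈ Matrix.unitaryGroup (Fin Nd) ℂ,
          M.sourcePower (RelayModel.sourcePrecoder Vsr ls Φ) = M.scalarSourcePower ls ∧
          (M.scalarSourcePower ls = M.Ps →
            M.relayPower (RelayModel.sourcePrecoder Vsr ls Φ)
              (M.relayPrecoder Vrd lr Usr UCsr dsr) = M.scalarRelayPower l1 ls lr ∧
            (M.scalarRelayPower l1 ls lr = M.Pr →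
              M.J (RelayModel.sourcePrecoder Vsr ls Φ)
                (M.relayPrecoder Vrd lr Usr UCsr dsr) = M.scalarObj l1 l2 ls lr))) ∧
      -- scalar minimizers give matrix minimizers, and conversely
      (∀ ls lr : Fin Nd → ℝ, M.IsScalarOptimal l1 l2 ls lr →
        ∀ Φ ∈ Matrix.unitaryGroup (Fin Nd) ℂ,
          M.IsOptimal (RelayModel.sourcePrecoder Vsr ls Φ)
            (M.relayPrecoder Vrd lr Usr UCsr dsr)) ∧
      (M.Hsr ≠ 0 → M.Hrd ≠ 0 →
        ∀ ls lr : Fin Nd → ℝ, (∀ i : Fin Nd, Nr ≤ (i : ℕ) → lr i = 0) →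
        ∀ Φ ∈ Matrix.unitaryGroup (Fin Nd) ℂ,
          M.IsOptimal (RelayModel.sourcePrecoder Vsr ls Φ)
            (M.relayPrecoder Vrd lr Usr UCsr dsr) →
          M.IsScalarOptimal l1 l2 ls lr) ∧
      -- the scalar problem is equivalent to the logarithmic power-allocation problem
      (∀ ls lr : Fin Nd → ℝ,
        M.scalarObj l1 l2 ls lr =
          (M.σs ^ 2) ^ Nd * Real.exp (-RelayModel.powerObj l1 l2 (M.xOf ls) (M.yOf l1 ls lr)) ∧
        (M.IsScalarOptimal l1 l2 ls lr ↔
          M.IsPowerOptimal l1 l2 (M.xOf ls) (M.yOf l1 ls lr))) ∧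
      (∀ x y : Fin Nd → ℝ, (∀ i, 0 ≤ x i) → (∀ i, 0 ≤ y i) →
        ∃ ls lr : Fin Nd → ℝ, (∀ i, 0 ≤ ls i) ∧ (∀ i, 0 ≤ lr i) ∧
          M.xOf ls = x ∧ M.yOf l1 ls lr = y)) := by
  have h : M.Regular :=
    ⟨hσs, hσnsr, hσnrd, hPs, hPr, hSigmasr, hSigmard, hPsisr, hPsird⟩
  obtain ⟨L, L', w⟩ := h.exists_isWhitened hEVDsr hEVDrd
  have hrel : ∀ (V : Matrix (Fin Nr) (Fin Nr) ℂ) (lr : Fin Nd → ℝ) (U : Matrix (Fin Nr) (Fin Nr) ℂ),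
      M.relayPrecoder V lr U UCsr dsr
        = V * rectDiag Nr Nr (zeroExt lr) * Uᴴ * (invSqrtDiag (M.eigSr dsr) * UCsrᴴ) := by
    intro V lr U
    rw [RelayModel.relayPrecoder, Matrix.mul_assoc _ (invSqrtDiag _)]
  have halpha : ∀ Fs : Matrix (Fin Ns) (Fin Nd) ℂ, M.sourcePower Fs = M.Ps →
      M.alpha1 Fs = M.Ps / M.σs ^ 2 := by
    intro Fs hs
    rw [h.alpha1_eq, ← hs, RelayModel.Regular.sourcePower_eq,
      mul_div_cancel_left₀ _ (pow_pos hσs 2).ne']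
  simp only [hrel]
  refine ⟨?_, ?_, ?_⟩
  · obtain ⟨Fs, Fr, hopt, hs, hr⟩ := w.exists_isOptimal_tight h (hNd.trans_le hNs) hNr hNd
    exact ⟨Fs, Fr, hopt, halpha Fs hs, by rw [h.alpha2_eq, hr]⟩
  · intro hsr hrd Fs Fr hopt
    obtain ⟨hJ, hs, hr⟩ := h.tight_of_isOptimal hsr (RelayModel.HrdT_ne_zero hrd) hNd hopt
    refine ⟨⟨hs, hr, halpha Fs hs, by rw [h.alpha2_eq, hr]⟩, ?_⟩
    obtain ⟨U₁, l₁, V₁, U₂, l₂, V₂, hP, hQ, ls, lr, Φ, hΦ, hls, hlr, hadm, rfl, rfl⟩ :=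
      w.exists_structured h hopt hJ hs hr
    exact ⟨U₁, l₁, V₁, U₂, l₂, V₂, hP, hQ, ls, lr, Φ, hΦ, hls, hlr, rfl, rfl,
      (w.isScalarOptimal_of_structured h hNs hP hQ hΦ hadm hopt hs hr).1⟩
  · intro U₁ l₁ V₁ U₂ l₂ V₂ hP hQ
    obtain ⟨ls₀, lr₀, hls₀, hlr₀, hadm₀, hs₀, hr₀, hbound⟩ :=
      w.exists_gains_attaining h hNd hNr hNs hP hQ
    refine ⟨⟨ls₀, lr₀, hls₀, hlr₀, ⟨⟨hs₀.le, hr₀.le⟩, fun ls lr hf => ?_⟩, hs₀, hr₀,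
      fun Φ hΦ => ?_⟩, fun ls lr hadm Φ hΦ => ?_, fun ls lr hopt Φ hΦ => ?_,
      fun hsr hrd ls lr hadm Φ hΦ hopt => ?_, fun ls lr => ?_, fun x y hx hy => ?_⟩
    -- The scalar value of the chosen gains bounds every feasible `J` from below, while competing
    -- scalar gains have structured precoders with `J` at most their scalar value.
    · obtain ⟨hf', hle⟩ := w.feasible_structured h hNs hP hQ (one_mem _) hf
      exact (hbound _ _ hf').trans hle
    · obtain ⟨hf, hle⟩ := w.feasible_structured h hNs hP hQ hΦ ⟨hs₀.le, hr₀.le⟩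
      refine ⟨⟨hf, fun Fs Fr hf' => hle.trans (hbound Fs Fr hf')⟩, halpha _ ?_, ?_⟩
      · rw [RelayModel.IsWhitened.sourcePower_sourcePrecoder hNs hP.unitary_right hΦ, hs₀]
      · rw [h.alpha2_eq, w.relayPower_structured h hNs hP hQ.unitary_right hΦ hadm₀ hs₀, hr₀]
    · exact ⟨RelayModel.IsWhitened.sourcePower_sourcePrecoder hNs hP.unitary_right hΦ, fun hs =>
        ⟨w.relayPower_structured h hNs hP hQ.unitary_right hΦ hadm hs, fun hr =>
          w.J_structured h hNs hP hQ hΦ hadm hs hr⟩⟩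
    -- Comparison runs through the tight gains `ls₀`, `lr₀`: `J` is at most the scalar minimum,
    -- which is at most their scalar value, which is at most any feasible `J`. No tightness of the
    -- given scalar minimiser is needed.
    · obtain ⟨hf, hle⟩ := w.feasible_structured h hNs hP hQ hΦ hopt.1
      exact ⟨hf, fun Fs Fr hf' => hle.trans
        ((hopt.2 ls₀ lr₀ ⟨hs₀.le, hr₀.le⟩).trans (hbound Fs Fr hf'))⟩
    · obtain ⟨-, hs, hr⟩ := h.tight_of_isOptimal hsr (RelayModel.HrdT_ne_zero hrd) hNd hopt
      exact (w.isScalarOptimal_of_structured h hNs hP hQ hΦ hadm hopt hs hr).1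
    · exact ⟨RelayModel.scalarObj_eq_exp hσs l₁ l₂ ls lr,
        RelayModel.isScalarOptimal_iff hσs l₁ l₂ ls lr⟩
    · exact RelayModel.exists_gains hσs l₁ hx hy
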